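/- Conventions. An operator algebra is a subalgebra $\mathcal{A}$ of $B(\mathcal{H})$, $\mathcal{H}$ a complex Hilbert space, with the norms of $\mathbb{M}_n(B(\mathcal H))=B(\mathcal H^{(n)})$ on $\mathbb{M}_n(\mathcal{A})$; it is unital if it is nonzero and contains the identity operator (norm closedness is not required). A representation is a completely contractive homomorphism. $\mathcal{A}$ is residually finite-dimensional (RFD) if there is a completely isometric homomorphism $\mathcal{A}\to\prod_{\lambda}\mathbb{M}_{r_\lambda}$ for some positive integers $r_\lambda$. A $\mathrm{C}^*$-cover of $\mathcal{A}$ is a pair $(\mathfrak{A},\iota)$, where $\mathfrak{A}$ is a $\mathrm{C}^*$-algebra and $\iota:\mathcal{A}\to\mathfrak{A}$ is a completely isometric homomorphism with $\mathfrak{A}=\mathrm{C}^*(\iota(\mathcal{A}))$; one writes $(\mathfrak{A},\iota)\preceq(\mathfrak{B},j)$ if there is a surjective $*$-homomorphism $\pi:\mathfrak{B}\to\mathfrak{A}$ with $\pi\circ j=\iota$. The RFD-maximal $\mathrm{C}^*$-cover $(\mathfrak{R}(\mathcal{A}),\upsilon)$ of an RFD operator algebra $\mathcal A$ is the element, unique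 up to equivalence of covers, which is maximal for $\preceq$ among the $\mathrm{C}^*$-covers $(\mathfrak{A},\iota)$ with $\mathfrak{A}$ RFD. The unital free product $\mathcal{A}*\mathcal{B}$ of unital operator algebras is a unital operator algebra generated, up to norm closure, by images of $\mathcal{A}$ and $\mathcal{B}$ under unital completely isometric homomorphisms $\iota,j$, such that for all unital representations $\pi:\mathcal{A}\to B(\mathcal{E})$ and $\theta:\mathcal{B}\to B(\mathcal{E})$ there is a unique unital representation $\sigma$ of $\mathcal{A}*\mathcal{B}$ on $\mathcal{E}$ with $\sigma\circ\iota=\pi$ and $\sigma\circ j=\theta$. For unital $\mathrm{C}^*$-algebras, $*$ denotes the unital $\mathrm{C}^*$-algebraic free product. Theorem. Let $\mathcal{A}$ and $\mathcal{B}$ be unital RFD operator algebras. Then $\mathfrak{R}(\mathcal{A})$, $\mathfrak{R}(\mathcal{B})$, $\mathcal{A}*\mathcal{B}$ and $\mathfrak{R}(\mathcal{A})*\mathfrak{R}(\mathcal{B})$ exist, $\mathcal{A}*\mathcal{B}$ is RFD (so that $\mathfrak{R}(\mathcal{A}*\mathcal{B})$ exists), and there is a $*$-isomorphism \[\mathfrak{R}(\mathcal{A}*\mathcal{B})\cong\mathfrak{R}(\mathcal{A})*\mathfrak{R}(\mathcal{B}).\]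 -/

import Mathlib

universe u v w

section OperatorAlgebras

variable {M : Type u} [CStarAlgebra M] {N : Type v} [CStarAlgebra N]

/-- The norm of an `n × n` matrix over a C*-algebra `M`, that is, the C*-norm of `𝕄ₙ(M)`; for
`M = B(H)` this is the operator norm of `B(H ⊕ ⋯ ⊕ H)`. (Mathlib's norm on `CStarMatrix` mentions
the order of `M`, so we supply the canonical one.) -/
noncomputable def matNorm {n : ℕ} (X : Matrix (Fin n) (Fin n) M) : ℝ :=
  letI := CStarAlgebra.spectralOrder M
  letI := CStarAlgebra.spectralOrderedRing M
  ‖CStarMatrix.ofMatrix X‖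

/-- `f⁽ⁿ⁾ : 𝕄ₙ(A) → 𝕄ₙ(N)` is contractive for every `n`. -/
def CompletelyContractive (A : Subalgebra ℂ M) (f : A → N) : Prop :=
  ∀ (n : ℕ) (X : Matrix (Fin n) (Fin n) A), matNorm (X.map f) ≤ matNorm (X.map Subtype.val)

/-- `f⁽ⁿ⁾ : 𝕄ₙ(A) → 𝕄ₙ(N)` is isometric for every `n`. -/
def CompletelyIsometric (A : Subalgebra ℂ M) (f : A → N) : Prop :=
  ∀ (n : ℕ) (X : Matrix (Fin n) (Fin n) A), matNorm (X.map f) = matNorm (X.map Subtype.val)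

/-- Residual finite-dimensionality: there is a completely isometric homomorphism of `A` into an
`ℓ^∞`-product of full matrix algebras `𝕄_{r l} = B(ℂ^{r l})`, i.e. a family of (not necessarily
unital) homomorphisms `ρ l : A → B(ℂ^{r l})` with `‖X‖ = sup_l ‖(ρ l)⁽ⁿ⁾ X‖` for all `n` and all
`X ∈ 𝕄ₙ(A)`. A C*-algebra `R` is RFD if `⊤ : Subalgebra ℂ R` is. -/
def IsRFD (A : Subalgebra ℂ M) : Prop :=
  ∃ (Λ : Type u) (r : Λ → ℕ)
    (ρ : ∀ l, A →ₙₐ[ℂ] (EuclideanSpace ℂ (Fin (r l)) →L[ℂ] EuclideanSpace ℂ (Fin (r l)))),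
    (∀ l, 0 < r l) ∧
      ∀ (n : ℕ) (X : Matrix (Fin n) (Fin n) A),
        IsLUB (Set.range fun l => matNorm (X.map (ρ l))) (matNorm (X.map Subtype.val))

/-- `(N, ι)` is a C*-cover of the unital operator algebra `A`: `ι` is a completely isometric
homomorphism and `N = C*(ι(A))`. (The unit of `C*(ι(A))` is `ι 1`, so `ι` is unital.) -/
structure IsCStarCover (A : Subalgebra ℂ M) (ι : A →ₐ[ℂ] N) : Prop where
  isometric : CompletelyIsometric A ι
  generates : (StarAlgebra.adjoin ℂ (Set.range ι)).topologicalClosure = ⊤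

/-- The ordering `(N₁, ι) ≼ (N₂, j)` of C*-covers: there is a surjective `*`-homomorphism
`π : N₂ → N₁` with `π ∘ j = ι`. -/
def CoverLE {N₁ : Type v} [CStarAlgebra N₁] {N₂ : Type w} [CStarAlgebra N₂]
    {A : Subalgebra ℂ M} (ι : A →ₐ[ℂ] N₁) (j : A →ₐ[ℂ] N₂) : Prop :=
  ∃ π : N₂ →⋆ₐ[ℂ] N₁, Function.Surjective π ∧ ∀ a, π (j a) = ι a

/-- `(R, υ)` is the RFD-maximal C*-cover of `A`: it is a C*-cover, `R` is RFD, and it is maximal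
among the C*-covers of `A` by RFD C*-algebras. -/
structure IsRFDMaximalCover {R : Type u} [CStarAlgebra R] (A : Subalgebra ℂ M)
    (υ : A →ₐ[ℂ] R) : Prop where
  cover : IsCStarCover A υ
  rfd : IsRFD (⊤ : Subalgebra ℂ R)
  maximal : ∀ (S : Type u) [CStarAlgebra S] (τ : A →ₐ[ℂ] S),
    IsCStarCover A τ → IsRFD (⊤ : Subalgebra ℂ S) → CoverLE υ τ → CoverLE τ υ

/-- The RFD-maximal C*-cover of `A` exists. -/
def HasRFDMaximalCover (A : Subalgebra ℂ M) : Prop :=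
  ∃ (R : Type u) (_ : CStarAlgebra R) (υ : A →ₐ[ℂ] R), IsRFDMaximalCover A υ

end OperatorAlgebras

section FreeProducts

/-- `(P, ι, j)` is the unital free product of the unital operator algebras `A` and `B`: the unital
completely isometric homomorphisms `ι`, `j` have images generating `P` (a dense subalgebra), and
any two unital representations of `A` and `B` on the same Hilbert space factor through a unique
unital representation of `P`. -/
structure IsFreeProduct {M₁ M₂ M₃ : Type u} [CStarAlgebra M₁] [CStarAlgebra M₂] [CStarAlgebra M₃]
    (A : Subalgebra ℂ M₁) (B : Subalgebra ℂ M₂) (P : Subalgebra ℂ M₃)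
    (ι : A →ₐ[ℂ] P) (j : B →ₐ[ℂ] P) : Prop where
  isometric_left : CompletelyIsometric A fun a => (ι a : M₃)
  isometric_right : CompletelyIsometric B fun b => (j b : M₃)
  generates : Dense (Algebra.adjoin ℂ (Set.range ι ∪ Set.range j) : Set P)
  universal : ∀ (E : Type u) [NormedAddCommGroup E] [InnerProductSpace ℂ E] [CompleteSpace E]
    (π : A →ₐ[ℂ] (E →L[ℂ] E)) (θ : B →ₐ[ℂ] (E →L[ℂ] E)),
    CompletelyContractive A π → CompletelyContractive B θ →
      ∃! σ : P →ₐ[ℂ] (E →L[ℂ] E),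
        CompletelyContractive P σ ∧ (∀ a, σ (ι a) = π a) ∧ ∀ b, σ (j b) = θ b

/-- `(F, r, s)` is the unital C*-algebraic free product of the unital C*-algebras `R` and `S`. -/
structure IsCStarFreeProduct {R S F : Type u} [CStarAlgebra R] [CStarAlgebra S] [CStarAlgebra F]
    (r : R →⋆ₐ[ℂ] F) (s : S →⋆ₐ[ℂ] F) : Prop where
  injective_left : Function.Injective r
  injective_right : Function.Injective s
  generates : (StarAlgebra.adjoin ℂ (Set.range r ∪ Set.range s)).topologicalClosure = ⊤
  universal : ∀ (D : Type u) [CStarAlgebra D] (π : R →⋆ₐ[ℂ] D) (θ : S →⋆ₐ[ℂ] D),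
    ∃! σ : F →⋆ₐ[ℂ] D, (∀ x, σ (r x) = π x) ∧ ∀ y, σ (s y) = θ y

/-- The unital free product of `A` and `B` exists as an algebra of operators on a Hilbert space. -/
def HasFreeProduct {M₁ M₂ : Type u} [CStarAlgebra M₁] [CStarAlgebra M₂]
    (A : Subalgebra ℂ M₁) (B : Subalgebra ℂ M₂) : Prop :=
  ∃ (L : Type u) (_ : NormedAddCommGroup L) (_ : InnerProductSpace ℂ L) (_ : CompleteSpace L)
    (P : Subalgebra ℂ (L →L[ℂ] L)) (ι : A →ₐ[ℂ] P) (j : B →ₐ[ℂ] P), IsFreeProduct A B P ι j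

/-- The unital C*-algebraic free product of `R` and `S` exists. -/
def HasCStarFreeProduct (R S : Type u) [CStarAlgebra R] [CStarAlgebra S] : Prop :=
  ∃ (F : Type u) (_ : CStarAlgebra F) (r : R →⋆ₐ[ℂ] F) (s : S →⋆ₐ[ℂ] F), IsCStarFreeProduct r s

end FreeProducts

/-! Let `FinCover A` be the C*-algebra generated by A inside the product of all its unital
completely contractive representations on matrix algebras. A unital completely contractive
homomorphism from A into an RFD C*-algebra S extends to `FinCover A`, because composing it with a
finite-dimensional representation of S gives a coordinate of the product. Hence `FinCover A` is an
RFD-maximal cover, and every RFD-maximal cover inherits its universal property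
(`IsRFDMaximalCover.exists_starHom`).

Once A * B and R(A) * R(B) are known to be RFD, the isomorphism is formal: the universal properties
give *-homomorphisms in both directions, and these are mutually inverse on generators. The work lies
in one estimate: matrices of noncommutative polynomials in two completely contractive
representations π, θ of A, B on one Hilbert space are bounded by the supremum over pairs of
finite-dimensional representations on a common space (`matNorm_pairEval_le_of_finRep`). This also
yields the free products, as algebras generated in the product over all such pairs.

The first half of the estimate is dilation (`exists_common_dilation`). Extension and Stinespring
arguments dilate π and θ separately to *-representations of the covers, on unrelated spaces. The
original space E is semi-invariant in each, so both dilations can be moved to one space E ⊕ Z ⊕ Z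
where they are triangular for the same decomposition, the unused room being filled with multiples of
finite-dimensional representations. The compression to E is then multiplicative on words mixing A
and B.

The second half is approximation (`matNorm_pairEval_le_of_finite`). By Hahn–Banach separation,
matrix coefficients of any representation of an RFD C*-algebra are limits of coefficients of
finite-dimensional ones. An inverse square root makes the approximate embeddings isometric,
amplification puts two approximations on one space, and controlling a*a as well as a upgrades weak
to strong convergence, which survives products. -/

open scoped InnerProductSpace ComplexOrder ENNReal

/-! ### Matrix norms and *-homomorphisms. -/

section MatNorm

variable {M : Type*} [CStarAlgebra M] {N : Type*} [CStarAlgebra N]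

theorem matNorm_nonneg {n : ℕ} (X : Matrix (Fin n) (Fin n) M) : 0 ≤ matNorm X := by
  let _ := CStarAlgebra.spectralOrder M
  let _ := CStarAlgebra.spectralOrderedRing M
  exact norm_nonneg (CStarMatrix.ofMatrix X)

theorem continuous_matNorm {n : ℕ} :
    Continuous (matNorm : Matrix (Fin n) (Fin n) M → ℝ) := by
  let _ := CStarAlgebra.spectralOrder M
  let _ := CStarAlgebra.spectralOrderedRing M
  exact continuous_norm.comp (CStarMatrix.ofMatrixL (m := Fin n) (n := Fin n) (A := M)).continuous

/-- Entrywise application of a `*`-homomorphism to matrices over a C*-algebra. -/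
noncomputable def starMapMatrix {n : ℕ} (φ : M →⋆ₐ[ℂ] N) :
    CStarMatrix (Fin n) (Fin n) M →⋆ₙₐ[ℂ] CStarMatrix (Fin n) (Fin n) N :=
  CStarMatrix.mapₙₐ (R := ℂ) (φ : M →⋆ₙₐ[ℂ] N)

theorem matNorm_map_le {n : ℕ} (φ : M →⋆ₐ[ℂ] N) (X : Matrix (Fin n) (Fin n) M) :
    matNorm (X.map φ) ≤ matNorm X := by
  let _ := CStarAlgebra.spectralOrder M
  let _ := CStarAlgebra.spectralOrderedRing M
  let _ := CStarAlgebra.spectralOrder N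
  let _ := CStarAlgebra.spectralOrderedRing N
  exact NonUnitalStarAlgHom.norm_apply_le (starMapMatrix φ) (CStarMatrix.ofMatrix X)

theorem matNorm_map_of_injective {n : ℕ} (φ : M →⋆ₐ[ℂ] N) (hφ : Function.Injective φ)
    (X : Matrix (Fin n) (Fin n) M) : matNorm (X.map φ) = matNorm X := by
  let _ := CStarAlgebra.spectralOrder M
  let _ := CStarAlgebra.spectralOrderedRing M
  let _ := CStarAlgebra.spectralOrder N
  let _ := CStarAlgebra.spectralOrderedRing N
  refine NonUnitalStarAlgHom.norm_map (starMapMatrix φ) ?_ (CStarMatrix.ofMatrix X)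
  exact CStarMatrix.map_injective hφ

open scoped ENNReal in
/-- A jointly injective family of `*`-homomorphisms is jointly completely norming. -/
theorem matNorm_le_of_forall_map {Λ : Type*} {D : Λ → Type*} [∀ l, CStarAlgebra (D l)]
    (φ : ∀ l, M →⋆ₐ[ℂ] D l) (hφ : ∀ x, (∀ l, φ l x = 0) → x = 0)
    {n : ℕ} (X : Matrix (Fin n) (Fin n) M) {C : ℝ} (hC : 0 ≤ C)
    (h : ∀ l, matNorm (X.map (φ l)) ≤ C) : matNorm X ≤ C := by
  let _ := CStarAlgebra.spectralOrder M
  let _ := CStarAlgebra.spectralOrderedRing M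
  let _ := fun l => CStarAlgebra.spectralOrder (D l)
  let _ := fun l => CStarAlgebra.spectralOrderedRing (D l)
  have hb (Y : CStarMatrix (Fin n) (Fin n) M) :
      Memℓp (fun l => starMapMatrix (φ l) Y) ∞ := by
    refine memℓp_infty ⟨‖Y‖, ?_⟩
    rintro _ ⟨l, rfl⟩
    exact NonUnitalStarAlgHom.norm_apply_le (starMapMatrix (φ l)) Y
  -- The whole family becomes one injective, hence isometric, *-homomorphism into an ℓ^∞-product of
  -- matrix algebras.
  let Ψ : CStarMatrix (Fin n) (Fin n) M →⋆ₙₐ[ℂ]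
      lp (fun l => CStarMatrix (Fin n) (Fin n) (D l)) ∞ :=
    { toFun := fun Y => ⟨fun l => starMapMatrix (φ l) Y, hb Y⟩
      map_smul' := fun c Y => by ext l : 2; exact map_smul (starMapMatrix (φ l)) c Y
      map_zero' := by ext l : 2; exact map_zero (starMapMatrix (φ l))
      map_add' := fun Y Z => by ext l : 2; exact map_add (starMapMatrix (φ l)) Y Z
      map_mul' := fun Y Z => by ext l : 2; exact map_mul (starMapMatrix (φ l)) Y Z
      map_star' := fun Y => by ext l : 2; exact map_star (starMapMatrix (φ l)) Y }
  have hΨ : Function.Injective Ψ := by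
    refine (injective_iff_map_eq_zero Ψ).2 fun Y hY => ?_
    refine CStarMatrix.ext fun i j => hφ _ fun l => ?_
    have h1 : starMapMatrix (φ l) Y = 0 := congrFun (congrArg Subtype.val hY) l
    exact congrFun (congrFun h1 i) j
  have h1 : ‖Ψ (CStarMatrix.ofMatrix X)‖ = ‖CStarMatrix.ofMatrix X‖ :=
    NonUnitalStarAlgHom.norm_map Ψ hΨ _
  refine (show ‖CStarMatrix.ofMatrix X‖ ≤ C from ?_)
  rw [← h1]
  exact lp.norm_le_of_forall_le hC h

theorem matNorm_diag (a : M) : matNorm (Matrix.of fun _ _ : Fin 1 => a) = ‖a‖ := by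
  let _ := CStarAlgebra.spectralOrder M
  let _ := CStarAlgebra.spectralOrderedRing M
  let φ : M →⋆ₙₐ[ℂ] CStarMatrix (Fin 1) (Fin 1) M :=
    { toFun := fun a => CStarMatrix.ofMatrix (Matrix.of fun _ _ => a)
      map_smul' := fun c x => rfl
      map_zero' := rfl
      map_add' := fun x y => rfl
      map_mul' := fun x y => CStarMatrix.ext fun i j => by simp [CStarMatrix.mul_apply]
      map_star' := fun x => rfl }
  have hφ : Function.Injective φ := fun x y h =>
    show CStarMatrix.ofMatrix (Matrix.of fun _ _ : Fin 1 => x) 0 0 =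
      CStarMatrix.ofMatrix (Matrix.of fun _ _ : Fin 1 => y) 0 0 from
    congrArg (fun Z : CStarMatrix (Fin 1) (Fin 1) M => Z 0 0) h
  exact NonUnitalStarAlgHom.norm_map φ hφ a

end MatNorm

/-! ### Matrices of operators as operators on a direct sum. -/

section Hilbert

variable {E : Type*} [NormedAddCommGroup E] [InnerProductSpace ℂ E] [CompleteSpace E]

/-- The operator on `E ⊕ ⋯ ⊕ E` given by a matrix of operators on `E`. -/
noncomputable def matOp {n : ℕ} (X : Matrix (Fin n) (Fin n) (E →L[ℂ] E)) :
    PiLp 2 (fun _ : Fin n => E) →L[ℂ] PiLp 2 (fun _ : Fin n => E) :=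
  (PiLp.continuousLinearEquiv 2 ℂ (fun _ : Fin n => E)).symm.toContinuousLinearMap ∘L
    (ContinuousLinearMap.pi fun i => ∑ j, X i j ∘L ContinuousLinearMap.proj j) ∘L
    (PiLp.continuousLinearEquiv 2 ℂ (fun _ : Fin n => E)).toContinuousLinearMap

@[simp] theorem matOp_apply {n : ℕ} (X : Matrix (Fin n) (Fin n) (E →L[ℂ] E))
    (x : PiLp 2 (fun _ : Fin n => E)) (i : Fin n) : matOp X x i = ∑ j, X i j (x j) := by
  simp [matOp]

/-- `𝕄ₙ(B(E)) ≅ B(E ⊕ ⋯ ⊕ E)`, as a `*`-homomorphism. -/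
noncomputable def matOpHom (n : ℕ) : CStarMatrix (Fin n) (Fin n) (E →L[ℂ] E) →⋆ₙₐ[ℂ]
    (PiLp 2 (fun _ : Fin n => E) →L[ℂ] PiLp 2 (fun _ : Fin n => E)) where
  toFun X := matOp (CStarMatrix.ofMatrix.symm X)
  map_smul' c X := by ext x i; simp [Finset.smul_sum]
  map_zero' := by ext x i; simp
  map_add' X Y := by ext x i; simp [Finset.sum_add_distrib]
  map_mul' X Y := by
    ext x i
    simp [CStarMatrix.mul_apply, map_sum, sum_apply]
    rw [Finset.sum_comm]
  map_star' X := by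
    rw [ContinuousLinearMap.star_eq_adjoint, ContinuousLinearMap.eq_adjoint_iff]
    intro x y
    simp only [PiLp.inner_apply, matOp_apply, sum_inner, inner_sum]
    rw [Finset.sum_comm]
    refine Finset.sum_congr rfl fun i _ => Finset.sum_congr rfl fun j _ => ?_
    simp [CStarMatrix.star_apply, ContinuousLinearMap.star_eq_adjoint,
      ContinuousLinearMap.adjoint_inner_left]

theorem matNorm_eq_norm_matOp {n : ℕ} (X : Matrix (Fin n) (Fin n) (E →L[ℂ] E)) :
    matNorm X = ‖matOp X‖ := by
  let _ := CStarAlgebra.spectralOrder (E →L[ℂ] E)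
  let _ := CStarAlgebra.spectralOrderedRing (E →L[ℂ] E)
  refine (NonUnitalStarAlgHom.norm_map (matOpHom (E := E) n) ?_ (CStarMatrix.ofMatrix X)).symm
  refine (injective_iff_map_eq_zero _).2 fun Y hY => CStarMatrix.ext fun i j => ?_
  ext x
  have := congrArg (fun T => T i) (DFunLike.congr_fun hY (PiLp.single 2 j x))
  have h2 : ∀ k, Y i k ((PiLp.single 2 j x : PiLp 2 (fun _ : Fin n => E)) k)
      = if k = j then Y i j x else 0 := by
    intro k
    by_cases hk : k = j
    · subst hk; simp
    · simp [hk]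
  have h3 : matOp (CStarMatrix.ofMatrix.symm Y) (PiLp.single 2 j x) i = 0 := this
  rw [matOp_apply] at h3
  simp only [h2, apply_ite (Y i _), map_zero] at h3
  have h4 : ∑ k, (Y i k) (if k = j then x else 0) = Y i j x := by
    rw [Finset.sum_eq_single j] <;> simp +contextual
  simpa using h4.symm.trans (by simpa [apply_ite] using h3)

/-- Identifying the C*-norm with the operator norm on the n-fold sum lets bounds be tested on
vectors; the compression and approximation estimates rely on this form. -/
theorem matNorm_le_iff {n : ℕ} (X : Matrix (Fin n) (Fin n) (E →L[ℂ] E)) {C : ℝ} (hC : 0 ≤ C) :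
    matNorm X ≤ C ↔
      ∀ x : Fin n → E, ∑ i, ‖∑ j, X i j (x j)‖ ^ 2 ≤ C ^ 2 * ∑ i, ‖x i‖ ^ 2 := by
  rw [matNorm_eq_norm_matOp, ContinuousLinearMap.opNorm_le_iff hC]
  constructor
  · intro h x
    have h1 := pow_le_pow_left₀ (norm_nonneg _) (h (WithLp.toLp 2 x)) 2
    rw [mul_pow, PiLp.norm_sq_eq_of_L2, PiLp.norm_sq_eq_of_L2] at h1
    simpa using h1
  · intro h x
    refine le_of_sq_le_sq ?_ (by positivity)
    rw [mul_pow, PiLp.norm_sq_eq_of_L2, PiLp.norm_sq_eq_of_L2]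
    simpa using h x

theorem sum_norm_sq_le_matNorm {n : ℕ} (X : Matrix (Fin n) (Fin n) (E →L[ℂ] E)) (x : Fin n → E) :
    ∑ i, ‖∑ j, X i j (x j)‖ ^ 2 ≤ matNorm X ^ 2 * ∑ i, ‖x i‖ ^ 2 :=
  (matNorm_le_iff X (matNorm_nonneg X)).1 le_rfl x

end Hilbert

/-! ### Automatic adjoint preservation and surjectivity. -/

section StarHoms

variable {R : Type*} [CStarAlgebra R] {S : Type*} [CStarAlgebra S]

/-- A unital contractive homomorphism between C*-algebras preserves adjoints. -/
theorem map_star_of_norm_le (h : R →ₐ[ℂ] S) (hh : ∀ x, ‖h x‖ ≤ ‖x‖) (x : R) :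
    h (star x) = star (h x) := by
  let _ := CStarAlgebra.spectralOrder S
  let _ := CStarAlgebra.spectralOrderedRing S
  have hx : x ∈ Submodule.span ℂ (unitary R : Set R) := by
    rw [CStarAlgebra.span_unitary]; trivial
  induction hx using Submodule.span_induction with
  | zero => simp
  | add x y _ _ hx hy => simp [hx, hy]
  | smul c x _ hx => simp [hx]
  | mem u hu =>
    have hn : ∀ z ∈ unitary R, ‖z‖ ≤ 1 := by
      intro z hz
      have h1 : ‖z‖ * ‖z‖ = ‖(1 : R)‖ := by
        rw [← CStarRing.norm_star_mul_self, Unitary.star_mul_self_of_mem hz]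
      have h2 : ‖(1 : R)‖ ≤ 1 := by
        rcases subsingleton_or_nontrivial R with hR | hR
        · simp [Subsingleton.elim (1 : R) 0]
        · exact norm_one.le
      nlinarith [norm_nonneg z]
    have hle : ∀ y : S, ‖y‖ ≤ 1 → star y * y ≤ 1 := by
      intro y hy
      rw [← CStarAlgebra.norm_le_one_iff_of_nonneg _ (star_mul_self_nonneg y),
        CStarRing.norm_star_mul_self]
      nlinarith [norm_nonneg y]
    -- With v = h u and w = h (star u), two mutually inverse contractions: 1 = (vw)*(vw) ≤ w*w ≤ 1,
    -- so w is an isometry with inverse v, and v = w*.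
    have h1 : h u * h (star u) = 1 := by
      rw [← map_mul, Unitary.mul_star_self_of_mem hu, map_one]
    have hv := hle (h u) ((hh _).trans (hn u hu))
    have hw := hle (h (star u)) ((hh _).trans (hn _ (Unitary.star_mem hu)))
    have h2 : star (h (star u)) * h (star u) = 1 := by
      refine le_antisymm hw ?_
      have := star_left_conjugate_le_conjugate hv (h (star u))
      calc (1 : S) = star (h u * h (star u)) * (h u * h (star u)) := by simp [h1]
        _ = star (h (star u)) * (star (h u) * h u) * h (star u) := by
          rw [star_mul]; noncomm_ring
        _ ≤ star (h (star u)) * 1 * h (star u) := this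
        _ = _ := by rw [mul_one]
    have h4 : h (star u) * h u = 1 := by
      rw [← map_mul, Unitary.star_mul_self_of_mem hu, map_one]
    have h3 : star (h (star u)) = h u := by
      calc star (h (star u)) = star (h (star u)) * (h (star u) * h u) := by rw [h4, mul_one]
        _ = h u := by rw [← mul_assoc, h2, one_mul]
    rw [← h3, star_star]

/-- A unital contractive homomorphism between C*-algebras, as a `*`-homomorphism. -/
def starHomOfNormLE (h : R →ₐ[ℂ] S) (hh : ∀ x, ‖h x‖ ≤ ‖x‖) : R →⋆ₐ[ℂ] S :=
  { h with map_star' := map_star_of_norm_le h hh }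

theorem norm_starHom_le (φ : R →⋆ₐ[ℂ] S) (x : R) : ‖φ x‖ ≤ ‖x‖ :=
  NonUnitalStarAlgHom.norm_apply_le φ x

theorem continuous_starHom (φ : R →⋆ₐ[ℂ] S) : Continuous φ :=
  AddMonoidHomClass.continuous_of_bound φ 1 (by simpa using norm_starHom_le φ)

/-- Truncating at ±‖φ x‖ by functional calculus shrinks x but leaves its image alone, since the
truncation is the identity on the spectrum of φ x. -/
theorem exists_small_preimage_of_isSelfAdjoint (φ : R →⋆ₐ[ℂ] S) (x : R) (hx : IsSelfAdjoint x) :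
    ∃ g, φ g = φ x ∧ ‖g‖ ≤ ‖φ x‖ := by
  set c := ‖φ x‖
  have hc : 0 ≤ c := norm_nonneg _
  let f : ℝ → ℝ := fun t => max (-c) (min c t)
  have hf : Continuous f := by fun_prop
  have hφx : IsSelfAdjoint (φ x) := hx.map φ
  refine ⟨cfc f x, ?_, norm_cfc_le hc fun t _ => ?_⟩
  · rw [StarAlgHomClass.map_cfc (S := ℂ) φ f x hf.continuousOn (continuous_starHom φ) hx hφx]
    conv_rhs => rw [← cfc_id ℝ (φ x) hφx]
    refine cfc_congr fun t ht => ?_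
    have h1 : |t| ≤ c := by
      rcases subsingleton_or_nontrivial S with hS | hS
      · have : spectrum ℝ (φ x) = ∅ := spectrum.of_subsingleton _
        simp [this] at ht
      · exact spectrum.norm_le_norm_of_mem ht
    rw [abs_le] at h1
    simp [f, min_eq_right h1.2, max_eq_right h1.1]
  · rw [Real.norm_eq_abs, abs_le]
    exact ⟨le_max_left _ _, max_le (by linarith) (min_le_left _ _)⟩

/-- A `*`-homomorphism between C*-algebras with dense range is surjective. -/
theorem surjective_of_denseRange (φ : R →⋆ₐ[ℂ] S) (hφ : DenseRange φ) :
    Function.Surjective φ := by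
  let f : NormedAddGroupHom R S :=
    { toFun := φ, map_add' := map_add φ, bound' := ⟨1, by simpa using norm_starHom_le φ⟩ }
  -- Preimages of controlled norm exist on the range, the factor 2 coming from the real and
  -- imaginary parts; completeness of R then extends this to the closure of the range.
  have key : ∀ y ∈ f.range, ∃ g, f g = y ∧ ‖g‖ ≤ 2 * ‖y‖ := by
    rintro _ ⟨x, rfl⟩
    obtain ⟨a, ha, hna⟩ := exists_small_preimage_of_isSelfAdjoint φ (realPart x : R)
      (realPart x).2
    obtain ⟨b, hb, hnb⟩ := exists_small_preimage_of_isSelfAdjoint φ (imaginaryPart x : R)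
      (imaginaryPart x).2
    have hre : φ (realPart x : R) = (realPart (φ x) : S) := by
      have h2 := map_smul φ (2⁻¹ : ℂ) (x + star x)
      simp only [realPart_apply_coe]
      rw [← Complex.coe_smul, ← Complex.coe_smul]
      simpa [map_star] using h2
    have him : φ (imaginaryPart x : R) = (imaginaryPart (φ x) : S) := by
      have h2 := map_smul φ (2⁻¹ : ℂ) (x - star x)
      simp only [imaginaryPart_apply_coe]
      rw [← Complex.coe_smul, ← Complex.coe_smul]
      have h3 : φ ((2⁻¹ : ℂ) • (x - star x)) = (2⁻¹ : ℂ) • (φ x - star (φ x)) := by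
        rw [h2, map_sub, map_star]
      rw [map_smul]
      simpa using h3
    refine ⟨a + Complex.I • b, ?_, ?_⟩
    · change φ (a + Complex.I • b) = φ x
      rw [map_add, map_smul, ha, hb, hre, him, realPart_add_I_smul_imaginaryPart]
    · have h1 : ‖(realPart (φ x) : S)‖ ≤ ‖φ x‖ := _root_.realPart.norm_le (φ x)
      have h2 : ‖(imaginaryPart (φ x) : S)‖ ≤ ‖φ x‖ := _root_.imaginaryPart.norm_le (φ x)
      rw [hre] at hna
      rw [him] at hnb
      change _ ≤ 2 * ‖φ x‖
      calc ‖a + Complex.I • b‖ ≤ ‖a‖ + ‖Complex.I • b‖ := norm_add_le _ _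
        _ = ‖a‖ + ‖b‖ := by simp [norm_smul]
        _ ≤ _ := by linarith
  have := controlled_closure_of_complete (f := f) (K := f.range) (C := 2) (ε := 1)
    (by norm_num) one_pos key
  intro y
  obtain ⟨g, hg, -⟩ := this y (by
    change y ∈ closure (f.range : Set S)
    have : (f.range : Set S) = Set.range φ := rfl
    rw [this]
    exact hφ y)
  exact ⟨g, hg⟩

end StarHoms

/-! ### Homomorphisms obtained from norm domination. -/

section Extension

variable {A₀ F D : Type*} [Ring A₀] [Algebra ℂ A₀] [NormedRing F] [NormedAlgebra ℂ F]
  [NormedRing D] [NormedAlgebra ℂ D] [CompleteSpace D]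

/-- A homomorphism dominated in norm by a homomorphism with dense range factors through it. -/
theorem exists_algHom_of_norm_le (f : A₀ →ₐ[ℂ] F) (g : A₀ →ₐ[ℂ] D) (hf : DenseRange f)
    (hfg : ∀ x, ‖g x‖ ≤ ‖f x‖) :
    ∃ h : F →ₐ[ℂ] D, (∀ y, ‖h y‖ ≤ ‖y‖) ∧ ∀ x, h (f x) = g x := by
  let e : F →L[ℂ] D := g.toLinearMap.extendOfNorm f.toLinearMap
  have hb : ∀ x, ‖g.toLinearMap x‖ ≤ 1 * ‖f.toLinearMap x‖ := by simpa using hfg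
  have he : ∀ x, e (f x) = g x := fun x => LinearMap.extendOfNorm_eq hf ⟨1, hb⟩ x
  have hn : ∀ y, ‖e y‖ ≤ ‖y‖ := fun y => by
    simpa using LinearMap.norm_extendOfNorm_apply_le hf 1 hb y
  refine ⟨AlgHom.ofLinearMap e.toLinearMap ?_ ?_, hn, he⟩
  · simpa using he 1
  · intro x y
    refine hf.induction_on₂ (p := fun x y => e (x * y) = e x * e y) ?_ ?_ x y
    · exact isClosed_eq (by fun_prop) (by fun_prop)
    · intro a b
      rw [← map_mul, he, he, he, map_mul]

end Extension

/-! ### Norm-attaining representations. -/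

section GNS

variable {D : Type u} [CStarAlgebra D]

/-- A contractive functional with `f 1 = 1` on a C*-algebra is positive. -/
theorem nonneg_of_norm_le [PartialOrder D] [StarOrderedRing D] (f : D →ₗ[ℂ] ℂ)
    (hf : ∀ x, ‖f x‖ ≤ ‖x‖) (h1 : f 1 = 1) (x : D) (hx : 0 ≤ x) : 0 ≤ f x := by
  set r := ‖x‖
  have hxs : IsSelfAdjoint x := hx.isSelfAdjoint
  have hsa : IsSelfAdjoint (x - algebraMap ℝ D (r / 2)) := hxs.sub (.algebraMap D (.all _))
  have hr : ‖x - algebraMap ℝ D (r / 2)‖ ≤ r / 2 := by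
    have hcfc : x - algebraMap ℝ D (r / 2) = cfc (fun t : ℝ => t - r / 2) x := by
      rw [cfc_sub .., cfc_id' ℝ x, cfc_const ..]
    rw [hcfc]
    refine norm_cfc_le (by positivity) fun t ht => ?_
    have h0 : 0 ≤ t := spectrum_nonneg_of_nonneg hx ht
    have h2 : |t| ≤ r := by
      rcases subsingleton_or_nontrivial D with hD | hD
      · have : spectrum ℝ x = ∅ := spectrum.of_subsingleton _
        simp [this] at ht
      · exact spectrum.norm_le_norm_of_mem ht
    rw [abs_le] at h2
    rw [Real.norm_eq_abs, abs_le]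
    constructor <;> linarith
  -- x - r/2 is self-adjoint of norm at most r/2, so subtracting it gives an element of squared norm
  -- at most (r/2)² + t². The unital contraction f respects this bound for every t.
  have key : ∀ t : ℝ, ((f x).re - r / 2) ^ 2 + ((f x).im - t) ^ 2 ≤ (r / 2) ^ 2 + t ^ 2 := by
    intro t
    set y := x - algebraMap ℝ D (r / 2)
    have hfy : f (y - algebraMap ℂ D (t * Complex.I)) = f x - (r / 2 : ℝ) - t * Complex.I := by
      have h3 : algebraMap ℝ D (r / 2) = ((r / 2 : ℝ) : ℂ) • (1 : D) := by
        rw [Algebra.algebraMap_eq_smul_one, Complex.coe_smul]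
      simp only [y, h3, Algebra.algebraMap_eq_smul_one, map_sub, map_smul, h1, smul_eq_mul,
        mul_one]
    have hny : ‖y - algebraMap ℂ D (t * Complex.I)‖ ^ 2 ≤ (r / 2) ^ 2 + t ^ 2 := by
      have h4 : star (y - algebraMap ℂ D (t * Complex.I)) * (y - algebraMap ℂ D (t * Complex.I))
          = y * y + algebraMap ℂ D ((t : ℂ) ^ 2) := by
        rw [star_sub, hsa.star_eq, ← algebraMap_star_comm]
        have h5 : star ((t : ℂ) * Complex.I) = -(t * Complex.I) := by simp
        have h6 : (t : ℂ) ^ 2 = -((t * Complex.I) * (t * Complex.I)) := by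
          linear_combination (t : ℂ) ^ 2 * Complex.I_sq
        have hc := Algebra.commutes ((t : ℂ) * Complex.I) y
        rw [h5, h6, map_neg, map_neg, map_mul (algebraMap ℂ D) (t * Complex.I) (t * Complex.I)]
        generalize algebraMap ℂ D ((t : ℂ) * Complex.I) = z at hc ⊢
        clear_value y
        rw [sub_neg_eq_add, add_mul, mul_sub, mul_sub, hc]
        abel
      rw [sq, ← CStarRing.norm_star_mul_self, h4]
      refine (norm_add_le _ _).trans (add_le_add ?_ ?_)
      · refine (norm_mul_le _ _).trans ?_
        nlinarith [norm_nonneg y]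
      · rw [Algebra.algebraMap_eq_smul_one, norm_smul]
        have h7 : ‖(1 : D)‖ ≤ 1 := by
          rcases subsingleton_or_nontrivial D with hR | hR
          · simp [Subsingleton.elim (1 : D) 0]
          · exact norm_one.le
        have h8 : ‖(t : ℂ) ^ 2‖ = t ^ 2 := by simp
        rw [h8]
        nlinarith [sq_nonneg t]
    have h9 := (pow_le_pow_left₀ (norm_nonneg _) (hf (y - algebraMap ℂ D (t * Complex.I))) 2).trans
      hny
    rw [hfy, ← Complex.normSq_eq_norm_sq, Complex.normSq_apply] at h9
    simp at h9
    nlinarith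
  have him : (f x).im = 0 := by
    by_contra hne
    -- This t is chosen so that `key` would read c ≤ c - 1.
    have h3 := key ((((f x).re - r / 2) ^ 2 + (f x).im ^ 2 - (r / 2) ^ 2 - 1) / (2 * (f x).im))
    have h4 : (((f x).re - r / 2) ^ 2 + (f x).im ^ 2 - (r / 2) ^ 2 - 1) / (2 * (f x).im)
      * (f x).im * 2 = ((f x).re - r / 2) ^ 2 + (f x).im ^ 2 - (r / 2) ^ 2 - 1 := by
      field_simp
    nlinarith
  have hre := key 0
  rw [him] at hre
  rw [Complex.nonneg_iff]
  exact ⟨by nlinarith [norm_nonneg x], him.symm⟩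

/-- Every element of a C*-algebra attains its norm in some representation on a Hilbert space. -/
theorem exists_starHom_norm_eq (d : D) :
    ∃ (E : Type u) (_ : NormedAddCommGroup E) (_ : InnerProductSpace ℂ E) (_ : CompleteSpace E)
      (φ : D →⋆ₐ[ℂ] (E →L[ℂ] E)), ‖φ d‖ = ‖d‖ := by
  let _ := CStarAlgebra.spectralOrder D
  let _ := CStarAlgebra.spectralOrderedRing D
  rcases eq_or_ne d 0 with rfl | hd
  · exact ⟨(0 : D →ₚ[ℂ] ℂ).GNS, inferInstance, inferInstance, inferInstance,
      (0 : D →ₚ[ℂ] ℂ).gnsStarAlgHom, by simp⟩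
  have : Nontrivial D := ⟨d, 0, hd⟩
  set a := star d * d
  have ha : 0 ≤ a := star_mul_self_nonneg d
  have hc : 0 < ‖a‖ := by
    rw [CStarRing.norm_star_mul_self]; have := norm_pos_iff.2 hd; positivity
  -- A functional norming a + ‖a‖, instead of a itself, must be extremal at both a and 1 at once. So
  -- it takes the value 1 at the unit, which makes it positive.
  have hb : ‖a + algebraMap ℝ D ‖a‖‖ = 2 * ‖a‖ := by
    refine le_antisymm ?_ ?_
    · refine (norm_add_le _ _).trans ?_
      rw [norm_algebraMap']; simp; linarith
    · have h1 := CStarAlgebra.norm_mem_spectrum_of_nonneg ha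
      have h2 : ‖a‖ + ‖a‖ ∈ spectrum ℝ (a + algebraMap ℝ D ‖a‖) := by
        have := spectrum.add_mem_add_iff (r := ‖a‖) (s := ‖a‖) (a := a) |>.2 h1
        rwa [add_comm a]
      have := spectrum.norm_le_norm_of_mem h2
      rw [Real.norm_eq_abs, abs_of_pos (by linarith)] at this
      linarith
  obtain ⟨g, hg1, hg2⟩ := exists_dual_vector ℂ (a + algebraMap ℝ D ‖a‖)
    (by rw [hb]; exact (by linarith : 0 < 2 * ‖a‖).ne')
  have hgn : ∀ x, ‖g x‖ ≤ ‖x‖ := fun x => by simpa [hg1] using g.le_opNorm x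
  have hsum : g a + ‖a‖ * g 1 = 2 * ‖a‖ := by
    have : g (a + algebraMap ℝ D ‖a‖) = g a + ‖a‖ * g 1 := by
      rw [map_add, Algebra.algebraMap_eq_smul_one, ← Complex.coe_smul, map_smul, smul_eq_mul]
    rw [← this, hg2, hb]; simp
  have h1n : ‖g 1‖ ≤ 1 := by simpa using hgn 1
  have h1re : (g 1).re ≤ 1 := (Complex.re_le_norm _).trans h1n
  have hare : (g a).re ≤ ‖a‖ := (Complex.re_le_norm _).trans (hgn a)
  have hre : (g a).re + ‖a‖ * (g 1).re = 2 * ‖a‖ := by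
    simpa using congrArg Complex.re hsum
  have hg1re : (g 1).re = 1 := by
    refine le_antisymm h1re ?_
    nlinarith
  have hg1' : g 1 = 1 := by
    have h2 : ‖g 1‖ ^ 2 ≤ 1 := by nlinarith [norm_nonneg (g 1)]
    rw [← Complex.normSq_eq_norm_sq, Complex.normSq_apply, hg1re] at h2
    have : (g 1).im = 0 := by nlinarith
    exact Complex.ext (by simp [hg1re]) (by simp [this])
  have hga : g a = ‖a‖ := by
    rw [hg1'] at hsum
    linear_combination hsum
  let f : D →ₚ[ℂ] ℂ := PositiveLinearMap.mk₀ g.toLinearMap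
    (nonneg_of_norm_le g.toLinearMap hgn hg1')
  refine ⟨f.GNS, inferInstance, inferInstance, inferInstance, f.gnsStarAlgHom,
    le_antisymm (norm_starHom_le _ _) ?_⟩
  have hf : ∀ x, f x = g x := fun x => rfl
  let ξ : f.PreGNS := f.toPreGNS 1
  have hξ : ‖(ξ : f.GNS)‖ = 1 := by
    rw [UniformSpace.Completion.norm_coe]
    have h2 : (‖ξ‖ : ℂ) ^ 2 = 1 := by
      rw [PositiveLinearMap.preGNS_norm_sq]
      simpa [ξ, hf] using hg1'
    have h3 : ‖ξ‖ ^ 2 = 1 := by exact_mod_cast h2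
    nlinarith [norm_nonneg ξ, sq_nonneg (‖ξ‖ - 1)]
  have hdξ : ‖f.gnsStarAlgHom d (ξ : f.GNS)‖ = ‖d‖ := by
    have h1 : f.gnsStarAlgHom d (ξ : f.GNS) = (f.leftMulMapPreGNS d ξ : f.PreGNS) :=
      PositiveLinearMap.gnsNonUnitalStarAlgHom_apply_coe f
    rw [h1, UniformSpace.Completion.norm_coe]
    have h2 : (‖f.leftMulMapPreGNS d ξ‖ : ℂ) ^ 2 = (‖d‖ : ℂ) ^ 2 := by
      rw [PositiveLinearMap.preGNS_norm_sq]
      have : ‖a‖ = ‖d‖ ^ 2 := by rw [CStarRing.norm_star_mul_self, sq]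
      have h4 : g (star d * d) = (‖d‖ : ℂ) ^ 2 := by
        rw [hga, this]; simp
      simpa [ξ, hf] using h4
    have h3 : ‖f.leftMulMapPreGNS d ξ‖ ^ 2 = ‖d‖ ^ 2 := by exact_mod_cast h2
    exact (sq_eq_sq₀ (norm_nonneg _) (norm_nonneg _)).1 h3
  calc ‖d‖ = ‖f.gnsStarAlgHom d (ξ : f.GNS)‖ := hdξ.symm
    _ ≤ ‖f.gnsStarAlgHom d‖ * ‖(ξ : f.GNS)‖ := ContinuousLinearMap.le_opNorm _ _
    _ = _ := by rw [hξ, mul_one]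

end GNS

/-! ### Compression by contractions. -/

section Compress

variable {E : Type*} [NormedAddCommGroup E] [InnerProductSpace ℂ E] [CompleteSpace E]
  {G : Type*} [NormedAddCommGroup G] [InnerProductSpace ℂ G] [CompleteSpace G]

/-- Applying T and S in each coordinate gives contractions on the n-fold sums, so the compression is
contractive at every matrix level. -/
theorem matNorm_compress_le {n : ℕ} (X : Matrix (Fin n) (Fin n) (G →L[ℂ] G)) (T : G →L[ℂ] E)
    (S : E →L[ℂ] G) (hT : ‖T‖ ≤ 1) (hS : ‖S‖ ≤ 1) :
    matNorm (X.map fun Y => T ∘L Y ∘L S) ≤ matNorm X := by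
  rw [matNorm_le_iff _ (matNorm_nonneg X)]
  intro x
  have h1 : ∀ i, ‖∑ j, (X.map fun Y => T ∘L Y ∘L S) i j (x j)‖ ≤ ‖∑ j, X i j (S (x j))‖ := by
    intro i
    have : ∑ j, (X.map fun Y => T ∘L Y ∘L S) i j (x j) = T (∑ j, X i j (S (x j))) := by
      simp [map_sum]
    rw [this]
    exact (T.le_of_opNorm_le hT _).trans (by rw [one_mul])
  have h2 : ∀ j, ‖S (x j)‖ ≤ ‖x j‖ := fun j =>
    (S.le_of_opNorm_le hS _).trans (by rw [one_mul])
  calc _ ≤ ∑ i, ‖∑ j, X i j (S (x j))‖ ^ 2 :=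
        Finset.sum_le_sum fun i _ => pow_le_pow_left₀ (norm_nonneg _) (h1 i) 2
    _ ≤ matNorm X ^ 2 * ∑ j, ‖S (x j)‖ ^ 2 := sum_norm_sq_le_matNorm X _
    _ ≤ _ := by gcongr with j _; exact h2 j

end Compress

/-! ### Unital finite-dimensional representations and the RFD property. -/

section FinRep

variable {M : Type u} [CStarAlgebra M]

/-- The full matrix algebra `𝕄_{k+1}`. -/
abbrev MatAlg (k : ℕ) : Type :=
  EuclideanSpace ℂ (Fin (k + 1)) →L[ℂ] EuclideanSpace ℂ (Fin (k + 1))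

/-- A unital completely contractive representation on a nonzero finite-dimensional space. -/
structure FinRep (A : Subalgebra ℂ M) : Type u where
  deg : ℕ
  hom : A →ₐ[ℂ] MatAlg deg
  contractive : CompletelyContractive A hom

theorem CompletelyContractive.norm_le {N : Type*} [CStarAlgebra N] {A : Subalgebra ℂ M}
    {f : A → N} (hf : CompletelyContractive A f) (a : A) : ‖f a‖ ≤ ‖a‖ := by
  have := hf 1 (Matrix.of fun _ _ => a)
  change matNorm (Matrix.of fun _ _ : Fin 1 => f a) ≤
    matNorm (Matrix.of fun _ _ : Fin 1 => (a : M)) at this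
  rwa [matNorm_diag, matNorm_diag] at this

theorem CompletelyContractive.comp_starHom {N : Type*} [CStarAlgebra N] {D : Type*}
    [CStarAlgebra D] {A : Subalgebra ℂ M} {f : A → N} (hf : CompletelyContractive A f)
    (φ : N →⋆ₐ[ℂ] D) : CompletelyContractive A fun a => φ (f a) := fun n X =>
  (matNorm_map_le φ (X.map f)).trans (hf n X)

theorem CompletelyIsometric.completelyContractive {N : Type*} [CStarAlgebra N]
    {A : Subalgebra ℂ M} {f : A → N} (hf : CompletelyIsometric A f) :
    CompletelyContractive A f := fun n X => (hf n X).le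

theorem CompletelyIsometric.norm_eq {N : Type*} [CStarAlgebra N] {A : Subalgebra ℂ M}
    {f : A → N} (hf : CompletelyIsometric A f) (a : A) : ‖f a‖ = ‖a‖ := by
  have := hf 1 (Matrix.of fun _ _ => a)
  change matNorm (Matrix.of fun _ _ : Fin 1 => f a) =
    matNorm (Matrix.of fun _ _ : Fin 1 => (a : M)) at this
  rwa [matNorm_diag, matNorm_diag] at this

theorem norm_one_le_one : ‖(1 : M)‖ ≤ 1 := by
  rcases subsingleton_or_nontrivial M with h | h
  · simp [Subsingleton.elim (1 : M) 0]
  · exact norm_one.le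

/-- A completely contractive homomorphism into `B(ℂ^r)` is controlled by its unital part. -/
theorem matNorm_map_le_of_forall_finRep {A : Subalgebra ℂ M} {r : ℕ}
    (ρ : A →ₙₐ[ℂ] (EuclideanSpace ℂ (Fin r) →L[ℂ] EuclideanSpace ℂ (Fin r)))
    (hρ : CompletelyContractive A ρ) {n : ℕ} (X : Matrix (Fin n) (Fin n) A) {C : ℝ} (hC : 0 ≤ C)
    (h : ∀ σ : FinRep A, matNorm (X.map σ.hom) ≤ C) : matNorm (X.map ρ) ≤ C := by
  set p := ρ 1 with hp
  have hp1 : ‖p‖ ≤ 1 := (hρ.norm_le 1).trans norm_one_le_one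
  have hpl : ∀ a x, p (ρ a x) = ρ a x := fun a x => by
    rw [← mul_apply_eq_comp, hp, ← map_mul, one_mul]
  have hpr : ∀ a x, ρ a (p x) = ρ a x := fun a x => by
    rw [← mul_apply_eq_comp, hp, ← map_mul, mul_one]
  -- ρ may fail to be unital, but it lives on the range W of the idempotent p = ρ 1, where it
  -- becomes unital. When W is zero so is ρ, and there is no compression to form.
  set W := LinearMap.range p.toLinearMap with hW
  obtain h0 | ⟨k, hk⟩ : Module.finrank ℂ W = 0 ∨ ∃ k, Module.finrank ℂ W = k + 1 :=
    Nat.eq_zero_or_eq_succ_pred _ |>.imp_right fun h => ⟨_, h⟩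
  · have hW0 : W = ⊥ := Submodule.finrank_eq_zero.1 h0
    have hp0 : ∀ x, p x = 0 := fun x => by
      have : p x ∈ W := ⟨x, rfl⟩
      rwa [hW0, Submodule.mem_bot] at this
    have hρ0 : ∀ a x, ρ a x = 0 := fun a x => by rw [← hpl, hp0]
    rw [matNorm_le_iff _ hC]
    intro x
    simp only [Matrix.map_apply, hρ0]
    simp
    positivity
  · let e : EuclideanSpace ℂ (Fin (k + 1)) ≃ₗᵢ[ℂ] W :=
      ((stdOrthonormalBasis ℂ W).reindex (finCongr hk)).repr.symm
    let J : EuclideanSpace ℂ (Fin (k + 1)) →L[ℂ] EuclideanSpace ℂ (Fin r) :=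
      (W.subtypeₗᵢ.comp e.toLinearIsometry).toContinuousLinearMap
    let J' := ContinuousLinearMap.adjoint J
    have hJ'J : ∀ x, J' (J x) = x := fun x => by
      refine ext_inner_right ℂ fun y => ?_
      rw [ContinuousLinearMap.adjoint_inner_left]
      exact (W.subtypeₗᵢ.comp e.toLinearIsometry).inner_map_map x y
    have hJW : ∀ w ∈ W, J (J' w) = w := fun w hw => by
      obtain ⟨z, hz⟩ : ∃ z, J z = w := ⟨e.symm ⟨w, hw⟩, by simp [J]⟩
      rw [← hz, hJ'J]
    have hpJ : ∀ x, p (J x) = J x := fun x => by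
      obtain ⟨z, hz⟩ : J x ∈ W := (e x).2
      rw [← hz]
      exact hpl 1 z
    have hρW : ∀ a x, ρ a x ∈ W := fun a x => ⟨ρ a x, hpl a x⟩
    have hJn : ‖J‖ ≤ 1 := (W.subtypeₗᵢ.comp e.toLinearIsometry).norm_toContinuousLinearMap_le
    have hJ'n : ‖J'‖ ≤ 1 := by
      rw [LinearIsometryEquiv.norm_map]; exact hJn
    let σ : A →ₐ[ℂ] MatAlg k :=
      { toFun := fun a => J' ∘L ρ a ∘L J
        map_one' := by
          ext1 x
          change J' (p (J x)) = x
          rw [hpJ, hJ'J]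
        map_mul' := fun a b => by
          ext1 x
          change J' (ρ (a * b) (J x)) = J' (ρ a (J (J' (ρ b (J x)))))
          rw [hJW _ (hρW b _), map_mul, mul_apply_eq_comp]
        map_zero' := by ext1 x; simp
        map_add' := fun a b => by ext1 x; simp
        commutes' := fun c => by
          ext1 x
          change J' (ρ (algebraMap ℂ A c) (J x)) = _
          rw [Algebra.algebraMap_eq_smul_one, map_smul]
          change J' (c • p (J x)) = _
          rw [map_smul, hpJ, hJ'J]
          simp [Algebra.algebraMap_eq_smul_one] }
    have hσ : CompletelyContractive A σ := fun m Y =>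
      (matNorm_compress_le (Y.map ρ) J' J hJ'n hJn).trans (hρ m Y)
    -- The compression loses nothing: ρ a = (ρ a) p and everything takes values in W, so ρ is
    -- recovered from σ by multiplying with contractions.
    have hback : X.map ρ = (X.map σ).map fun T => J ∘L T ∘L (J' ∘L p) := by
      ext i j : 1
      refine ContinuousLinearMap.ext fun x => ?_
      change ρ (X i j) x = J (J' (ρ (X i j) (J (J' (p x)))))
      rw [hJW _ (hρW _ _), hJW (p x) ⟨x, rfl⟩, hpr]
    rw [hback]
    refine (matNorm_compress_le (X.map σ) J (J' ∘L p) hJn ?_).trans (h ⟨k, σ, hσ⟩)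
    exact (ContinuousLinearMap.opNorm_comp_le _ _).trans
      (mul_le_one₀ hJ'n (norm_nonneg _) hp1)

/-- The definition of RFD allows non-unital homomorphisms; passing to their unital parts shows that
unital representations on nonzero spaces already suffice. -/
theorem IsRFD.matNorm_le {A : Subalgebra ℂ M} (hA : IsRFD A) {n : ℕ}
    (X : Matrix (Fin n) (Fin n) A) {C : ℝ} (hC : 0 ≤ C)
    (h : ∀ σ : FinRep A, matNorm (X.map σ.hom) ≤ C) : matNorm (X.map Subtype.val) ≤ C := by
  obtain ⟨Λ, r, ρ, -, hρ⟩ := hA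
  refine (hρ n X).2 ?_
  rintro _ ⟨l, rfl⟩
  exact matNorm_map_le_of_forall_finRep (ρ l) (fun m Y => (hρ m Y).1 ⟨l, rfl⟩) X hC h

/-- Nontriviality guarantees at least one representation: over an empty family the hypothesis would
force ‖1‖ ≤ 0. The least upper bound is therefore taken over a nonempty set. -/
theorem isRFD_of_forall_finRep [Nontrivial M] (A : Subalgebra ℂ M)
    (h : ∀ (n : ℕ) (X : Matrix (Fin n) (Fin n) A) (C : ℝ), 0 ≤ C →
      (∀ σ : FinRep A, matNorm (X.map σ.hom) ≤ C) → matNorm (X.map Subtype.val) ≤ C) :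
    IsRFD A := by
  have hne : Nonempty (FinRep A) := by
    by_contra hne
    rw [not_nonempty_iff] at hne
    have := h 1 (Matrix.of fun _ _ => 1) 0 le_rfl fun σ => hne.elim σ
    change matNorm (Matrix.of fun _ _ : Fin 1 => (1 : M)) ≤ 0 at this
    rw [matNorm_diag, norm_one] at this
    exact absurd this (by norm_num)
  refine ⟨FinRep A, fun σ => σ.deg + 1, fun σ => σ.hom, fun σ => Nat.succ_pos _, fun n X => ?_⟩
  refine ⟨?_, fun b hb => ?_⟩
  · rintro _ ⟨σ, rfl⟩
    exact σ.contractive n X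
  · have hb' : ∀ σ : FinRep A, matNorm (X.map σ.hom) ≤ b := fun σ => hb ⟨σ, rfl⟩
    exact h n X b ((matNorm_nonneg _).trans (hb' hne.some)) hb'

end FinRep

/-! ### Residual finiteness of C*-algebras. -/

section Separated

/-- The finite-dimensional `*`-representations separate the points of the C*-algebra `R`. -/
def IsResiduallyFinite (R : Type*) [CStarAlgebra R] : Prop :=
  ∀ x : R, (∀ (k : ℕ) (ρ : R →⋆ₐ[ℂ] MatAlg k), ρ x = 0) → x = 0

variable {R : Type u} [CStarAlgebra R]

/-- Separating points is enough to norm all matrices, because jointly injective *-homomorphisms are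
jointly isometric. -/
theorem IsResiduallyFinite.matNorm_le (hR : IsResiduallyFinite R) {n : ℕ}
    (X : Matrix (Fin n) (Fin n) R) {C : ℝ} (hC : 0 ≤ C)
    (h : ∀ (k : ℕ) (ρ : R →⋆ₐ[ℂ] MatAlg k), matNorm (X.map ρ) ≤ C) : matNorm X ≤ C :=
  matNorm_le_of_forall_map (fun l : Σ k, (R →⋆ₐ[ℂ] MatAlg k) => l.2)
    (fun x hx => hR x fun k ρ => hx ⟨k, ρ⟩) X hC fun l => h l.1 l.2

theorem IsResiduallyFinite.norm_le (hR : IsResiduallyFinite R) (x : R) {C : ℝ} (hC : 0 ≤ C)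
    (h : ∀ (k : ℕ) (ρ : R →⋆ₐ[ℂ] MatAlg k), ‖ρ x‖ ≤ C) : ‖x‖ ≤ C := by
  rw [← matNorm_diag]
  refine hR.matNorm_le _ hC fun k ρ => ?_
  change matNorm (Matrix.of fun _ _ : Fin 1 => ρ x) ≤ C
  rw [matNorm_diag]
  exact h k ρ

/-- Unital contractive homomorphisms between C*-algebras preserve adjoints, so the representations
norming ⊤ are *-representations. -/
theorem isResiduallyFinite_of_isRFD (h : IsRFD (⊤ : Subalgebra ℂ R)) : IsResiduallyFinite R := by
  intro x hx
  have := h.matNorm_le (Matrix.of fun _ _ : Fin 1 => (⟨x, Algebra.mem_top⟩ : (⊤ : Subalgebra ℂ R)))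
    le_rfl fun σ => ?_
  · change matNorm (Matrix.of fun _ _ : Fin 1 => x) ≤ 0 at this
    rwa [matNorm_diag, norm_le_zero_iff] at this
  · change matNorm (Matrix.of fun _ _ : Fin 1 => σ.hom ⟨x, Algebra.mem_top⟩) ≤ 0
    rw [matNorm_diag, norm_le_zero_iff]
    exact hx σ.deg (starHomOfNormLE (σ.hom.comp (Subalgebra.topEquiv (R := ℂ) (A := R)).symm)
      fun y => σ.contractive.norm_le ⟨y, Algebra.mem_top⟩)

theorem IsResiduallyFinite.isRFD [Nontrivial R] (h : IsResiduallyFinite R) :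
    IsRFD (⊤ : Subalgebra ℂ R) := by
  refine isRFD_of_forall_finRep _ fun n X C hC hX => h.matNorm_le _ hC fun k ρ => ?_
  exact hX ⟨k, (ρ : R →ₐ[ℂ] MatAlg k).comp (⊤ : Subalgebra ℂ R).val,
    fun m Y => matNorm_map_le ρ (Y.map Subtype.val)⟩

end Separated

/-! ### Products of matrix algebras and their block diagonal action. -/

section MatProd

noncomputable instance lp.instCStarAlgebra {Λ : Type*} (B : Λ → Type*) [∀ l, CStarAlgebra (B l)]
    [∀ l, Nontrivial (B l)] : CStarAlgebra (lp B ∞) where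

/-- The `ℓ^∞`-product of a family of full matrix algebras. -/
noncomputable def MatProd {Λ : Type*} (k : Λ → ℕ) : Type _ := lp (fun l => MatAlg (k l)) ∞

noncomputable instance MatProd.instCStarAlgebra {Λ : Type*} (k : Λ → ℕ) :
    CStarAlgebra (MatProd k) :=
  lp.instCStarAlgebra fun l => MatAlg (k l)

variable {Λ : Type*} {k : Λ → ℕ}

/-- The underlying family of an element of an `ℓ^∞`-product. -/
noncomputable def MatProd.coord (x : MatProd k) (l : Λ) : MatAlg (k l) :=
  (show lp (fun l => MatAlg (k l)) ∞ from x) l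

@[ext] theorem MatProd.ext {x y : MatProd k} (h : ∀ l, x.coord l = y.coord l) : x = y :=
  lp.ext (funext h)

theorem MatProd.norm_coord_le (x : MatProd k) (l : Λ) : ‖x.coord l‖ ≤ ‖x‖ :=
  lp.norm_apply_le_norm ENNReal.top_ne_zero (show lp (fun l => MatAlg (k l)) ∞ from x) l

/-- The coordinates of an `ℓ^∞`-product. -/
noncomputable def MatProd.eval (l : Λ) : MatProd k →⋆ₐ[ℂ] MatAlg (k l) where
  toFun x := x.coord l
  map_one' := rfl
  map_mul' _ _ := rfl
  map_zero' := rfl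
  map_add' _ _ := rfl
  commutes' _ := rfl
  map_star' _ := rfl

theorem MatProd.ext_eval {x y : MatProd k} (h : ∀ l, MatProd.eval l x = MatProd.eval l y) : x = y :=
  MatProd.ext h

/-- The homomorphism into an `ℓ^∞`-product with given coordinates. -/
noncomputable def MatProd.lift {A : Type*} [Ring A] [Algebra ℂ A] (f : ∀ l, A →ₐ[ℂ] MatAlg (k l))
    (hf : ∀ a, ∃ c : ℝ, ∀ l, ‖f l a‖ ≤ c) : A →ₐ[ℂ] MatProd k where
  toFun a := show lp (fun l => MatAlg (k l)) ∞ from ⟨fun l => f l a, memℓp_infty ⟨(hf a).choose, by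
    rintro _ ⟨l, rfl⟩; exact (hf a).choose_spec l⟩⟩
  map_one' := by ext l : 1; exact map_one (f l)
  map_mul' a b := by ext l : 1; exact map_mul (f l) a b
  map_zero' := by ext l : 1; exact map_zero (f l)
  map_add' a b := by ext l : 1; exact map_add (f l) a b
  commutes' c := by ext l : 1; exact (f l).commutes c

theorem MatProd.matNorm_le {n : ℕ} (X : Matrix (Fin n) (Fin n) (MatProd k)) {C : ℝ} (hC : 0 ≤ C)
    (h : ∀ l, matNorm (X.map (MatProd.eval l)) ≤ C) : matNorm X ≤ C :=
  matNorm_le_of_forall_map (fun l : Λ => MatProd.eval (k := k) l)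
    (fun x hx => by ext l : 1; exact hx l) X hC h

theorem isResiduallyFinite_of_injective {R S : Type*} [CStarAlgebra R] [CStarAlgebra S]
    (φ : R →⋆ₐ[ℂ] S) (hφ : Function.Injective φ) (hS : IsResiduallyFinite S) :
    IsResiduallyFinite R := fun x hx =>
  hφ (by rw [map_zero]; exact hS _ fun k ρ => hx k (ρ.comp φ))

theorem MatProd.isResiduallyFinite : IsResiduallyFinite (MatProd k) := fun x hx => by
  ext l : 1
  exact hx _ (MatProd.eval l)

/-- The block diagonal action of an `ℓ^∞`-product of matrix algebras on the `ℓ²`-sum. -/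
noncomputable def MatProd.blockDiagonal : MatProd k →⋆ₐ[ℂ]
    (lp (fun l => EuclideanSpace ℂ (Fin (k l + 1))) 2 →L[ℂ]
      lp (fun l => EuclideanSpace ℂ (Fin (k l + 1))) 2) := by
  have hle : ∀ (T : MatProd k) (x : lp (fun l => EuclideanSpace ℂ (Fin (k l + 1))) 2) l,
      ‖T.coord l (x l)‖ ≤ ‖T‖ * ‖x l‖ := fun T x l =>
    ContinuousLinearMap.le_of_opNorm_le (T.coord l) (T.norm_coord_le l) _
  have hsum : ∀ x : lp (fun l => EuclideanSpace ℂ (Fin (k l + 1))) 2,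
      Summable fun l => ‖x l‖ ^ 2 := fun x => by
    simpa using (lp.memℓp x).summable (by norm_num)
  have hmem : ∀ (T : MatProd k) (x : lp (fun l => EuclideanSpace ℂ (Fin (k l + 1))) 2),
      Memℓp (fun l => T.coord l (x l)) 2 := fun T x => by
    refine memℓp_gen ?_
    simp only [ENNReal.toReal_ofNat, Real.rpow_ofNat]
    refine Summable.of_nonneg_of_le (fun _ => by positivity)
      (fun l => pow_le_pow_left₀ (norm_nonneg _) (hle T x l) 2) ?_
    simp only [mul_pow]
    exact (hsum x).mul_left _
  have hnorm : ∀ x : lp (fun l => EuclideanSpace ℂ (Fin (k l + 1))) 2,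
      ‖x‖ ^ 2 = ∑' l, ‖x l‖ ^ 2 := fun x => by
    simpa using lp.norm_rpow_eq_tsum (p := 2) (by norm_num) x
  let op : MatProd k → (lp (fun l => EuclideanSpace ℂ (Fin (k l + 1))) 2 →L[ℂ]
      lp (fun l => EuclideanSpace ℂ (Fin (k l + 1))) 2) := fun T =>
    LinearMap.mkContinuous
      { toFun := fun x => ⟨fun l => T.coord l (x l), hmem T x⟩
        map_add' := fun x y => by ext l : 2; exact map_add (T.coord l) _ _
        map_smul' := fun c x => by ext l : 2; exact map_smul (T.coord l) _ _ } ‖T‖ fun x => by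
      refine le_of_sq_le_sq ?_ (by positivity)
      rw [hnorm, mul_pow, hnorm, ← tsum_mul_left]
      refine Summable.tsum_le_tsum (fun l => ?_) (hsum _) ((hsum x).mul_left _)
      rw [← mul_pow]
      exact pow_le_pow_left₀ (norm_nonneg _) (hle T x l) 2
  exact
    { toFun := op
      map_one' := by ext x l : 3; rfl
      map_mul' := fun S T => by ext x l : 3; rfl
      map_zero' := by ext x l : 3; rfl
      map_add' := fun S T => by ext x l : 3; rfl
      commutes' := fun c => by ext x l : 3; rfl
      map_star' := fun T => by
        rw [ContinuousLinearMap.star_eq_adjoint, ContinuousLinearMap.eq_adjoint_iff]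
        intro x y
        rw [lp.inner_eq_tsum, lp.inner_eq_tsum]
        refine tsum_congr fun l => ?_
        change ⟪(star (T.coord l)) (x l), y l⟫_ℂ = ⟪x l, T.coord l (y l)⟫_ℂ
        rw [ContinuousLinearMap.star_eq_adjoint, ContinuousLinearMap.adjoint_inner_left] }

theorem MatProd.blockDiagonal_injective :
    Function.Injective (MatProd.blockDiagonal (k := k)) := by
  classical
  intro S T h
  ext l : 1
  refine ContinuousLinearMap.ext fun v => ?_
  let ξ : lp (fun l => EuclideanSpace ℂ (Fin (k l + 1))) 2 :=
    lp.single (E := fun l => EuclideanSpace ℂ (Fin (k l + 1))) 2 l v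
  have hξ : ξ l = v :=
    lp.single_apply_self (E := fun l => EuclideanSpace ℂ (Fin (k l + 1))) 2 l v
  have : S.coord l (ξ l) = T.coord l (ξ l) :=
    congrArg (fun Z : lp (fun l => EuclideanSpace ℂ (Fin (k l + 1))) 2 →L[ℂ]
      lp (fun l => EuclideanSpace ℂ (Fin (k l + 1))) 2 => Z ξ l) h
  rwa [hξ] at this

attribute [irreducible] MatProd.instCStarAlgebra

end MatProd

/-! ### Noncommutative polynomials in two families. -/

section PairEval

variable {I J : Type*} {D : Type*} [Ring D] [Algebra ℂ D]

/-- Evaluation of noncommutative polynomials in two families of variables. -/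
noncomputable def pairEval (f : I → D) (g : J → D) : FreeAlgebra ℂ (I ⊕ J) →ₐ[ℂ] D :=
  FreeAlgebra.lift ℂ (Sum.elim f g)

@[simp] theorem pairEval_inl (f : I → D) (g : J → D) (i : I) :
    pairEval f g (FreeAlgebra.ι ℂ (Sum.inl i)) = f i := by simp [pairEval]

@[simp] theorem pairEval_inr (f : I → D) (g : J → D) (j : J) :
    pairEval f g (FreeAlgebra.ι ℂ (Sum.inr j)) = g j := by simp [pairEval]

theorem algHom_pairEval {D' : Type*} [Ring D'] [Algebra ℂ D'] (φ : D →ₐ[ℂ] D') (f : I → D)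
    (g : J → D) (x : FreeAlgebra ℂ (I ⊕ J)) :
    φ (pairEval f g x) = pairEval (fun i => φ (f i)) (fun j => φ (g j)) x := by
  have : φ.comp (pairEval f g) = pairEval (fun i => φ (f i)) (fun j => φ (g j)) := by
    refine FreeAlgebra.hom_ext (funext fun s => ?_)
    rcases s with i | j <;> simp
  exact DFunLike.congr_fun this x

theorem range_pairEval (f : I → D) (g : J → D) :
    Set.range (pairEval f g) = (Algebra.adjoin ℂ (Set.range f ∪ Set.range g) : Set D) := by
  rw [← Set.Sum.elim_range, Algebra.adjoin_range_eq_range_freeAlgebra_lift]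
  rfl

/-- Using the elements and their adjoints as two families of variables turns generation as a
C*-algebra into density of ordinary polynomials, so homomorphisms can be built with
`exists_algHom_of_norm_le`. -/
theorem denseRange_pairEval_star {N : Type*} [CStarAlgebra N] (f : I → N)
    (hf : (StarAlgebra.adjoin ℂ (Set.range f)).topologicalClosure = ⊤) :
    DenseRange (pairEval f fun i => star (f i)) := by
  intro y
  have hy : y ∈ (StarAlgebra.adjoin ℂ (Set.range f)).topologicalClosure := by rw [hf]; trivial
  have h2 : ((StarAlgebra.adjoin ℂ (Set.range f) : StarSubalgebra ℂ N) : Set N) =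
      Set.range (pairEval f fun i => star (f i)) := by
    rw [range_pairEval, ← StarSubalgebra.coe_toSubalgebra, StarAlgebra.adjoin_toSubalgebra]
    congr 3
    ext z
    simp only [Set.mem_star, Set.mem_range]
    exact ⟨fun ⟨i, hi⟩ => ⟨i, by rw [hi, star_star]⟩, fun ⟨i, hi⟩ => ⟨i, by rw [← hi, star_star]⟩⟩
  rw [← h2]
  exact hy

/-- The ranges of r and s are closed under adjoints, so no further variables are needed. -/
theorem denseRange_pairEval_of_starHom {R S F : Type*} [CStarAlgebra R] [CStarAlgebra S]
    [CStarAlgebra F] (r : R →⋆ₐ[ℂ] F) (s : S →⋆ₐ[ℂ] F)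
    (h : (StarAlgebra.adjoin ℂ (Set.range r ∪ Set.range s)).topologicalClosure = ⊤) :
    DenseRange (pairEval r s) := by
  intro y
  have hy : y ∈ (StarAlgebra.adjoin ℂ (Set.range r ∪ Set.range s)).topologicalClosure := by
    rw [h]; trivial
  have h2 : ((StarAlgebra.adjoin ℂ (Set.range r ∪ Set.range s) : StarSubalgebra ℂ F) : Set F) =
      Set.range (pairEval r s) := by
    rw [range_pairEval, ← StarSubalgebra.coe_toSubalgebra, StarAlgebra.adjoin_toSubalgebra]
    congr 2
    refine Set.union_eq_left.2 ?_
    rintro z (⟨x, hx⟩ | ⟨x, hx⟩)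
    · exact Or.inl ⟨star x, by rw [map_star, hx, star_star]⟩
    · exact Or.inr ⟨star x, by rw [map_star, hx, star_star]⟩
  rw [← h2]
  exact hy

theorem starHom_ext_of_topologicalClosure_adjoin {N D : Type*} [CStarAlgebra N] [CStarAlgebra D]
    {s : Set N} (hs : (StarAlgebra.adjoin ℂ s).topologicalClosure = ⊤) (φ ψ : N →⋆ₐ[ℂ] D)
    (h : Set.EqOn φ ψ s) : φ = ψ := by
  have h1 : StarAlgebra.adjoin ℂ s ≤ StarAlgHom.equalizer φ ψ :=
    StarAlgHom.adjoin_le_equalizer φ ψ h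
  have h2 : (StarAlgebra.adjoin ℂ s).topologicalClosure ≤ StarAlgHom.equalizer φ ψ :=
    StarSubalgebra.topologicalClosure_minimal h1
      (isClosed_eq (continuous_starHom φ) (continuous_starHom ψ))
  rw [hs] at h2
  exact StarAlgHom.ext fun x => h2 (show x ∈ (⊤ : StarSubalgebra ℂ N) from trivial)

theorem topologicalClosure_adjoin_eq_top_of_image {N : Type*} [CStarAlgebra N] (s : Set N)
    (t : Set (StarAlgebra.adjoin ℂ s).topologicalClosure) (ht : Subtype.val '' t = s) :
    (StarAlgebra.adjoin ℂ t).topologicalClosure = ⊤ := by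
  refine eq_top_iff.2 fun x _ => ?_
  change x ∈ closure ((StarAlgebra.adjoin ℂ t : StarSubalgebra ℂ _) : Set _)
  rw [closure_subtype]
  have h1 : Subtype.val '' ((StarAlgebra.adjoin ℂ t : StarSubalgebra ℂ _) :
      Set (StarAlgebra.adjoin ℂ s).topologicalClosure) = (StarAlgebra.adjoin ℂ s : Set N) := by
    have := StarAlgHom.map_adjoin (StarSubalgebra.subtype
      (StarAlgebra.adjoin ℂ s).topologicalClosure) t
    have h3 := congrArg (fun S : StarSubalgebra ℂ N => (S : Set N)) this
    simp only [StarSubalgebra.coe_map] at h3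
    refine h3.trans ?_
    congr 2
  rw [h1]
  exact x.2

instance isClosed_topologicalClosure_adjoin {N : Type*} [CStarAlgebra N] (s : Set N) :
    IsClosed ((StarAlgebra.adjoin ℂ s).topologicalClosure : Set N) :=
  StarSubalgebra.isClosed_topologicalClosure _

end PairEval

/-! ### The RFD-maximal cover and its universal property. -/

section FinCover

variable {M : Type u} [CStarAlgebra M] (A : Subalgebra ℂ M)

/-- The product of all finite-dimensional representations. -/
noncomputable def finRepProd : A →ₐ[ℂ] MatProd (fun σ : FinRep A => σ.deg) :=
  MatProd.lift (fun σ => σ.hom) fun a => ⟨‖a‖, fun σ => σ.contractive.norm_le a⟩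

/-- The C*-algebra generated by `A` in the product of all its finite-dimensional
representations. -/
noncomputable abbrev FinCover : StarSubalgebra ℂ (MatProd fun σ : FinRep A => σ.deg) :=
  (StarAlgebra.adjoin ℂ (Set.range (finRepProd A))).topologicalClosure

/-- The canonical homomorphism `A → FinCover A`. -/
noncomputable def finCoverMap : A →ₐ[ℂ] FinCover A :=
  (finRepProd A).codRestrict (FinCover A).toSubalgebra fun a =>
    StarSubalgebra.le_topologicalClosure _ (StarAlgebra.subset_adjoin ℂ _ ⟨a, rfl⟩)

/-- The coordinates of `FinCover A`. -/
noncomputable def finCoverEval (σ : FinRep A) : FinCover A →⋆ₐ[ℂ] MatAlg σ.deg :=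
  (MatProd.eval σ).comp (StarSubalgebra.subtype (FinCover A))

variable {A}

theorem finCover_matNorm_le {n : ℕ} (X : Matrix (Fin n) (Fin n) (FinCover A)) {C : ℝ} (hC : 0 ≤ C)
    (h : ∀ σ : FinRep A, matNorm (X.map (finCoverEval A σ)) ≤ C) : matNorm X ≤ C :=
  matNorm_le_of_forall_map (fun σ : FinRep A => finCoverEval A σ)
    (fun x hx => Subtype.ext (MatProd.ext_eval fun σ =>
      (hx σ).trans (map_zero (MatProd.eval σ)).symm)) X hC h

theorem isResiduallyFinite_finCover : IsResiduallyFinite (FinCover A) :=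
  isResiduallyFinite_of_injective (StarSubalgebra.subtype (FinCover A)) Subtype.val_injective
    MatProd.isResiduallyFinite

theorem generates_finCoverMap :
    (StarAlgebra.adjoin ℂ (Set.range (finCoverMap A))).topologicalClosure = ⊤ := by
  refine topologicalClosure_adjoin_eq_top_of_image _ _ ?_
  rw [← Set.range_comp]
  rfl

theorem completelyContractive_finCoverMap : CompletelyContractive A (finCoverMap A) :=
  fun n X => finCover_matNorm_le _ (matNorm_nonneg _) fun σ => σ.contractive n X

theorem IsRFD.completelyIsometric_finCoverMap (hA : IsRFD A) :
    CompletelyIsometric A (finCoverMap A) := fun n X =>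
  le_antisymm (completelyContractive_finCoverMap n X)
    (hA.matNorm_le X (matNorm_nonneg _) fun σ =>
      matNorm_map_le (finCoverEval A σ) (X.map (finCoverMap A)))

theorem IsRFD.isCStarCover_finCoverMap (hA : IsRFD A) : IsCStarCover A (finCoverMap A) :=
  ⟨hA.completelyIsometric_finCoverMap, generates_finCoverMap⟩

/-- `FinCover A` is universal for completely contractive homomorphisms into residually
finite-dimensional C*-algebras. -/
theorem exists_starHom_finCover {S : Type v} [CStarAlgebra S] (hS : IsResiduallyFinite S)
    (τ : A →ₐ[ℂ] S) (hτ : CompletelyContractive A τ) :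
    ∃ h : FinCover A →⋆ₐ[ℂ] S, ∀ a, h (finCoverMap A a) = τ a := by
  obtain ⟨h, hn, hh⟩ := exists_algHom_of_norm_le
    (pairEval (finCoverMap A) fun a => star (finCoverMap A a)) (pairEval τ fun a => star (τ a))
    (denseRange_pairEval_star _ generates_finCoverMap) fun x => by
      refine hS.norm_le _ (norm_nonneg _) fun k ρ => ?_
      -- The composite of ρ and τ is itself a coordinate of `FinCover A`, and this coordinate
      -- dominates ρ on polynomials in the τ a and their adjoints.
      let σ : FinRep A := ⟨k, (ρ : S →ₐ[ℂ] MatAlg k).comp τ, hτ.comp_starHom ρ⟩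
      have h1 := algHom_pairEval (ρ : S →ₐ[ℂ] MatAlg k) τ (fun a => star (τ a)) x
      have h2 := algHom_pairEval (finCoverEval A σ : FinCover A →ₐ[ℂ] MatAlg k) (finCoverMap A)
        (fun a => star (finCoverMap A a)) x
      have h3 : ρ (pairEval τ (fun a => star (τ a)) x) = finCoverEval A σ
          (pairEval (finCoverMap A) (fun a => star (finCoverMap A a)) x) := by
        refine h1.trans (Eq.trans ?_ h2.symm)
        congr 2
        funext a
        change ρ (star (τ a)) = finCoverEval A σ (star (finCoverMap A a))
        rw [map_star, map_star]
        rfl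
      rw [h3]
      exact norm_starHom_le _ _
  refine ⟨starHomOfNormLE h hn, fun a => ?_⟩
  have := hh (FreeAlgebra.ι ℂ (Sum.inl a))
  rwa [pairEval_inl, pairEval_inl] at this

theorem CompletelyIsometric.nontrivial [Nontrivial M] {N : Type*} [CStarAlgebra N]
    {f : A → N} (hf : CompletelyIsometric A f) : Nontrivial N := by
  refine ⟨f 1, 0, fun h => ?_⟩
  have h1 := hf.norm_eq 1
  rw [h, norm_zero] at h1
  have h2 : ‖(1 : A)‖ = 1 := norm_one (α := M)
  linarith

/-- If an RFD cover S lies above through π, universality gives k in the other direction. Then k ∘ π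
fixes the generators of S, so it is the identity and k is surjective. -/
theorem IsRFD.isRFDMaximalCover_finCoverMap [Nontrivial M] (hA : IsRFD A) :
    IsRFDMaximalCover A (finCoverMap A) where
  cover := hA.isCStarCover_finCoverMap
  rfd := by
    have := hA.completelyIsometric_finCoverMap.nontrivial
    exact isResiduallyFinite_finCover.isRFD
  maximal S _ τ hτ hS h := by
    obtain ⟨π, -, hπ⟩ := h
    obtain ⟨k, hk⟩ := exists_starHom_finCover (isResiduallyFinite_of_isRFD hS) τ
      hτ.isometric.completelyContractive
    refine ⟨k, fun y => ⟨π y, ?_⟩, hk⟩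
    have : k.comp π = StarAlgHom.id ℂ S := by
      refine starHom_ext_of_topologicalClosure_adjoin hτ.generates _ _ ?_
      rintro _ ⟨a, rfl⟩
      change k (π (τ a)) = τ a
      rw [hπ, hk]
    exact DFunLike.congr_fun this y

theorem IsRFD.hasRFDMaximalCover [Nontrivial M] (hA : IsRFD A) : HasRFDMaximalCover A :=
  ⟨FinCover A, inferInstance, finCoverMap A, hA.isRFDMaximalCover_finCoverMap⟩

variable {R : Type u} [CStarAlgebra R] {υ : A →ₐ[ℂ] R}

theorem isRFD_of_completelyIsometric [Nontrivial M] (hυ : CompletelyIsometric A υ)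
    (hR : IsResiduallyFinite R) : IsRFD A := by
  refine isRFD_of_forall_finRep A fun n X C hC h => ?_
  rw [← hυ]
  refine hR.matNorm_le _ hC fun k ρ => ?_
  exact h ⟨k, (ρ : R →ₐ[ℂ] MatAlg k).comp υ, hυ.completelyContractive.comp_starHom ρ⟩

theorem IsRFDMaximalCover.isResiduallyFinite (h : IsRFDMaximalCover A υ) :
    IsResiduallyFinite R := isResiduallyFinite_of_isRFD h.rfd

/-- Completely contractive homomorphisms of `A` into residually finite-dimensional C*-algebras
extend to the RFD-maximal C*-cover. -/
theorem IsRFDMaximalCover.exists_starHom [Nontrivial M] (h : IsRFDMaximalCover A υ) {S : Type v}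
    [CStarAlgebra S] (hS : IsResiduallyFinite S) (τ : A →ₐ[ℂ] S) (hτ : CompletelyContractive A τ) :
    ∃ k : R →⋆ₐ[ℂ] S, ∀ a, k (υ a) = τ a := by
  have hA : IsRFD A := isRFD_of_completelyIsometric h.cover.isometric h.isResiduallyFinite
  obtain ⟨p, hp⟩ := exists_starHom_finCover h.isResiduallyFinite υ
    h.cover.isometric.completelyContractive
  have hp' : Function.Surjective p := by
    refine surjective_of_denseRange p fun y => ?_
    refine closure_mono ?_ (denseRange_pairEval_star υ h.cover.generates y)
    rintro _ ⟨x, rfl⟩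
    refine ⟨pairEval (finCoverMap A) (fun a => star (finCoverMap A a)) x, ?_⟩
    refine (algHom_pairEval (p : FinCover A →ₐ[ℂ] R) _ _ x).trans ?_
    congr 2
    · funext a; exact hp a
    · funext a
      change p (star (finCoverMap A a)) = _
      rw [map_star, hp]
  -- The surjection p puts υ below `finCoverMap A`. Maximality then returns a map q from R to
  -- `FinCover A`, along which the universal property is transported.
  obtain ⟨q, -, hq⟩ := h.maximal (FinCover A) (finCoverMap A) hA.isCStarCover_finCoverMap
    hA.isRFDMaximalCover_finCoverMap.rfd ⟨p, hp', hp⟩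
  obtain ⟨k, hk⟩ := exists_starHom_finCover hS τ hτ
  exact ⟨k.comp q, fun a => by rw [StarAlgHom.comp_apply, hq, hk]⟩

end FinCover

/-! ### Complete contractivity implies preservation of accretivity. -/

section Positivity

variable {A₀ : Type*} [Ring A₀] [Algebra ℂ A₀] {R : Type u} [CStarAlgebra R]
  {E : Type*} [NormedAddCommGroup E] [InnerProductSpace ℂ E] [CompleteSpace E]

theorem sum_one_sub_smul_apply {n : ℕ} (X : Matrix (Fin n) (Fin n) A₀) (t : ℂ)
    (π : A₀ →ₐ[ℂ] (E →L[ℂ] E)) (x : Fin n → E) (i : Fin n) :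
    ∑ j, ((1 - t • X).map π) i j (x j) = x i - t • ∑ j, π (X i j) (x j) := by
  have h : ∀ j, ((1 - t • X).map π) i j (x j) = (if i = j then x j else 0) - t • π (X i j) (x j) := by
    intro j
    by_cases hij : i = j
    · subst hij; simp
    · simp [hij, Matrix.one_apply]
  simp_rw [h]
  rw [Finset.sum_sub_distrib, ← Finset.smul_sum]
  simp

/-- For small t the linear term dominates the quadratic one, so norms of 1 - tX detect the sign of
the real part of X. -/
theorem sum_norm_sub_smul_sq {n : ℕ} (x w : Fin n → E) (t : ℝ) :
    ∑ i, ‖x i - (t : ℂ) • w i‖ ^ 2 =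
      ∑ i, ‖x i‖ ^ 2 - 2 * t * (∑ i, ⟪x i, w i⟫_ℂ).re + t ^ 2 * ∑ i, ‖w i‖ ^ 2 := by
  rw [Complex.re_sum, Finset.mul_sum, Finset.mul_sum, ← Finset.sum_sub_distrib,
    ← Finset.sum_add_distrib]
  refine Finset.sum_congr rfl fun i _ => ?_
  rw [@norm_sub_sq ℂ, inner_smul_right, norm_smul, mul_pow]
  simp
  ring

/-- A completely contractive homomorphism maps accretive matrices to accretive matrices. -/
theorem re_sum_inner_nonneg_of_contractive (hR : IsResiduallyFinite R) (f : A₀ →ₐ[ℂ] R)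
    (π : A₀ →ₐ[ℂ] (E →L[ℂ] E))
    (hπ : ∀ (n : ℕ) (X : Matrix (Fin n) (Fin n) A₀), matNorm (X.map π) ≤ matNorm (X.map f))
    {n : ℕ} (X : Matrix (Fin n) (Fin n) A₀)
    (hX : ∀ (k : ℕ) (ρ : R →⋆ₐ[ℂ] MatAlg k) (x : Fin n → EuclideanSpace ℂ (Fin (k + 1))),
      0 ≤ (∑ i, ⟪x i, ∑ j, ρ (f (X i j)) (x j)⟫_ℂ).re) (x : Fin n → E) :
    0 ≤ (∑ i, ⟪x i, ∑ j, π (X i j) (x j)⟫_ℂ).re := by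
  set c := matNorm (X.map f)
  have hc : 0 ≤ c := matNorm_nonneg _
  -- Accretivity in all finite-dimensional representations gives ‖1 - tX‖² ≤ 1 + t²c² there, hence
  -- in R, hence under π. Expanding on x and dividing by t leaves an error of order t.
  have key : ∀ t : ℝ, 0 < t →
      -(t * (c ^ 2 * ∑ i, ‖x i‖ ^ 2)) ≤ 2 * (∑ i, ⟪x i, ∑ j, π (X i j) (x j)⟫_ℂ).re := by
    intro t ht
    have h1 : matNorm ((1 - (t : ℂ) • X).map f) ≤ √(1 + t ^ 2 * c ^ 2) := by
      refine hR.matNorm_le _ (Real.sqrt_nonneg _) fun k ρ => ?_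
      rw [matNorm_le_iff _ (Real.sqrt_nonneg _)]
      intro y
      have h2 := sum_one_sub_smul_apply X t ((ρ : R →ₐ[ℂ] MatAlg k).comp f) y
      have h3 : ∀ i, ∑ j, (((1 - (t : ℂ) • X).map f).map ρ) i j (y j) =
        y i - (t : ℂ) • ∑ j, ρ (f (X i j)) (y j) := h2
      simp_rw [h3]
      rw [sum_norm_sub_smul_sq, Real.sq_sqrt (by positivity)]
      have h4 := sum_norm_sq_le_matNorm ((X.map f).map ρ) y
      have h5 : matNorm ((X.map f).map ρ) ^ 2 ≤ c ^ 2 :=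
        pow_le_pow_left₀ (matNorm_nonneg _) (matNorm_map_le ρ _) 2
      have h6 := h4.trans (mul_le_mul_of_nonneg_right h5 (by positivity))
      simp only [Matrix.map_apply] at h6
      have h7 := hX k ρ y
      nlinarith [mul_le_mul_of_nonneg_left h6 (sq_nonneg t), mul_nonneg ht.le h7]
    have h2 := (matNorm_le_iff _ (Real.sqrt_nonneg _)).1 ((hπ n (1 - (t : ℂ) • X)).trans h1) x
    simp_rw [sum_one_sub_smul_apply] at h2
    rw [sum_norm_sub_smul_sq, Real.sq_sqrt (by positivity)] at h2
    have h8 : 0 ≤ t ^ 2 * ∑ i, ‖∑ j, π (X i j) (x j)‖ ^ 2 := by positivity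
    have h9 : t * (-(t * (c ^ 2 * ∑ i, ‖x i‖ ^ 2))) ≤
        t * (2 * (∑ i, ⟪x i, ∑ j, π (X i j) (x j)⟫_ℂ).re) := by nlinarith
    exact le_of_mul_le_mul_left h9 ht
  set s := (∑ i, ⟪x i, ∑ j, π (X i j) (x j)⟫_ℂ).re
  set q := c ^ 2 * ∑ i, ‖x i‖ ^ 2
  have hq : 0 ≤ q := by positivity
  by_contra hs
  push Not at hs
  -- Here t q ≤ -s, so `key` gives s ≤ 2s, impossible for s < 0.
  have := key (-s / (q + 1)) (div_pos (by linarith) (by linarith))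
  have h2 : -s / (q + 1) * q ≤ -s := by
    rw [div_mul_eq_mul_div, div_le_iff₀ (by linarith)]
    nlinarith
  linarith

end Positivity

/-! ### Finitely supported matrices over an arbitrary index set. -/

section Kernel

variable {I : Type*} {R₀ : Type*} [AddCommGroup R₀] [Module ℂ R₀]
  {K : Type*} [NormedAddCommGroup K] [InnerProductSpace ℂ K]

/-- The functional `y ↦ ∑ ⟪v e, ρ (y e f) (v f)⟫` on finitely supported matrices over `R₀`. -/
noncomputable def kernelForm (ρ : R₀ →ₗ[ℂ] (K →L[ℂ] K)) (v : I → K) : ((I × I) →₀ R₀) →ₗ[ℂ] ℂ :=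
  Finsupp.lsum ℂ fun p =>
    { toFun := fun m => ⟪v p.1, ρ m (v p.2)⟫_ℂ
      map_add' := fun m m' => by simp [inner_add_right]
      map_smul' := fun c m => by simp [inner_smul_right] }

@[simp] theorem kernelForm_single (ρ : R₀ →ₗ[ℂ] (K →L[ℂ] K)) (v : I → K) (p : I × I) (m : R₀) :
    kernelForm ρ v (Finsupp.single p m) = ⟪v p.1, ρ m (v p.2)⟫_ℂ := by
  simp [kernelForm]

theorem kernelForm_mapRange {R₁ : Type*} [AddCommGroup R₁] [Module ℂ R₁] (f : R₁ →ₗ[ℂ] R₀)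
    (ρ : R₀ →ₗ[ℂ] (K →L[ℂ] K)) (v : I → K) (w : (I × I) →₀ R₁) :
    kernelForm ρ v (Finsupp.mapRange.linearMap f w) = kernelForm (ρ ∘ₗ f) v w := by
  have : kernelForm ρ v ∘ₗ Finsupp.mapRange.linearMap f = kernelForm (ρ ∘ₗ f) v := by
    ext p m
    simp
  exact DFunLike.congr_fun this w

/-- With all vectors of E as indices, one functional records every matrix coefficient. Each matrix
still has only finitely many nonzero rows and columns, so questions about it reduce to finite square
matrices. -/
theorem exists_enumeration_support (w : (I × I) →₀ R₀) :
    ∃ (n : ℕ) (e : Fin n → I), Function.Injective e ∧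
      ∀ p, w p ≠ 0 → p.1 ∈ Set.range e ∧ p.2 ∈ Set.range e := by
  classical
  let s : Finset I := w.support.image Prod.fst ∪ w.support.image Prod.snd
  have hs : ∀ x ∈ s, x ∈ Set.range fun i => (s.equivFin.symm i : I) := fun x hx =>
    ⟨s.equivFin ⟨x, hx⟩, by simp⟩
  refine ⟨s.card, fun i => s.equivFin.symm i,
    Subtype.val_injective.comp s.equivFin.symm.injective, fun p hp => ⟨hs _ ?_, hs _ ?_⟩⟩
  · exact Finset.mem_union_left _ (Finset.mem_image_of_mem _ (Finsupp.mem_support_iff.2 hp))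
  · exact Finset.mem_union_right _ (Finset.mem_image_of_mem _ (Finsupp.mem_support_iff.2 hp))

theorem kernelForm_eq_sum {n : ℕ} {e : Fin n → I} (he : Function.Injective e)
    {w : (I × I) →₀ R₀} (hw : ∀ p, w p ≠ 0 → p.1 ∈ Set.range e ∧ p.2 ∈ Set.range e)
    (ρ : R₀ →ₗ[ℂ] (K →L[ℂ] K)) (v : I → K) :
    kernelForm ρ v w = ∑ i, ⟪v (e i), ∑ j, ρ (w (e i, e j)) (v (e j))⟫_ℂ := by
  classical
  let s : Finset I := Finset.univ.image e
  have h1 : w.support ⊆ s ×ˢ s := fun p hp => by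
    obtain ⟨⟨i, hi⟩, ⟨j, hj⟩⟩ := hw p (Finsupp.mem_support_iff.1 hp)
    simp [s, ← hi, ← hj]
  have h2 : kernelForm ρ v w = ∑ p ∈ s ×ˢ s, ⟪v p.1, ρ (w p) (v p.2)⟫_ℂ := by
    refine (Finsupp.sum_of_support_subset w h1 _ ?_)
    simp
  rw [h2, Finset.sum_product, Finset.sum_image he.injOn]
  simp only [inner_sum]
  exact Finset.sum_congr rfl fun i _ => Finset.sum_image he.injOn

end Kernel

/-! ### Positive extension from A to its C*-cover. -/

section Extension

variable {M : Type*} [CStarAlgebra M] {A : Subalgebra ℂ M} {R : Type u} [CStarAlgebra R]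

/-- The cone of finitely supported matrices over `R` with positive real part. -/
def accretiveCone (I : Type*) (R : Type*) [CStarAlgebra R] : PointedCone ℝ ((I × I) →₀ R) where
  carrier := {y | ∀ (k : ℕ) (ρ : R →⋆ₐ[ℂ] MatAlg k) (v : I → EuclideanSpace ℂ (Fin (k + 1))),
    0 ≤ (kernelForm (ρ : R →ₐ[ℂ] MatAlg k).toLinearMap v y).re}
  zero_mem' := fun k ρ v => by simp
  add_mem' := fun {x y} hx hy k ρ v => by
    rw [map_add, Complex.add_re]; exact add_nonneg (hx k ρ v) (hy k ρ v)
  smul_mem' := fun c x hx k ρ v => by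
    have h : kernelForm (ρ : R →ₐ[ℂ] MatAlg k).toLinearMap v (c • x) =
        (c : ℝ) • kernelForm (ρ : R →ₐ[ℂ] MatAlg k).toLinearMap v x := by
      rw [← LinearMap.map_smul_of_tower]; rfl
    change 0 ≤ (kernelForm (ρ : R →ₐ[ℂ] MatAlg k).toLinearMap v (c • x)).re
    rw [h, Complex.smul_re]
    exact mul_nonneg c.2 (hx k ρ v)

/-- An entry m at (e, f) is dominated by ‖m‖ at (e, e) and (f, f), by Cauchy–Schwarz and the
arithmetic-geometric mean inequality. This is the cofinality required by `riesz_extension`. -/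
theorem exists_add_mem_accretiveCone {I : Type*} (y : (I × I) →₀ R) :
    ∃ c : (I × I) →₀ ℝ, Finsupp.mapRange.linearMap
      ((Algebra.linearMap ℝ R)) c + y ∈ accretiveCone I R := by
  induction y using Finsupp.induction_linear with
  | zero => exact ⟨0, by simp⟩
  | add x y hx hy =>
    obtain ⟨c, hc⟩ := hx
    obtain ⟨d, hd⟩ := hy
    refine ⟨c + d, ?_⟩
    have := add_mem hc hd
    rw [map_add]
    convert this using 1
    abel
  | single p m =>
    refine ⟨Finsupp.single (p.1, p.1) ‖m‖ + Finsupp.single (p.2, p.2) ‖m‖, fun k ρ v => ?_⟩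
    have h1 : ∀ x, ρ (algebraMap ℝ R ‖m‖) x = (‖m‖ : ℂ) • x := fun x => by
      rw [Algebra.algebraMap_eq_smul_one, ← Complex.coe_smul, map_smul, map_one]
      rfl
    simp only [map_add, Finsupp.mapRange.linearMap_apply, Finsupp.mapRange_single,
      kernelForm_single, Algebra.linearMap_apply, AlgHom.toLinearMap_apply]
    change 0 ≤ (⟪v p.1, ρ (algebraMap ℝ R ‖m‖) (v p.1)⟫_ℂ +
      ⟪v p.2, ρ (algebraMap ℝ R ‖m‖) (v p.2)⟫_ℂ + ⟪v p.1, ρ m (v p.2)⟫_ℂ).re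
    rw [h1, h1, inner_smul_right, inner_smul_right, inner_self_eq_norm_sq_to_K,
      inner_self_eq_norm_sq_to_K]
    have h2 : |(⟪v p.1, ρ m (v p.2)⟫_ℂ).re| ≤ ‖m‖ * (‖v p.1‖ * ‖v p.2‖) := by
      refine (Complex.abs_re_le_norm _).trans ((norm_inner_le_norm _ _).trans ?_)
      have := ContinuousLinearMap.le_of_opNorm_le (ρ m) (norm_starHom_le ρ m) (v p.2)
      nlinarith [norm_nonneg (v p.1)]
    have h3 : ∀ a b : ℝ, (((a : ℂ)) * ((b : ℝ) : ℂ) ^ 2).re = a * b ^ 2 := fun a b => by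
      rw [← Complex.ofReal_pow, ← Complex.ofReal_mul, Complex.ofReal_re]
    simp only [Complex.add_re]
    have h5 : ∀ x : EuclideanSpace ℂ (Fin (k + 1)),
        ((‖m‖ : ℂ) * ((‖x‖ : ℝ) : ℂ) ^ 2).re = ‖m‖ * ‖x‖ ^ 2 := fun x => h3 _ _
    change 0 ≤ ((‖m‖ : ℂ) * ((‖v p.1‖ : ℝ) : ℂ) ^ 2).re + ((‖m‖ : ℂ) * ((‖v p.2‖ : ℝ) : ℂ) ^ 2).re
      + _
    rw [h5, h5]
    have h4 := (abs_le.1 h2).1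
    nlinarith [norm_nonneg m, mul_nonneg (norm_nonneg m) (sq_nonneg (‖v p.1‖ - ‖v p.2‖)),
      mul_nonneg (norm_nonneg m) (sq_nonneg (‖v p.1‖ + ‖v p.2‖))]

variable {E : Type*} [NormedAddCommGroup E] [InnerProductSpace ℂ E] [CompleteSpace E]

/-- Arveson's extension theorem, in dual form. -/
theorem exists_positive_extension (hR : IsResiduallyFinite R) (υ : A →ₐ[ℂ] R)
    (hυ : CompletelyIsometric A υ) (π : A →ₐ[ℂ] (E →L[ℂ] E)) (hπ : CompletelyContractive A π) :
    ∃ Φ : ((E × E) →₀ R) →ₗ[ℂ] ℂ, (∀ y ∈ accretiveCone E R, 0 ≤ (Φ y).re) ∧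
      ∀ (e f : E) (a : A), Φ (Finsupp.single (e, f) (υ a)) = ⟪e, π a f⟫_ℂ := by
  have hυ' : Function.Injective υ := (injective_iff_map_eq_zero υ).2 fun a ha => by
    have := hυ.norm_eq a
    rw [ha, norm_zero] at this
    exact norm_eq_zero.1 this.symm
  let J : ((E × E) →₀ A) →ₗ[ℂ] ((E × E) →₀ R) := Finsupp.mapRange.linearMap υ.toLinearMap
  have hJ : Function.Injective (J.restrictScalars ℝ) :=
    Finsupp.mapRange_injective _ (map_zero _) hυ'
  let eJ := LinearEquiv.ofInjective (J.restrictScalars ℝ) hJ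
  let ψ : ((E × E) →₀ A) →ₗ[ℂ] ℂ := kernelForm π.toLinearMap id
  let f : ((E × E) →₀ R) →ₗ.[ℝ] ℝ :=
    { domain := LinearMap.range (J.restrictScalars ℝ)
      toFun := Complex.reLm ∘ₗ ψ.restrictScalars ℝ ∘ₗ eJ.symm.toLinearMap }
  have hf : ∀ w : (E × E) →₀ A, f ⟨J w, ⟨w, rfl⟩⟩ = (ψ w).re := fun w => by
    have : eJ.symm ⟨J w, ⟨w, rfl⟩⟩ = w := eJ.symm_apply_apply w
    change (ψ (eJ.symm ⟨J w, ⟨w, rfl⟩⟩)).re = _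
    rw [this]
  -- Nonnegativity of f on cone elements coming from A is the accretive form of the complete
  -- contractivity of π.
  obtain ⟨g, hg1, hg2⟩ := riesz_extension (accretiveCone E R) f (by
    rintro ⟨_, w, rfl⟩ hw
    change 0 ≤ f ⟨J w, ⟨w, rfl⟩⟩
    rw [hf]
    obtain ⟨n, e, he, hen⟩ := exists_enumeration_support w
    rw [kernelForm_eq_sum he hen]
    refine re_sum_inner_nonneg_of_contractive hR υ π (fun m X => (hπ m X).trans (hυ m X).ge)
      (Matrix.of fun i j => w (e i, e j)) (fun k ρ x => ?_) _
    -- The vectors x are placed along the rows and columns that w uses; the default 0 elsewhere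
    -- plays no role.
    have h1 := hw k ρ (Function.extend e x 0)
    change 0 ≤ (kernelForm _ _ (Finsupp.mapRange.linearMap υ.toLinearMap w)).re at h1
    rw [kernelForm_mapRange, kernelForm_eq_sum he hen] at h1
    simpa [he.extend_apply] using h1) (by
    intro y
    obtain ⟨c, hc⟩ := exists_add_mem_accretiveCone y
    -- The dominating matrix has scalar entries, so it comes from A because A and υ are unital.
    refine ⟨⟨_, Finsupp.mapRange.linearMap (Algebra.linearMap ℝ A) c, rfl⟩, ?_⟩
    convert hc using 2
    ext p
    change υ (algebraMap ℝ A (c p)) = algebraMap ℝ R (c p)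
    rw [Algebra.algebraMap_eq_smul_one, Algebra.algebraMap_eq_smul_one, ← Complex.coe_smul,
      ← Complex.coe_smul, map_smul, map_one])
  have hre : ∀ w, g (J w) = (ψ w).re := fun w => (hg1 ⟨J w, ⟨w, rfl⟩⟩).trans (hf w)
  -- g is only real linear; Φ is the complex functional with real part g. It agrees with ψ on A
  -- because the real parts agree at w and at i w.
  let Φ : ((E × E) →₀ R) →ₗ[ℂ] ℂ := Module.Dual.extendRCLike g
  have hΦ : ∀ y, (Φ y).re = g y := Module.Dual.re_extendRCLike_apply (𝕜 := ℂ) g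
  have hΦJ : ∀ w, Φ (J w) = ψ w := fun w => by
    refine Complex.ext ((hΦ _).trans (hre w)) ?_
    have h1 := (hΦ (J (Complex.I • w))).trans (hre (Complex.I • w))
    rw [map_smul, map_smul, map_smul] at h1
    simpa using h1
  refine ⟨Φ, fun y hy => (hΦ y).symm ▸ hg2 y hy, fun x z a => ?_⟩
  have := hΦJ (Finsupp.single (x, z) a)
  simpa [J, ψ] using this

end Extension

/-! ### The Stinespring construction for a positive functional on kernels. -/

section Stinespring

variable {I : Type*} {R : Type*} [CStarAlgebra R]

/-- The matrix `(star (x e) * y f)` over `R`. -/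
noncomputable def gramKernel (x y : I →₀ R) : (I × I) →₀ R :=
  x.sum fun e m => y.sum fun f m' => Finsupp.single (e, f) (star m * m')

theorem gramKernel_add_left (x y z : I →₀ R) :
    gramKernel (x + y) z = gramKernel x z + gramKernel y z := by
  classical
  refine Finsupp.sum_add_index' (fun e => ?_) fun e m m' => ?_
  · simp
  · simp [add_mul, Finsupp.sum_add]

theorem gramKernel_smul_left (c : ℂ) (x y : I →₀ R) :
    gramKernel (c • x) y = star c • gramKernel x y := by
  classical
  unfold gramKernel
  rw [Finsupp.sum_smul_index' (fun e => by simp), Finsupp.smul_sum]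
  refine Finsupp.sum_congr fun e _ => ?_
  rw [Finsupp.smul_sum]
  refine Finsupp.sum_congr fun f _ => ?_
  rw [Finsupp.smul_single, star_smul, smul_mul_assoc]

/-- Entrywise left multiplication. -/
noncomputable def entrywiseMul (I : Type*) (a : R) : (I →₀ R) →ₗ[ℂ] (I →₀ R) :=
  Finsupp.mapRange.linearMap (LinearMap.mulLeft ℂ a)

@[simp] theorem entrywiseMul_single (a : R) (i : I) (m : R) :
    entrywiseMul I a (Finsupp.single i m) = Finsupp.single i (a * m) := by
  simp [entrywiseMul]

theorem entrywiseMul_mul (a b : R) (x : I →₀ R) :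
    entrywiseMul I (a * b) x = entrywiseMul I a (entrywiseMul I b x) := by
  ext i; simp [entrywiseMul, mul_assoc]

theorem entrywiseMul_add (a b : R) (x : I →₀ R) :
    entrywiseMul I (a + b) x = entrywiseMul I a x + entrywiseMul I b x := by
  ext i; simp [entrywiseMul, add_mul]

theorem entrywiseMul_smul_one (c : ℂ) (x : I →₀ R) :
    entrywiseMul I (c • (1 : R)) x = c • x := by
  ext i; simp [entrywiseMul]

theorem gramKernel_entrywiseMul_left (a : R) (x y : I →₀ R) :
    gramKernel (entrywiseMul I a x) y = gramKernel x (entrywiseMul I (star a) y) := by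
  unfold gramKernel entrywiseMul
  simp only [Finsupp.mapRange.linearMap_apply]
  rw [Finsupp.sum_mapRange_index (fun e => by simp)]
  refine Finsupp.sum_congr fun e _ => ?_
  rw [Finsupp.sum_mapRange_index (fun e => by simp)]
  refine Finsupp.sum_congr fun f _ => ?_
  simp [mul_assoc]

section
variable {K : Type*} [NormedAddCommGroup K] [InnerProductSpace ℂ K] [CompleteSpace K]

theorem kernelForm_gramKernel (ρ : R →⋆ₐ[ℂ] (K →L[ℂ] K)) (v : I → K) (x y : I →₀ R) :
    kernelForm (ρ : R →ₐ[ℂ] (K →L[ℂ] K)).toLinearMap v (gramKernel x y) =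
      ⟪x.sum fun e m => ρ m (v e), y.sum fun e m => ρ m (v e)⟫_ℂ := by
  simp only [gramKernel, Finsupp.sum, map_sum, sum_inner, inner_sum, kernelForm_single]
  refine (Finset.sum_congr rfl fun e _ => Finset.sum_congr rfl fun f _ => ?_).trans
    Finset.sum_comm
  change ⟪v e, ρ (star (x e) * y f) (v f)⟫_ℂ = _
  rw [map_mul, map_star, ContinuousLinearMap.star_eq_adjoint, mul_apply_eq_comp,
    ContinuousLinearMap.adjoint_inner_right]

theorem sum_entrywiseMul (ρ : R →⋆ₐ[ℂ] (K →L[ℂ] K)) (v : I → K) (a : R) (x : I →₀ R) :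
    ((entrywiseMul I a x).sum fun e m => ρ m (v e)) = ρ a (x.sum fun e m => ρ m (v e)) := by
  unfold entrywiseMul
  rw [Finsupp.mapRange.linearMap_apply, Finsupp.sum_mapRange_index (fun e => by simp)]
  simp [Finsupp.sum, map_sum]

end

/-- A functional on finitely supported matrices over `R` which is positive on accretive ones. -/
structure PositiveKernelFunctional (I : Type*) (R : Type*) [CStarAlgebra R] where
  toFun : ((I × I) →₀ R) →ₗ[ℂ] ℂ
  nonneg : ∀ y ∈ accretiveCone I R, 0 ≤ (toFun y).re

namespace PositiveKernelFunctional

variable (Φ : PositiveKernelFunctional I R)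

/-- Both y and -y lie in the accretive cone. -/
theorem re_eq_zero (y : (I × I) →₀ R) (hy : ∀ (k : ℕ) (ρ : R →⋆ₐ[ℂ] MatAlg k)
    (v : I → EuclideanSpace ℂ (Fin (k + 1))),
      (kernelForm (ρ : R →ₐ[ℂ] MatAlg k).toLinearMap v y).re = 0) : (Φ.toFun y).re = 0 := by
  have h1 := Φ.nonneg y fun k ρ v => (hy k ρ v).ge
  have h2 := Φ.nonneg (-y) fun k ρ v => by
    rw [map_neg, Complex.neg_re, hy, neg_zero]
  rw [map_neg, Complex.neg_re] at h2
  linarith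

/-- In each finite-dimensional representation the two Gram kernels give conjugate inner products.
Hence their difference, and i times their sum, have real part zero there, and so also under Φ. -/
theorem conj_symm (x y : I →₀ R) :
    star (Φ.toFun (gramKernel y x)) = Φ.toFun (gramKernel x y) := by
  have h1 := Φ.re_eq_zero (gramKernel x y - gramKernel y x) fun k ρ v => by
    rw [map_sub, kernelForm_gramKernel, kernelForm_gramKernel, Complex.sub_re, sub_eq_zero,
      ← inner_conj_symm]
    rfl
  have h2 := Φ.re_eq_zero (Complex.I • (gramKernel x y + gramKernel y x)) fun k ρ v => by
    rw [map_smul, map_add, kernelForm_gramKernel, kernelForm_gramKernel, smul_eq_mul,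
      Complex.I_mul_re, Complex.add_im, neg_eq_zero, ← inner_conj_symm]
    exact neg_add_cancel _
  rw [map_sub, Complex.sub_re] at h1
  rw [map_smul, map_add] at h2
  simp at h2
  refine Complex.ext ?_ ?_
  · change (Φ.toFun (gramKernel y x)).re = _
    linarith
  · change -(Φ.toFun (gramKernel y x)).im = _
    linarith

theorem re_nonneg (x : I →₀ R) : 0 ≤ (Φ.toFun (gramKernel x x)).re := by
  refine Φ.nonneg _ fun k ρ v => ?_
  rw [kernelForm_gramKernel]
  exact inner_self_nonneg (𝕜 := ℂ)

/-- Representations are contractive, so ‖a‖² times the Gram kernel of x minus that of a x is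
accretive. This makes left multiplication bounded. -/
theorem entrywiseMul_le (a : R) (x : I →₀ R) :
    (Φ.toFun (gramKernel (entrywiseMul I a x) (entrywiseMul I a x))).re ≤
      ‖a‖ ^ 2 * (Φ.toFun (gramKernel x x)).re := by
  have := Φ.nonneg (((‖a‖ ^ 2 : ℝ) : ℂ) • gramKernel x x -
    gramKernel (entrywiseMul I a x) (entrywiseMul I a x)) fun k ρ v => by
      rw [map_sub, map_smul, kernelForm_gramKernel, kernelForm_gramKernel, sum_entrywiseMul,
        Complex.sub_re, smul_eq_mul, Complex.re_ofReal_mul]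
      set z := x.sum fun e m => ρ m (v e)
      have h1 : (⟪z, z⟫_ℂ).re = ‖z‖ ^ 2 := inner_self_eq_norm_sq (𝕜 := ℂ) z
      have h2 : (⟪ρ a z, ρ a z⟫_ℂ).re = ‖ρ a z‖ ^ 2 := inner_self_eq_norm_sq (𝕜 := ℂ) _
      rw [h1, h2, ← mul_pow, sub_nonneg]
      exact pow_le_pow_left₀ (norm_nonneg _)
        (ContinuousLinearMap.le_of_opNorm_le _ (norm_starHom_le ρ a) z) 2
  rw [map_sub, map_smul, Complex.sub_re, smul_eq_mul, Complex.re_ofReal_mul] at this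
  linarith

set_option linter.unusedVariables false in
/-- The space of finitely supported functions `I → R` with the semi-inner product of `Φ`. -/
@[nolint unusedArguments]
def Pre (Φ : PositiveKernelFunctional I R) := I →₀ R

noncomputable instance : AddCommGroup Φ.Pre := inferInstanceAs (AddCommGroup (I →₀ R))
noncomputable instance : Module ℂ Φ.Pre := inferInstanceAs (Module ℂ (I →₀ R))

/-- The identity map onto `Pre`. -/
noncomputable def toPre : (I →₀ R) ≃ₗ[ℂ] Φ.Pre := LinearEquiv.refl ℂ _

/-- The identity map from `Pre`. -/
noncomputable def ofPre : Φ.Pre ≃ₗ[ℂ] (I →₀ R) := Φ.toPre.symm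

@[simp] theorem ofPre_toPre (x : I →₀ R) : Φ.ofPre (Φ.toPre x) = x := rfl

@[simp] theorem toPre_ofPre (x : Φ.Pre) : Φ.toPre (Φ.ofPre x) = x := rfl

/-- The semi-inner product of `Φ`. -/
noncomputable abbrev preCore : PreInnerProductSpace.Core ℂ Φ.Pre where
  inner x y := Φ.toFun (gramKernel (Φ.ofPre x) (Φ.ofPre y))
  conj_inner_symm x y := Φ.conj_symm _ _
  re_inner_nonneg x := Φ.re_nonneg _
  add_left x y z := by rw [map_add, gramKernel_add_left, map_add]
  smul_left x y c := by rw [map_smul, gramKernel_smul_left, map_smul]; rfl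

noncomputable instance : SeminormedAddCommGroup Φ.Pre :=
  InnerProductSpace.Core.toSeminormedAddCommGroup (c := Φ.preCore)

noncomputable instance : InnerProductSpace ℂ Φ.Pre :=
  InnerProductSpace.ofCore Φ.preCore

theorem pre_inner (x y : Φ.Pre) :
    ⟪x, y⟫_ℂ = Φ.toFun (gramKernel (Φ.ofPre x) (Φ.ofPre y)) := rfl

theorem pre_norm_sq (x : Φ.Pre) :
    ‖x‖ ^ 2 = (Φ.toFun (gramKernel (Φ.ofPre x) (Φ.ofPre x))).re := by
  rw [← pre_inner]
  exact (inner_self_eq_norm_sq (𝕜 := ℂ) x).symm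

/-- Left multiplication by `a`. -/
noncomputable def leftMul (a : R) : Φ.Pre →L[ℂ] Φ.Pre :=
  (Φ.toPre.toLinearMap ∘ₗ entrywiseMul I a ∘ₗ Φ.ofPre.toLinearMap).mkContinuous ‖a‖ fun x => by
    refine le_of_sq_le_sq ?_ (by positivity)
    rw [mul_pow, pre_norm_sq, pre_norm_sq]
    exact Φ.entrywiseMul_le a _

theorem leftMul_apply (a : R) (x : Φ.Pre) :
    Φ.leftMul a x = Φ.toPre (entrywiseMul I a (Φ.ofPre x)) := rfl

/-- The Hilbert space of `Φ`. -/
abbrev Space := UniformSpace.Completion Φ.Pre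

theorem completion_ext {T T' : Φ.Space →L[ℂ] Φ.Space}
    (h : ∀ z : Φ.Pre, T (z : Φ.Space) = T' (z : Φ.Space)) : T = T' := by
  refine ContinuousLinearMap.ext fun z => ?_
  induction z using UniformSpace.Completion.induction_on with
  | hp => exact isClosed_eq T.continuous T'.continuous
  | ih z => exact h z

/-- Left multiplication on the Hilbert space of `Φ`. -/
noncomputable def mulOp (a : R) : Φ.Space →L[ℂ] Φ.Space := (Φ.leftMul a).completion

theorem mulOp_coe (a : R) (x : Φ.Pre) : Φ.mulOp a (x : Φ.Space) = (Φ.leftMul a x : Φ.Pre) :=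
  ContinuousLinearMap.completion_apply_coe _ _

theorem mulOp_smul_one (c : ℂ) : Φ.mulOp (c • (1 : R)) = c • (1 : Φ.Space →L[ℂ] Φ.Space) := by
  refine Φ.completion_ext fun z => ?_
  rw [mulOp_coe, leftMul_apply, entrywiseMul_smul_one, map_smul, toPre_ofPre,
    UniformSpace.Completion.coe_smul]
  rfl

theorem mulOp_add (a b : R) : Φ.mulOp (a + b) = Φ.mulOp a + Φ.mulOp b := by
  refine Φ.completion_ext fun z => ?_
  rw [add_apply, mulOp_coe, mulOp_coe, mulOp_coe, leftMul_apply,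
    entrywiseMul_add, map_add, UniformSpace.Completion.coe_add]
  rfl

theorem mulOp_mul (a b : R) : Φ.mulOp (a * b) = Φ.mulOp a * Φ.mulOp b := by
  refine Φ.completion_ext fun z => ?_
  rw [mul_apply_eq_comp, mulOp_coe, mulOp_coe, mulOp_coe, leftMul_apply, entrywiseMul_mul]
  rfl

theorem mulOp_star (a : R) : Φ.mulOp (star a) = star (Φ.mulOp a) := by
  rw [ContinuousLinearMap.star_eq_adjoint, ContinuousLinearMap.eq_adjoint_iff]
  intro x y
  induction x, y using UniformSpace.Completion.induction_on₂ with
  | hp => exact isClosed_eq (by fun_prop) (by fun_prop)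
  | ih x y =>
    rw [mulOp_coe, mulOp_coe, UniformSpace.Completion.inner_coe, UniformSpace.Completion.inner_coe,
      pre_inner, pre_inner, leftMul_apply, leftMul_apply, ofPre_toPre, ofPre_toPre,
      gramKernel_entrywiseMul_left, star_star]

/-- The `*`-representation of `R` on the Hilbert space of `Φ`. -/
noncomputable def rep : R →⋆ₐ[ℂ] (Φ.Space →L[ℂ] Φ.Space) where
  toFun := Φ.mulOp
  map_one' := by
    have := Φ.mulOp_smul_one 1
    rwa [one_smul, one_smul] at this
  map_zero' := by
    have := Φ.mulOp_smul_one 0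
    rwa [zero_smul, zero_smul] at this
  commutes' c := by
    rw [Algebra.algebraMap_eq_smul_one, mulOp_smul_one, Algebra.algebraMap_eq_smul_one]
  map_add' := Φ.mulOp_add
  map_mul' := Φ.mulOp_mul
  map_star' := Φ.mulOp_star

theorem rep_coe (a : R) (x : Φ.Pre) : Φ.rep a (x : Φ.Space) = (Φ.leftMul a x : Φ.Pre) :=
  Φ.mulOp_coe a x

/-- The canonical vectors. -/
noncomputable def vec (i : I) : Φ.Space := (Φ.toPre (Finsupp.single i 1) : Φ.Pre)

theorem inner_vec_rep_vec (i j : I) (a : R) :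
    ⟪Φ.vec i, Φ.rep a (Φ.vec j)⟫_ℂ = Φ.toFun (Finsupp.single (i, j) a) := by
  rw [vec, vec, rep_coe, UniformSpace.Completion.inner_coe, pre_inner, leftMul_apply,
    ofPre_toPre, ofPre_toPre, ofPre_toPre, entrywiseMul_single, gramKernel,
    Finsupp.sum_single_index (by simp), Finsupp.sum_single_index (by simp), star_one, one_mul,
    mul_one]

end PositiveKernelFunctional

end Stinespring

/-! ### Dilation of completely contractive representations. -/

section Dilation

/-- A map between Hilbert spaces preserving inner products is a linear isometry. -/
theorem exists_linearIsometry_of_inner {E G : Type*} [NormedAddCommGroup E]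
    [InnerProductSpace ℂ E] [NormedAddCommGroup G] [InnerProductSpace ℂ G] (f : E → G)
    (hf : ∀ x y, ⟪f x, f y⟫_ℂ = ⟪x, y⟫_ℂ) : ∃ V : E →ₗᵢ[ℂ] G, ∀ x, V x = f x := by
  have hadd : ∀ x y, f (x + y) = f x + f y := fun x y => by
    rw [← sub_eq_zero, ← inner_self_eq_zero (𝕜 := ℂ)]
    simp only [inner_sub_left, inner_sub_right, inner_add_left, inner_add_right, hf]
    ring
  have hsmul : ∀ (c : ℂ) x, f (c • x) = c • f x := fun c x => by
    rw [← sub_eq_zero, ← inner_self_eq_zero (𝕜 := ℂ)]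
    simp only [inner_sub_left, inner_sub_right, inner_smul_left, inner_smul_right, hf]
    ring
  let L : E →ₗ[ℂ] G := ⟨⟨f, hadd⟩, hsmul⟩
  exact ⟨L.isometryOfInner hf, fun x => rfl⟩

variable {M : Type u} [CStarAlgebra M] {A : Subalgebra ℂ M} {R : Type u} [CStarAlgebra R]
  {E : Type u} [NormedAddCommGroup E] [InnerProductSpace ℂ E] [CompleteSpace E]

/-- Completely contractive representations dilate to `*`-representations. -/
theorem exists_dilation (hR : IsResiduallyFinite R) (υ : A →ₐ[ℂ] R)
    (hυ : CompletelyIsometric A υ) (π : A →ₐ[ℂ] (E →L[ℂ] E)) (hπ : CompletelyContractive A π) :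
    ∃ (G : Type u) (_ : NormedAddCommGroup G) (_ : InnerProductSpace ℂ G) (_ : CompleteSpace G)
      (σ : R →⋆ₐ[ℂ] (G →L[ℂ] G)) (V : E →ₗᵢ[ℂ] G),
      ∀ a x y, ⟪V x, σ (υ a) (V y)⟫_ℂ = ⟪x, π a y⟫_ℂ := by
  obtain ⟨Φ, h1, h2⟩ := exists_positive_extension hR υ hυ π hπ
  let Ψ : PositiveKernelFunctional E R := ⟨Φ, h1⟩
  have h3 : ∀ a x y, ⟪Ψ.vec x, Ψ.rep (υ a) (Ψ.vec y)⟫_ℂ = ⟪x, π a y⟫_ℂ := fun a x y =>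
    (Ψ.inner_vec_rep_vec x y (υ a)).trans (h2 x y a)
  -- The case a = 1 says that `vec` preserves inner products; its linearity, invisible in the
  -- construction, is then automatic.
  obtain ⟨V, hV⟩ := exists_linearIsometry_of_inner Ψ.vec fun x y => by
    have := h3 1 x y
    simpa using this
  exact ⟨Ψ.Space, inferInstance, inferInstance, inferInstance, Ψ.rep, V, fun a x y => by
    rw [hV, hV]; exact h3 a x y⟩

end Dilation

/-! ### Orthogonal sums of two Hilbert spaces. -/

section OrthogonalSum

open ContinuousLinearMap

/-- `i` and `j` exhibit `G` as the orthogonal direct sum of `E` and `F`. -/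
structure IsOrthogonalSum {E F G : Type*} [NormedAddCommGroup E] [InnerProductSpace ℂ E]
    [CompleteSpace E] [NormedAddCommGroup F] [InnerProductSpace ℂ F] [CompleteSpace F]
    [NormedAddCommGroup G] [InnerProductSpace ℂ G] [CompleteSpace G]
    (i : E →L[ℂ] G) (j : F →L[ℂ] G) : Prop where
  left_left : ∀ x, adjoint i (i x) = x
  right_right : ∀ x, adjoint j (j x) = x
  left_right : ∀ x, adjoint i (j x) = 0
  right_left : ∀ x, adjoint j (i x) = 0
  sum : ∀ x, i (adjoint i x) + j (adjoint j x) = x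

theorem exists_isOrthogonalSum (E F : Type u) [NormedAddCommGroup E] [InnerProductSpace ℂ E]
    [CompleteSpace E] [NormedAddCommGroup F] [InnerProductSpace ℂ F] [CompleteSpace F] :
    ∃ (G : Type u) (_ : NormedAddCommGroup G) (_ : InnerProductSpace ℂ G) (_ : CompleteSpace G)
      (i : E →L[ℂ] G) (j : F →L[ℂ] G), IsOrthogonalSum i j := by
  let e := WithLp.prodContinuousLinearEquiv 2 ℂ E F
  let i : E →L[ℂ] WithLp 2 (E × F) := (e.symm : E × F →L[ℂ] _) ∘L ContinuousLinearMap.inl ℂ E F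
  let j : F →L[ℂ] WithLp 2 (E × F) := (e.symm : E × F →L[ℂ] _) ∘L ContinuousLinearMap.inr ℂ E F
  have hi : adjoint i = ContinuousLinearMap.fst ℂ E F ∘L (e : _ →L[ℂ] E × F) := by
    symm
    rw [eq_adjoint_iff]
    intro x y
    simp [i, e, WithLp.prod_inner_apply]
  have hj : adjoint j = ContinuousLinearMap.snd ℂ E F ∘L (e : _ →L[ℂ] E × F) := by
    symm
    rw [eq_adjoint_iff]
    intro x y
    simp [j, e, WithLp.prod_inner_apply]
  refine ⟨WithLp 2 (E × F), inferInstance, inferInstance, inferInstance, i, j, ?_, ?_, ?_, ?_, ?_⟩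
  · intro x; rw [hi]; simp [i]
  · intro x; rw [hj]; simp [j]
  · intro x; rw [hi]; simp [j]
  · intro x; rw [hj]; simp [i]
  · intro x
    rw [hi, hj]
    apply e.injective
    simp [i, j]

end OrthogonalSum

/-! ### Multiples of matrix representations. -/

section Amplification

open ContinuousLinearMap

variable {Z : Type*} [NormedAddCommGroup Z] [InnerProductSpace ℂ Z] [CompleteSpace Z]

/-- Isometries with orthogonal ranges summing to `Z`. -/
theorem exists_cuntz_of_hilbertBasis {T : Type*} {κ : Type*} [Fintype κ] [DecidableEq κ]
    (b : HilbertBasis (T × κ) ℂ Z) :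
    ∃ S : κ → (lp (fun _ : T => ℂ) 2 →L[ℂ] Z),
      (∀ i j x, adjoint (S i) (S j x) = if i = j then x else 0) ∧
        ∀ z, ∑ i, S i (adjoint (S i) z) = z := by
  classical
  have ho : ∀ i, Orthonormal ℂ fun t => b (t, i) := fun i =>
    b.orthonormal.comp (fun t => (t, i)) fun t t' h => (Prod.ext_iff.1 h).1
  let S : κ → (lp (fun _ : T => ℂ) 2 →ₗᵢ[ℂ] Z) := fun i =>
    (ho i).orthogonalFamily.linearIsometry
  have hS : ∀ i t c, S i (lp.single 2 t c) = c • b (t, i) := fun i t c => by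
    rw [OrthogonalFamily.linearIsometry_apply_single]
    simp
  have hcoord : ∀ i y t, adjoint (S i).toContinuousLinearMap y t = ⟪b (t, i), y⟫_ℂ := by
    intro i y t
    have h1 := lp.inner_single_left (𝕜 := ℂ) (G := fun _ : T => ℂ) t 1
      (adjoint (S i).toContinuousLinearMap y)
    rw [adjoint_inner_right] at h1
    change ⟪S i (lp.single 2 t 1), y⟫_ℂ = _ at h1
    rw [hS, one_smul] at h1
    rw [h1]
    simp
  have hadj : ∀ i j t, adjoint (S i).toContinuousLinearMap (b (t, j)) =
      if i = j then lp.single 2 t (1 : ℂ) else 0 := fun i j t => by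
    ext t'
    rw [hcoord, orthonormal_iff_ite.1 b.orthonormal]
    by_cases h : i = j <;> by_cases h' : t' = t <;>
      simp [h, h', lp.single_apply, Pi.single_apply]
  refine ⟨fun i => (S i).toContinuousLinearMap, fun i j x => ?_, fun z => ?_⟩
  · ext t
    rw [hcoord, ← adjoint_inner_left, hadj]
    by_cases h : i = j
    · simp only [h, if_true]
      rw [lp.inner_single_left]
      simp
    · simp [h, Ne.symm h]
  · apply b.repr.injective
    ext ⟨t, j⟩
    rw [b.repr_apply_apply, b.repr_apply_apply, inner_sum]
    simp_rw [← adjoint_inner_left, hadj]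
    rw [Finset.sum_eq_single j]
    · rw [if_pos rfl, adjoint_adjoint]
      change ⟪S j (lp.single 2 t 1), z⟫_ℂ = _
      rw [hS, one_smul]
    · intro i _ h
      simp [h]
    · simp

/-- The matrix units attached to isometries with orthogonal ranges define a representation of the
full matrix algebra. -/
theorem exists_amplification_of_cuntz {D : Type*} [NormedAddCommGroup D] [InnerProductSpace ℂ D]
    [CompleteSpace D] {k : ℕ} (S : Fin (k + 1) → (D →L[ℂ] Z))
    (hS : ∀ i j x, adjoint (S i) (S j x) = if i = j then x else 0)
    (hsum : ∀ z, ∑ i, S i (adjoint (S i) z) = z) (d : D) (hd : ‖d‖ = 1) :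
    ∃ (Θ : MatAlg k →⋆ₐ[ℂ] (Z →L[ℂ] Z)) (J : EuclideanSpace ℂ (Fin (k + 1)) →ₗᵢ[ℂ] Z),
      ∀ a x, Θ a (J x) = J (a x) := by
  let θ (m : Matrix (Fin (k + 1)) (Fin (k + 1)) ℂ) : Z →L[ℂ] Z :=
    ∑ i, ∑ j, m i j • (S i ∘L adjoint (S j))
  have hθ : ∀ m z, θ m z = ∑ i, ∑ j, m i j • S i (adjoint (S j) z) := fun m z => by
    simp [θ, sum_apply]
  have hS' : ∀ m i z, adjoint (S i) (θ m z) = ∑ j, m i j • adjoint (S j) z := fun m i z => by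
    simp [hθ, hS]
  have hone : θ 1 = 1 := by
    ext z
    rw [hθ]
    simp [Matrix.one_apply, hsum]
  have hsmul : ∀ (c : ℂ) m, θ (c • m) = c • θ m := fun c m => by
    simp [θ, Finset.smul_sum, smul_smul]
  let Θ : Matrix (Fin (k + 1)) (Fin (k + 1)) ℂ →⋆ₐ[ℂ] (Z →L[ℂ] Z) :=
    { toFun := θ
      map_one' := hone
      map_zero' := by simp [θ]
      map_add' := fun m m' => by simp [θ, add_smul, Finset.sum_add_distrib]
      map_mul' := fun m m' => by
        refine ContinuousLinearMap.ext fun z => ?_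
        rw [mul_apply_eq_comp, hθ m]
        simp_rw [hS']
        rw [hθ]
        refine Finset.sum_congr rfl fun i _ => ?_
        simp only [Matrix.mul_apply, Finset.sum_smul, map_sum, Finset.smul_sum, map_smul, smul_smul]
        exact Finset.sum_comm
      commutes' := fun c => by
        rw [Algebra.algebraMap_eq_smul_one, hsmul, hone, Algebra.algebraMap_eq_smul_one]
      map_star' := fun m => by
        rw [ContinuousLinearMap.star_eq_adjoint, eq_adjoint_iff]
        intro x y
        simp only [hθ, sum_inner, inner_sum, inner_smul_left, inner_smul_right]
        rw [Finset.sum_comm]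
        refine Finset.sum_congr rfl fun i _ => Finset.sum_congr rfl fun j _ => ?_
        rw [← adjoint_inner_left, ← adjoint_inner_right]
        simp [Matrix.star_apply] }
  have hin : ∀ i j, ⟪S i d, S j d⟫_ℂ = if i = j then 1 else 0 := fun i j => by
    rw [← adjoint_inner_right, hS]
    by_cases h : i = j
    · simp [h, inner_self_eq_norm_sq_to_K, hd]
    · simp [h]
  let J : EuclideanSpace ℂ (Fin (k + 1)) →ₗ[ℂ] Z :=
    { toFun := fun x => ∑ i, x i • S i d
      map_add' := fun x y => by simp [add_smul, Finset.sum_add_distrib]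
      map_smul' := fun c x => by simp [Finset.smul_sum, smul_smul] }
  -- The coordinate vectors go to S i d for one fixed unit vector d, which spans a single copy of
  -- the defining representation.
  refine ⟨Θ.comp (Matrix.toEuclideanCLM (n := Fin (k + 1)) (𝕜 := ℂ)).symm.toStarAlgHom,
    J.isometryOfInner fun x y => ?_, fun a x => ?_⟩
  · simp only [J, LinearMap.coe_mk, AddHom.coe_mk, sum_inner, inner_sum, inner_smul_left,
      inner_smul_right, hin]
    simp [PiLp.inner_apply, mul_comm]
  · obtain ⟨m, rfl⟩ : ∃ m, Matrix.toEuclideanCLM (n := Fin (k + 1)) (𝕜 := ℂ) m = a :=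
      (Matrix.toEuclideanCLM (n := Fin (k + 1)) (𝕜 := ℂ)).surjective a
    simp only [StarAlgHom.comp_apply]
    have : (Matrix.toEuclideanCLM (n := Fin (k + 1)) (𝕜 := ℂ)).symm.toStarAlgHom
      (Matrix.toEuclideanCLM (n := Fin (k + 1)) (𝕜 := ℂ) m) = m :=
      (Matrix.toEuclideanCLM (n := Fin (k + 1)) (𝕜 := ℂ)).symm_apply_apply m
    rw [this]
    change θ m (∑ i, x i • S i d) = ∑ i, (m.mulVec x) i • S i d
    rw [hθ]
    refine Finset.sum_congr rfl fun i _ => ?_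
    simp [hS, Matrix.mulVec, dotProduct, Finset.sum_smul, smul_smul]

/-- Regrouping the basis as T × Fin (k + 1) splits Z into k + 1 orthogonal copies of ℓ²(T), permuted
by the matrix units. -/
theorem exists_amplification {ι T : Type*} [Nonempty T] {k : ℕ} (b : HilbertBasis ι ℂ Z)
    (e : T × Fin (k + 1) ≃ ι) :
    ∃ (Θ : MatAlg k →⋆ₐ[ℂ] (Z →L[ℂ] Z)) (J : EuclideanSpace ℂ (Fin (k + 1)) →ₗᵢ[ℂ] Z),
      ∀ a x, Θ a (J x) = J (a x) := by
  classical
  have hr : Set.range (b ∘ e) = Set.range b := e.surjective.range_comp b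
  let b' : HilbertBasis (T × Fin (k + 1)) ℂ Z :=
    HilbertBasis.mk (b.orthonormal.comp e e.injective) (by rw [hr, b.dense_span])
  obtain ⟨S, h1, h2⟩ := exists_cuntz_of_hilbertBasis b'
  obtain ⟨t⟩ := ‹Nonempty T›
  exact exists_amplification_of_cuntz S h1 h2 (lp.single 2 t (1 : ℂ))
    (by rw [lp.norm_single (by norm_num), norm_one])

/-- An infinite basis absorbs a finite factor, so it can be regrouped as w × Fin (k + 1). -/
theorem exists_starHom_of_infiniteDimensional {R : Type*} [CStarAlgebra R] {k : ℕ}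
    (ρ : R →⋆ₐ[ℂ] MatAlg k) (hZ : ¬ FiniteDimensional ℂ Z) :
    Nonempty (R →⋆ₐ[ℂ] (Z →L[ℂ] Z)) := by
  obtain ⟨w, b, hb⟩ := exists_hilbertBasis ℂ Z
  have : Infinite w := by
    by_contra h
    have : Finite w := not_infinite_iff_finite.1 h
    have := Fintype.ofFinite w
    exact hZ (b.toOrthonormalBasis.toBasis.finiteDimensional_of_finite)
  obtain ⟨e⟩ : Nonempty (w × Fin (k + 1) ≃ w) := by
    rw [← Cardinal.eq]
    rw [Cardinal.mk_prod, Cardinal.lift_id', Cardinal.mk_fin]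
    refine Cardinal.mul_eq_left (Cardinal.aleph0_le_mk _) ?_ ?_
    · rw [Cardinal.lift_natCast]
      exact (Cardinal.natCast_le_aleph0).trans (Cardinal.aleph0_le_mk w)
    · simp
  obtain ⟨Θ, -⟩ := exists_amplification b e
  exact ⟨Θ.comp ρ⟩

/-- Conjugation by a unitary. -/
noncomputable def conjHom {E F : Type*} [NormedAddCommGroup E] [InnerProductSpace ℂ E]
    [CompleteSpace E] [NormedAddCommGroup F] [InnerProductSpace ℂ F] [CompleteSpace F]
    (U : E ≃ₗᵢ[ℂ] F) : (E →L[ℂ] E) →⋆ₐ[ℂ] (F →L[ℂ] F) where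
  toFun T := (U.toContinuousLinearEquiv : E →L[ℂ] F) ∘L T ∘L
    (U.symm.toContinuousLinearEquiv : F →L[ℂ] E)
  map_one' := by ext; simp
  map_zero' := by ext; simp
  map_add' S T := by ext; simp
  map_mul' S T := by ext; simp
  commutes' c := by ext; simp [Algebra.algebraMap_eq_smul_one]
  map_star' T := by
    rw [ContinuousLinearMap.star_eq_adjoint, ContinuousLinearMap.star_eq_adjoint, eq_adjoint_iff]
    intro x y
    have h1 : ∀ z w, ⟪U z, w⟫_ℂ = ⟪z, U.symm w⟫_ℂ := fun z w => by
      rw [← U.symm.inner_map_map, U.symm_apply_apply]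
    have h2 : ∀ z w, ⟪z, U w⟫_ℂ = ⟪U.symm z, w⟫_ℂ := fun z w => by
      rw [← U.symm.inner_map_map, U.symm_apply_apply]
    change ⟪U (adjoint T (U.symm x)), y⟫_ℂ = ⟪x, U (T (U.symm y))⟫_ℂ
    rw [h1, h2, adjoint_inner_left]

@[simp] theorem conjHom_apply {E F : Type*} [NormedAddCommGroup E] [InnerProductSpace ℂ E]
    [CompleteSpace E] [NormedAddCommGroup F] [InnerProductSpace ℂ F] [CompleteSpace F]
    (U : E ≃ₗᵢ[ℂ] F) (T : E →L[ℂ] E) (x : F) : conjHom U T x = U (T (U.symm x)) := rfl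

/-- This is q + 1 copies of the defining representation; the shifts occur because `MatAlg N` acts on
dimension N + 1. -/
theorem exists_amplification_mul (p q : ℕ) {N : ℕ} (hN : (q + 1) * (p + 1) = N + 1) :
    ∃ (Θ : MatAlg p →⋆ₐ[ℂ] MatAlg N)
      (J : EuclideanSpace ℂ (Fin (p + 1)) →ₗᵢ[ℂ] EuclideanSpace ℂ (Fin (N + 1))),
      ∀ a x, Θ a (J x) = J (a x) := by
  refine exists_amplification (T := Fin (q + 1))
    (EuclideanSpace.basisFun (Fin (N + 1)) ℂ).toHilbertBasis
    (finProdFinEquiv.trans (finCongr hN))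

end Amplification

/-! ### Placing two finite-dimensional representations on one space. -/

section Pairs

variable {R S : Type*} [CStarAlgebra R] [CStarAlgebra S]

/-- Finite-dimensional `*`-representations of two C*-algebras are contained in finite-dimensional
`*`-representations on a common space, in such a way that two given isometries into the original
spaces become equal. -/
theorem exists_common_amplification {p q : ℕ} (ρ : R →⋆ₐ[ℂ] MatAlg p) (ρ' : S →⋆ₐ[ℂ] MatAlg q)
    {P : Type*} [NormedAddCommGroup P] [InnerProductSpace ℂ P]
    (J : P →ₗᵢ[ℂ] EuclideanSpace ℂ (Fin (p + 1))) (J' : P →ₗᵢ[ℂ] EuclideanSpace ℂ (Fin (q + 1))) :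
    ∃ (N : ℕ) (σ : R →⋆ₐ[ℂ] MatAlg N) (σ' : S →⋆ₐ[ℂ] MatAlg N)
      (T : EuclideanSpace ℂ (Fin (p + 1)) →ₗᵢ[ℂ] EuclideanSpace ℂ (Fin (N + 1)))
      (T' : EuclideanSpace ℂ (Fin (q + 1)) →ₗᵢ[ℂ] EuclideanSpace ℂ (Fin (N + 1))),
      (∀ m x, σ m (T x) = T (ρ m x)) ∧ (∀ m x, σ' m (T' x) = T' (ρ' m x)) ∧
        ∀ x, T (J x) = T' (J' x) := by
  obtain ⟨Θ, V, hV⟩ := exists_amplification_mul p q (N := (q + 1) * (p + 1) - 1)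
    (Nat.sub_add_cancel (Nat.mul_pos q.succ_pos p.succ_pos))
  obtain ⟨Θ', V', hV'⟩ := exists_amplification_mul q p (N := (q + 1) * (p + 1) - 1)
    (by rw [mul_comm (p + 1)]; exact Nat.sub_add_cancel (Nat.mul_pos q.succ_pos p.succ_pos))
  let W := (V.comp J).toLinearMap.range
  let e : P ≃ₗᵢ[ℂ] W := (V.comp J).equivRange
  -- The partial isometry taking V (J x) to V' (J' x) extends to the finite-dimensional space, where
  -- it is unitary by dimension; conjugating by it aligns the two copies of P.
  let L : EuclideanSpace ℂ (Fin ((q + 1) * (p + 1) - 1 + 1)) →ₗᵢ[ℂ] _ :=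
    ((V'.comp J').comp e.symm.toLinearIsometry).extend
  let U := L.toLinearIsometryEquiv rfl
  refine ⟨_, (conjHom U).comp (Θ.comp ρ), Θ'.comp ρ', U.toLinearIsometry.comp V, V',
    fun m x => ?_, fun m x => hV' _ _, fun x => ?_⟩
  · simp [hV]
  · change L (V (J x)) = _
    have := LinearIsometry.extend_apply ((V'.comp J').comp e.symm.toLinearIsometry) (e x)
    have h2 : ((e x : W) : EuclideanSpace ℂ (Fin ((q + 1) * (p + 1) - 1 + 1))) = V (J x) := rfl
    rw [h2] at this
    rw [this]
    simp

end Pairs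

/-! ### Representations supported on a subspace. -/

section Corner

open ContinuousLinearMap

variable {E G : Type*} [NormedAddCommGroup E] [InnerProductSpace ℂ E] [CompleteSpace E]
  [NormedAddCommGroup G] [InnerProductSpace ℂ G] [CompleteSpace G]

/-- Conjugation by an isometry `V`, as a non-unital `*`-homomorphism. -/
noncomputable def cornerHom (V : E →L[ℂ] G) (hV : ∀ x, adjoint V (V x) = x) :
    (E →L[ℂ] E) →⋆ₙₐ[ℂ] (G →L[ℂ] G) where
  toFun T := V ∘L T ∘L adjoint V
  map_smul' c T := by ext; simp
  map_zero' := by ext; simp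
  map_add' S T := by ext; simp
  map_mul' S T := by ext; simp [hV]
  map_star' T := by
    rw [ContinuousLinearMap.star_eq_adjoint, ContinuousLinearMap.star_eq_adjoint, adjoint_comp,
      adjoint_comp, adjoint_adjoint]
    rfl

theorem LinearIsometry.adjoint_apply_apply (V : E →ₗᵢ[ℂ] G) (x : E) :
    adjoint V.toContinuousLinearMap (V x) = x := by
  refine ext_inner_left ℂ fun y => ?_
  rw [adjoint_inner_right]
  exact V.inner_map_map y x

/-- A C*-algebra with a finite-dimensional representation has non-unital representations whose
unit is a given projection of infinite rank. -/
theorem exists_starHom_one_sub {R : Type*} [CStarAlgebra R] {k : ℕ} (ρ : R →⋆ₐ[ℂ] MatAlg k)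
    (T : G →L[ℂ] G) (h1 : ∀ z, T (T z) = T z) (h2 : ∀ x y, ⟪T x, y⟫_ℂ = ⟪x, T y⟫_ℂ)
    (hT : ¬ FiniteDimensional ℂ T.ker) :
    ∃ τ : R →⋆ₙₐ[ℂ] (G →L[ℂ] G), (∀ z, τ 1 z = z - T z) ∧ ∀ a z, T (τ a z) = 0 := by
  have : CompleteSpace T.ker := T.isClosed_ker.completeSpace_coe
  obtain ⟨τ⟩ := exists_starHom_of_infiniteDimensional (Z := T.ker) ρ hT
  let V : T.ker →ₗᵢ[ℂ] G := T.ker.subtypeₗᵢ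
  let W := V.toContinuousLinearMap
  have hV : ∀ x, adjoint W (W x) = x := V.adjoint_apply_apply
  have hV' : ∀ z, W (adjoint W z) = z - T z := fun z => by
    have hz : z - T z ∈ T.ker := by
      rw [LinearMap.mem_ker]
      simp [h1]
    have : adjoint W z = ⟨z - T z, hz⟩ := by
      refine ext_inner_left ℂ fun y => ?_
      rw [adjoint_inner_right]
      change ⟪(y : G), z⟫_ℂ = ⟪(y : G), z - T z⟫_ℂ
      rw [inner_sub_right, ← h2, show T (y : G) = 0 from y.2, inner_zero_left, sub_zero]
    rw [this]
    rfl
  refine ⟨(cornerHom W hV).comp (τ : R →⋆ₙₐ[ℂ] (T.ker →L[ℂ] T.ker)), fun z => ?_, fun a z => ?_⟩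
  · rw [← hV' z]
    change W ((τ 1) (adjoint W z)) = _
    rw [map_one]
    rfl
  · exact (τ a (adjoint W z)).2

end Corner

/-! ### The common ambient space. -/

section ThreeSum

open ContinuousLinearMap

/-- `G` is the orthogonal sum of `E`, `Z` and `Z`, via `i`, `p` and `q`. -/
structure IsThreeSum {E Z G : Type*} [NormedAddCommGroup E] [InnerProductSpace ℂ E]
    [CompleteSpace E] [NormedAddCommGroup Z] [InnerProductSpace ℂ Z] [CompleteSpace Z]
    [NormedAddCommGroup G] [InnerProductSpace ℂ G] [CompleteSpace G]
    (i : E →L[ℂ] G) (p q : Z →L[ℂ] G) : Prop where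
  ii : ∀ x, adjoint i (i x) = x
  pp : ∀ x, adjoint p (p x) = x
  qq : ∀ x, adjoint q (q x) = x
  ip : ∀ x, adjoint i (p x) = 0
  iq : ∀ x, adjoint i (q x) = 0
  pi : ∀ x, adjoint p (i x) = 0
  pq : ∀ x, adjoint p (q x) = 0
  qi : ∀ x, adjoint q (i x) = 0
  qp : ∀ x, adjoint q (p x) = 0
  sum : ∀ x, i (adjoint i x) + p (adjoint p x) + q (adjoint q x) = x

/-- One copy of Z will receive the part of a dilation that completes E to an invariant subspace, and
the other the complement of that subspace. -/
theorem exists_isThreeSum (E Z : Type u) [NormedAddCommGroup E] [InnerProductSpace ℂ E]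
    [CompleteSpace E] [NormedAddCommGroup Z] [InnerProductSpace ℂ Z] [CompleteSpace Z] :
    ∃ (G : Type u) (_ : NormedAddCommGroup G) (_ : InnerProductSpace ℂ G) (_ : CompleteSpace G)
      (i : E →L[ℂ] G) (p q : Z →L[ℂ] G), IsThreeSum i p q := by
  obtain ⟨Y, _, _, _, p, q, h⟩ := exists_isOrthogonalSum Z Z
  obtain ⟨G, _, _, _, i, j, h'⟩ := exists_isOrthogonalSum E Y
  refine ⟨G, _, _, ‹_›, i, j ∘L p, j ∘L q, ?_⟩
  constructor <;> intro x <;>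
    simp [adjoint_comp, h.left_left, h.right_right, h.left_right, h.right_left, h'.left_left,
      h'.right_right, h'.left_right, h'.right_left]
  rw [add_assoc, ← map_add, h.sum, h'.sum]

end ThreeSum

/-! ### Triangular form of a dilation. -/

section NormalForm

open ContinuousLinearMap

variable {M : Type*} [CStarAlgebra M] {A : Subalgebra ℂ M} {R : Type*} [CStarAlgebra R]
  {E Z G D : Type*} [NormedAddCommGroup E] [InnerProductSpace ℂ E] [CompleteSpace E]
  [NormedAddCommGroup Z] [InnerProductSpace ℂ Z] [CompleteSpace Z]
  [NormedAddCommGroup G] [InnerProductSpace ℂ G] [CompleteSpace G]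
  [NormedAddCommGroup D] [InnerProductSpace ℂ D] [CompleteSpace D]

/-- The smallest invariant subspace containing a semi-invariant subspace, and the resulting
decomposition of the dilation space. -/
theorem exists_semiInvariant_projections {A₀ : Type*} [Ring A₀] [Algebra ℂ A₀]
    (σ : A₀ →ₐ[ℂ] (D →L[ℂ] D)) (π : A₀ →ₐ[ℂ] (E →L[ℂ] E)) (V : E →ₗᵢ[ℂ] D)
    (hV : ∀ a x y, ⟪V x, σ a (V y)⟫_ℂ = ⟪x, π a y⟫_ℂ) :
    ∃ P Q : D →L[ℂ] D,
      (∀ x, P (P x) = P x) ∧ (∀ x, Q (Q x) = Q x) ∧ (∀ x, P (Q x) = 0) ∧ (∀ x, Q (P x) = 0) ∧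
      (∀ x, P (V x) = 0) ∧ (∀ x, Q (V x) = 0) ∧
      (∀ x y, ⟪P x, y⟫_ℂ = ⟪x, P y⟫_ℂ) ∧ (∀ x y, ⟪Q x, y⟫_ℂ = ⟪x, Q y⟫_ℂ) ∧
      (∀ x, V (adjoint V.toContinuousLinearMap x) + P x + Q x = x) ∧
      (∀ a x y, Q (σ a (V x + P y)) = 0) ∧
      ∀ a x y, adjoint V.toContinuousLinearMap (σ a (V x + P y)) = π a x := by
  set V' := adjoint V.toContinuousLinearMap with hV'
  have hadj : ∀ x y, ⟪V x, y⟫_ℂ = ⟪x, V' y⟫_ℂ := fun x y => by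
    rw [hV', adjoint_inner_right]; rfl
  have hVV : ∀ x, V' (V x) = x := V.adjoint_apply_apply
  have hσV : ∀ a y, V' (σ a (V y)) = π a y := fun a y =>
    ext_inner_left ℂ fun x => by rw [← hadj, hV]
  -- K, the closure, is the smallest closed subspace containing V E and invariant under A.
  let K₀ : Submodule ℂ D := Submodule.span ℂ {z | ∃ a x, σ a (V x) = z}
  let K := K₀.topologicalClosure
  have : CompleteSpace K := K₀.isClosed_topologicalClosure.completeSpace_coe
  have hVK : ∀ x, V x ∈ K := fun x => K₀.le_topologicalClosure
    (Submodule.subset_span ⟨1, x, by rw [map_one]; rfl⟩)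
  have hinv : ∀ a, ∀ z ∈ K, σ a z ∈ K := by
    intro a z hz
    have h0 : K₀ ≤ K₀.comap (σ a).toLinearMap := by
      refine Submodule.span_le.2 ?_
      rintro _ ⟨b, x, rfl⟩
      refine Submodule.subset_span ⟨a * b, x, ?_⟩
      rw [map_mul]; rfl
    exact map_mem_closure (σ a).continuous hz fun z hz => h0 hz
  -- On a generator σ b (V x) both sides equal π (a b) x. In particular K ⊖ V E, the kernel of V* in
  -- K, is invariant too.
  have hco : ∀ a, ∀ z ∈ K, V' (σ a z) = π a (V' z) := by
    intro a
    have hcl : IsClosed {z | V' (σ a z) = π a (V' z)} :=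
      isClosed_eq (by fun_prop) (by fun_prop)
    have h0 : ∀ z ∈ K₀, V' (σ a z) = π a (V' z) := by
      intro z hz
      induction hz using Submodule.span_induction with
      | mem z hz =>
        obtain ⟨b, x, rfl⟩ := hz
        rw [hσV, ← mul_apply_eq_comp, ← map_mul, hσV, map_mul]; rfl
      | zero => simp
      | add x y _ _ hx hy => simp only [map_add, hx, hy]
      | smul c x _ hx => simp only [map_smul, hx]
    exact fun z hz => closure_minimal (s := (K₀ : Set D)) h0 hcl hz
  have hself : ∀ x y, ⟪K.starProjection x, y⟫_ℂ = ⟪x, K.starProjection y⟫_ℂ :=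
    K.inner_starProjection_left_eq_right
  have hK1 : ∀ z ∈ K, K.starProjection z = z := fun z hz =>
    Submodule.starProjection_eq_self_iff.2 hz
  have hK2 : ∀ z, K.starProjection z ∈ K := fun z => K.starProjection_apply_mem z
  have hVP : ∀ z, V' (K.starProjection z) = V' z := fun z =>
    ext_inner_left ℂ fun x => by rw [← hadj, ← hself, hK1 _ (hVK x), hadj]
  -- P projects onto K ⊖ V E and Q onto the complement of K, so σ is triangular for D = PD ⊕ VE ⊕
  -- QD.
  let P : D →L[ℂ] D := K.starProjection - V.toContinuousLinearMap ∘L V'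
  let Q : D →L[ℂ] D := 1 - K.starProjection
  have hP : ∀ z, P z = K.starProjection z - V (V' z) := fun z => rfl
  have hQ : ∀ z, Q z = z - K.starProjection z := fun z => rfl
  have hPK : ∀ z, P z ∈ K := fun z => K.sub_mem (hK2 z) (hVK _)
  have hV'P : ∀ z, V' (P z) = 0 := fun z => by rw [hP, map_sub, hVP, hVV, sub_self]
  have hV'Q : ∀ z, V' (Q z) = 0 := fun z => by rw [hQ, map_sub, hVP, sub_self]
  have hQK : ∀ z ∈ K, Q z = 0 := fun z hz => by rw [hQ, hK1 z hz, sub_self]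
  have hKQ : ∀ z, K.starProjection (Q z) = 0 := fun z => by
    rw [hQ, map_sub, hK1 _ (hK2 z), sub_self]
  refine ⟨P, Q, fun x => ?_, fun x => ?_, fun x => ?_, fun x => hQK _ (hPK x), fun x => ?_,
    fun x => hQK _ (hVK x), fun x y => ?_, fun x y => ?_, fun x => ?_, fun a x y => ?_,
    fun a x y => ?_⟩
  · rw [hP, hV'P, hK1 _ (hPK x), map_zero, sub_zero]
  · rw [hQ, hKQ, sub_zero]
  · rw [hP, hKQ, hV'Q, map_zero, sub_zero]
  · rw [hP, hVV, hK1 _ (hVK x), sub_self]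
  · rw [hP, hP, inner_sub_left, inner_sub_right, hself, hadj, ← inner_conj_symm x (V (V' y)), hadj,
      inner_conj_symm]
  · rw [hQ, hQ, inner_sub_left, inner_sub_right, hself]
  · rw [hP, hQ]; abel
  · exact hQK _ (hinv a _ (K.add_mem (hVK x) (hPK y)))
  · rw [hco a _ (K.add_mem (hVK x) (hPK y)), map_add, hVV, hV'P, add_zero]

/-- A representation of `A` with a `*`-dilation occurs as the corner of a `*`-dilation on a
prescribed space `G = E ⊕ Z ⊕ Z` which is upper triangular on `A`. -/
theorem exists_triangular_dilation {i : E →L[ℂ] G} {p q : Z →L[ℂ] G} (hG : IsThreeSum i p q)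
    (υ : A →ₐ[ℂ] R) (π : A →ₐ[ℂ] (E →L[ℂ] E)) (σ : R →⋆ₐ[ℂ] (D →L[ℂ] D)) (V : E →ₗᵢ[ℂ] D)
    (hV : ∀ a x y, ⟪V x, σ (υ a) (V y)⟫_ℂ = ⟪x, π a y⟫_ℂ) (u : D →ₗᵢ[ℂ] Z)
    (hu : ¬ FiniteDimensional ℂ (adjoint u.toContinuousLinearMap).ker)
    {k : ℕ} (ρ : R →⋆ₐ[ℂ] MatAlg k) :
    ∃ τ : R →⋆ₐ[ℂ] (G →L[ℂ] G), ∀ a x z, adjoint i (τ (υ a) (i x + p z)) = π a x ∧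
      adjoint q (τ (υ a) (i x + p z)) = 0 := by
  obtain ⟨P, Q, hPP, hQQ, hPQ, hQP, hPV, hQV, hPs, hQs, hsum, hQσ, hVσ⟩ :=
    exists_semiInvariant_projections ((σ : R →ₐ[ℂ] (D →L[ℂ] D)).comp υ) π V hV
  set V' := adjoint V.toContinuousLinearMap with hV'
  set u' := adjoint u.toContinuousLinearMap with hu'
  have huu : ∀ x, u' (u x) = x := u.adjoint_apply_apply
  have huadj : ∀ x y, ⟪u x, y⟫_ℂ = ⟪x, u' y⟫_ℂ := fun x y => by
    rw [hu', adjoint_inner_right]; rfl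
  have huadj' : ∀ x y, ⟪y, u x⟫_ℂ = ⟪u' y, x⟫_ℂ := fun x y => by
    rw [hu', adjoint_inner_left]; rfl
  have hVV : ∀ x, V' (V x) = x := V.adjoint_apply_apply
  have hVP : ∀ x, V' (P x) = 0 := fun x => ext_inner_left ℂ fun y => by
    rw [hV', adjoint_inner_right]
    change ⟪V y, P x⟫_ℂ = _
    rw [← hPs, hPV, inner_zero_left, inner_zero_right]
  have hVQ : ∀ x, V' (Q x) = 0 := fun x => ext_inner_left ℂ fun y => by
    rw [hV', adjoint_inner_right]
    change ⟪V y, Q x⟫_ℂ = _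
    rw [← hQs, hQV, inner_zero_left, inner_zero_right]
  -- The part of Z outside u P D contains ker u*, so it is infinite-dimensional and carries a filler
  -- representation of R. This is where `hu` and ρ enter.
  have corner : ∀ P : D →L[ℂ] D, (∀ x, P (P x) = P x) → (∀ x y, ⟪P x, y⟫_ℂ = ⟪x, P y⟫_ℂ) →
      ∃ τ : R →⋆ₙₐ[ℂ] (Z →L[ℂ] Z), (∀ z, τ 1 z = z - u (P (u' z))) ∧
        ∀ a z, P (u' (τ a z)) = 0 := by
    intro P hP hP'
    obtain ⟨τ, h1, h2⟩ := exists_starHom_one_sub ρ (u.toContinuousLinearMap ∘L P ∘L u')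
      (fun z => by simp [huu, hP]) (fun x y => by simp [huadj, huadj', hP']) fun hfin => hu <| by
        have : u'.ker ≤ (u.toContinuousLinearMap ∘L P ∘L u').ker := fun z hz => by
          have hz' : u' z = 0 := hz
          simp [LinearMap.mem_ker, hz']
        exact Submodule.finiteDimensional_of_le this
    exact ⟨τ, h1, fun a z => by simpa [huu] using congrArg u' (h2 a z)⟩
  obtain ⟨τP, hτP1, hτP⟩ := corner P hPP hPs
  obtain ⟨τQ, hτQ1, hτQ⟩ := corner Q hQQ hQs
  -- The isometry w sends the summands VE, PD and QD into the separate summands E, Z and Z of G. Two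
  -- dilations treated this way become triangular for the same decomposition.
  let w : D →L[ℂ] G := i ∘L V' + p ∘L u.toContinuousLinearMap ∘L P +
    q ∘L u.toContinuousLinearMap ∘L Q
  have hw : ∀ x, w x = i (V' x) + p (u (P x)) + q (u (Q x)) := fun x => rfl
  have hw' : ∀ x, adjoint w x = V (adjoint i x) + P (u' (adjoint p x)) + Q (u' (adjoint q x)) :=
    fun x => by
      refine ext_inner_left ℂ fun y => ?_
      rw [adjoint_inner_right, hw]
      rw [inner_add_left, inner_add_left, inner_add_right, inner_add_right,
        ← adjoint_inner_right i, ← adjoint_inner_right p, ← adjoint_inner_right q, huadj, huadj,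
        hPs, hQs, hV', adjoint_inner_left]
      rfl
  have hww : ∀ x, adjoint w (w x) = x := fun x => by
    rw [hw', hw]
    simp only [map_add, hG.ii, hG.pp, hG.qq, hG.ip, hG.iq, hG.pi, hG.pq, hG.qi, hG.qp, map_zero,
      huu, hPP, hQQ, zero_add, add_zero]
    exact hsum x
  let α := (cornerHom w hww).comp (σ : R →⋆ₙₐ[ℂ] (D →L[ℂ] D))
  let β := (cornerHom p hG.pp).comp τP
  let γ := (cornerHom q hG.qq).comp τQ
  have hα : ∀ a x, α a x = w (σ a (adjoint w x)) := fun a x => rfl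
  have hβ : ∀ a x, β a x = p (τP a (adjoint p x)) := fun a x => rfl
  have hγ : ∀ a x, γ a x = q (τQ a (adjoint q x)) := fun a x => rfl
  have hwp : ∀ a x, adjoint w (p (τP a x)) = 0 := fun a x => by
    rw [hw', hG.ip, hG.pp, hG.qp, hτP]; simp
  have hwq : ∀ a x, adjoint w (q (τQ a x)) = 0 := fun a x => by
    rw [hw', hG.iq, hG.qq, hG.pq, hτQ]; simp
  have hαβ : ∀ a b, α a * β b = 0 := fun a b => ContinuousLinearMap.ext fun x => by
    rw [mul_apply_eq_comp, hα, hβ, hwp]; simp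
  have hαγ : ∀ a b, α a * γ b = 0 := fun a b => ContinuousLinearMap.ext fun x => by
    rw [mul_apply_eq_comp, hα, hγ, hwq]; simp
  have hβγ : ∀ a b, β a * γ b = 0 := fun a b => ContinuousLinearMap.ext fun x => by
    rw [mul_apply_eq_comp, hβ, hγ, hG.pq]; simp
  have hstar : ∀ (f g : R →⋆ₙₐ[ℂ] (G →L[ℂ] G)), (∀ a b, f a * g b = 0) → ∀ a b, g a * f b = 0 :=
    fun f g h a b => by
      rw [← star_star (g a * f b), star_mul, ← map_star, ← map_star, h, star_zero]
  have hβα := hstar α β hαβ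
  have hγα := hstar α γ hαγ
  have hγβ := hstar β γ hβγ
  have hone : α 1 + β 1 + γ 1 = 1 := ContinuousLinearMap.ext fun x => by
    rw [add_apply, add_apply, hα, hβ, hγ, map_one, hτP1, hτQ1]
    change w (adjoint w x) + _ + _ = x
    conv_rhs => rw [← hG.sum x]
    rw [hw, hw']
    simp only [map_add, map_sub, hVV, hPV, hQV, hPP, hQQ, hPQ, hQP, hVP, hVQ, map_zero, zero_add,
      add_zero]
    abel
  let τ : R →⋆ₐ[ℂ] (G →L[ℂ] G) :=
    { toFun := fun a => α a + β a + γ a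
      map_one' := hone
      map_zero' := by simp
      map_add' := fun a b => by simp only [map_add]; abel
      map_mul' := fun a b => by
        simp only [map_mul, add_mul, mul_add, hαβ, hαγ, hβγ, hβα, hγα, hγβ, zero_add, add_zero]
      commutes' := fun c => by
        simp only [Algebra.algebraMap_eq_smul_one, map_smul, ← smul_add, hone]
      map_star' := fun a => by simp only [map_star, star_add] }
  have hτ : ∀ a x, τ a x = w (σ a (adjoint w x)) + p (τP a (adjoint p x)) +
    q (τQ a (adjoint q x)) := fun a x => rfl
  refine ⟨τ, fun a x z => ?_⟩
  have h1 : adjoint w (i x + p z) = V x + P (u' z) := by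
    rw [hw']
    simp [hG.ii, hG.ip, hG.pi, hG.pp, hG.qi, hG.qp]
  have h2 : V' (σ (υ a) (V x + P (u' z))) = π a x := hVσ a x _
  have h3 : Q (σ (υ a) (V x + P (u' z))) = 0 := hQσ a x _
  rw [hτ, h1, hw, h2, h3]
  constructor
  · simp [hG.ii, hG.ip, hG.iq, hG.qi, hG.qp]
  · simp [hG.qi, hG.qp, hG.qq]

end NormalForm

/-! ### Simultaneous dilation of two representations. -/

section CommonDilation

open ContinuousLinearMap

theorem IsResiduallyFinite.exists_starHom {R : Type*} [CStarAlgebra R] [Nontrivial R]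
    (hR : IsResiduallyFinite R) : ∃ k, Nonempty (R →⋆ₐ[ℂ] MatAlg k) := by
  by_contra! h
  exact one_ne_zero (hR 1 fun k ρ => ((h k).false ρ).elim)

theorem exists_linearIsometry_of_adjoint {E G : Type*} [NormedAddCommGroup E]
    [InnerProductSpace ℂ E] [CompleteSpace E] [NormedAddCommGroup G] [InnerProductSpace ℂ G]
    [CompleteSpace G] (i : E →L[ℂ] G) (hi : ∀ x, adjoint i (i x) = x) :
    ∃ u : E →ₗᵢ[ℂ] G, u.toContinuousLinearMap = i :=
  ⟨i.toLinearMap.isometryOfInner fun x y => by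
    change ⟪i x, i y⟫_ℂ = _
    rw [← adjoint_inner_right, hi], rfl⟩

theorem not_finiteDimensional_lp (T : Type*) [Infinite T] :
    ¬ FiniteDimensional ℂ (lp (fun _ : T => ℂ) 2) := fun _ => by
  classical
  let b : HilbertBasis T ℂ (lp (fun _ : T => ℂ) 2) :=
    HilbertBasis.ofRepr (LinearIsometryEquiv.refl ℂ _)
  have : Finite T := b.orthonormal.linearIndependent.finite
  exact not_finite T

/-- Two Hilbert spaces embed isometrically, with complements of infinite dimension, into a third. -/
theorem exists_common_isometries (D D' : Type u) [NormedAddCommGroup D] [InnerProductSpace ℂ D]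
    [CompleteSpace D] [NormedAddCommGroup D'] [InnerProductSpace ℂ D'] [CompleteSpace D'] :
    ∃ (Z : Type u) (_ : NormedAddCommGroup Z) (_ : InnerProductSpace ℂ Z) (_ : CompleteSpace Z)
      (u : D →ₗᵢ[ℂ] Z) (u' : D' →ₗᵢ[ℂ] Z),
      ¬ FiniteDimensional ℂ (adjoint u.toContinuousLinearMap).ker ∧
        ¬ FiniteDimensional ℂ (adjoint u'.toContinuousLinearMap).ker := by
  obtain ⟨Y, _, _, _, i, j, h⟩ := exists_isOrthogonalSum D D'
  obtain ⟨Z, _, _, _, a, l, h'⟩ :=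
    exists_isOrthogonalSum Y (lp (fun _ : ULift.{u} ℕ => ℂ) 2)
  obtain ⟨u, hu⟩ := exists_linearIsometry_of_adjoint (a ∘L i) fun x => by
    simp [adjoint_comp, h.left_left, h'.left_left]
  obtain ⟨u', hu'⟩ := exists_linearIsometry_of_adjoint (a ∘L j) fun x => by
    simp [adjoint_comp, h.right_right, h'.left_left]
  have key : ∀ {D : Type u} [NormedAddCommGroup D] [InnerProductSpace ℂ D] [CompleteSpace D]
      (v : D →L[ℂ] Y), ¬ FiniteDimensional ℂ (adjoint (a ∘L v)).ker := by
    intro D _ _ _ v hfin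
    refine not_finiteDimensional_lp (ULift.{u} ℕ) ?_
    have hl : ∀ x, l x ∈ (adjoint (a ∘L v)).ker := fun x => by
      rw [LinearMap.mem_ker]
      simp [adjoint_comp, h'.left_right]
    refine FiniteDimensional.of_injective (l.toLinearMap.codRestrict _ hl) fun x y hxy => ?_
    have h1 : l x = l y := congrArg Subtype.val hxy
    rw [← h'.right_right x, h1, h'.right_right]
  exact ⟨Z, inferInstance, inferInstance, inferInstance, u, u', by rw [hu]; exact key i,
    by rw [hu']; exact key j⟩

theorem opNorm_le_one_of_adjoint {E G : Type*} [NormedAddCommGroup E]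
    [InnerProductSpace ℂ E] [CompleteSpace E] [NormedAddCommGroup G] [InnerProductSpace ℂ G]
    [CompleteSpace G] (i : E →L[ℂ] G) (hi : ∀ x, adjoint i (i x) = x) : ‖i‖ ≤ 1 := by
  obtain ⟨u, rfl⟩ := exists_linearIsometry_of_adjoint i hi
  exact u.norm_toContinuousLinearMap_le

variable {M M' : Type u} [CStarAlgebra M] [CStarAlgebra M'] {A : Subalgebra ℂ M}
  {B : Subalgebra ℂ M'} {R S : Type u} [CStarAlgebra R] [CStarAlgebra S]
  {E : Type u} [NormedAddCommGroup E] [InnerProductSpace ℂ E] [CompleteSpace E]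

/-- Two completely contractive representations on the same space have `*`-dilations on a common
space, whose joint polynomials dominate those of the given representations. -/
theorem exists_common_dilation [Nontrivial R] [Nontrivial S] (hR : IsResiduallyFinite R)
    (hS : IsResiduallyFinite S) (υ : A →ₐ[ℂ] R) (υ' : B →ₐ[ℂ] S) (hυ : CompletelyIsometric A υ)
    (hυ' : CompletelyIsometric B υ') (π : A →ₐ[ℂ] (E →L[ℂ] E)) (θ : B →ₐ[ℂ] (E →L[ℂ] E))
    (hπ : CompletelyContractive A π) (hθ : CompletelyContractive B θ) :
    ∃ (G : Type u) (_ : NormedAddCommGroup G) (_ : InnerProductSpace ℂ G) (_ : CompleteSpace G)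
      (σ : R →⋆ₐ[ℂ] (G →L[ℂ] G)) (τ : S →⋆ₐ[ℂ] (G →L[ℂ] G)),
      ∀ (n : ℕ) (X : Matrix (Fin n) (Fin n) (FreeAlgebra ℂ (A ⊕ B))),
        matNorm (X.map (pairEval π θ)) ≤
          matNorm (X.map (pairEval (fun a => σ (υ a)) fun b => τ (υ' b))) := by
  obtain ⟨k, ⟨ρ⟩⟩ := hR.exists_starHom
  obtain ⟨k', ⟨ρ'⟩⟩ := hS.exists_starHom
  obtain ⟨D, _, _, _, σ, V, hV⟩ := exists_dilation hR υ hυ π hπ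
  obtain ⟨D', _, _, _, τ, V', hV'⟩ := exists_dilation hS υ' hυ' θ hθ
  obtain ⟨Z, _, _, _, u, u', hu, hu'⟩ := exists_common_isometries D D'
  obtain ⟨G, _, _, _, i, p, q, hG⟩ := exists_isThreeSum E Z
  obtain ⟨σ', hσ'⟩ := exists_triangular_dilation hG υ π σ V hV u hu ρ
  obtain ⟨τ', hτ'⟩ := exists_triangular_dilation hG υ' θ τ V' hV' u' hu' ρ'
  refine ⟨G, inferInstance, inferInstance, inferInstance, σ', τ', fun n X => ?_⟩
  set f := pairEval (fun a => σ' (υ a)) fun b => τ' (υ' b)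
  have hgen : ∀ (T : G →L[ℂ] G) (T' : E →L[ℂ] E),
      (∀ x z, adjoint i (T (i x + p z)) = T' x ∧ adjoint q (T (i x + p z)) = 0) →
      ∀ x z, ∃ z', T (i x + p z) = i (T' x) + p z' := fun T T' h x z => by
    refine ⟨adjoint p (T (i x + p z)), ?_⟩
    conv_lhs => rw [← hG.sum (T (i x + p z))]
    rw [(h x z).1, (h x z).2, map_zero, add_zero]
  -- The subspace i E + p Z is invariant for letters from both algebras, and modulo p Z they act as
  -- π and θ. Hence mixed words also act correctly, which two unrelated dilations would not give.
  have hf : ∀ w x z, ∃ z', f w (i x + p z) = i (pairEval π θ w x) + p z' := by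
    intro w
    induction w using FreeAlgebra.induction with
    | grade0 c =>
      intro x z
      exact ⟨c • z, by simp [Algebra.algebraMap_eq_smul_one]⟩
    | grade1 s =>
      rcases s with a | b
      · have := hgen (σ' (υ a)) (π a) (hσ' a)
        simpa [f] using this
      · have := hgen (τ' (υ' b)) (θ b) (hτ' b)
        simpa [f] using this
    | mul w w' hw hw' =>
      intro x z
      obtain ⟨z', hz'⟩ := hw' x z
      obtain ⟨z'', hz''⟩ := hw (pairEval π θ w' x) z'
      exact ⟨z'', by rw [map_mul, map_mul, mul_apply_eq_comp, mul_apply_eq_comp, hz', hz'']⟩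
    | add w w' hw hw' =>
      intro x z
      obtain ⟨z', hz'⟩ := hw x z
      obtain ⟨z'', hz''⟩ := hw' x z
      refine ⟨z' + z'', ?_⟩
      rw [map_add f, map_add (pairEval π θ), add_apply, add_apply, hz', hz'', map_add i, map_add p]
      abel
  have hcomp : X.map (pairEval π θ) = (X.map f).map fun Y => adjoint i ∘L Y ∘L i := by
    ext r s x
    obtain ⟨z', hz'⟩ := hf (X r s) x 0
    rw [map_zero, add_zero] at hz'
    simp [hz', hG.ii, hG.ip]
  rw [hcomp]
  have hi := opNorm_le_one_of_adjoint i hG.ii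
  exact matNorm_compress_le _ _ _ (by rwa [LinearIsometryEquiv.norm_map]) hi

end CommonDilation

/-! ### Direct sums of finite-dimensional representations. -/

section DirectSum

open ContinuousLinearMap

variable {R : Type*} [CStarAlgebra R]

/-- Direct sums of finite-dimensional `*`-representations. -/
theorem exists_finite_directSum {p q : ℕ} (ρ : R →⋆ₐ[ℂ] MatAlg p) (ρ' : R →⋆ₐ[ℂ] MatAlg q) :
    ∃ (N : ℕ) (σ : R →⋆ₐ[ℂ] MatAlg N)
      (J : EuclideanSpace ℂ (Fin (p + 1)) →ₗᵢ[ℂ] EuclideanSpace ℂ (Fin (N + 1)))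
      (J' : EuclideanSpace ℂ (Fin (q + 1)) →ₗᵢ[ℂ] EuclideanSpace ℂ (Fin (N + 1))),
      (∀ a x, σ a (J x) = J (ρ a x)) ∧ (∀ a x, σ a (J' x) = J' (ρ' a x)) ∧
        (∀ x y, ⟪J x, J' y⟫_ℂ = 0) ∧ ∀ x y, ⟪J' x, J y⟫_ℂ = 0 := by
  obtain ⟨G, _, _, _, i, j, h⟩ := exists_isOrthogonalSum (EuclideanSpace ℂ (Fin (p + 1)))
    (EuclideanSpace ℂ (Fin (q + 1)))
  obtain ⟨u, hu⟩ := exists_linearIsometry_of_adjoint i h.left_left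
  obtain ⟨u', hu'⟩ := exists_linearIsometry_of_adjoint j h.right_right
  have hui : ∀ x, i x = u x := fun x => by rw [← hu]; rfl
  have huj : ∀ x, j x = u' x := fun x => by rw [← hu']; rfl
  have hfin : FiniteDimensional ℂ G := FiniteDimensional.of_surjective
    (i.toLinearMap.coprod j.toLinearMap) fun x => ⟨(adjoint i x, adjoint j x), h.sum x⟩
  have hnt : Nontrivial G := u.injective.nontrivial
  obtain ⟨N, hN⟩ : ∃ N, Module.finrank ℂ G = N + 1 :=
    Nat.exists_eq_succ_of_ne_zero Module.finrank_pos.ne'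
  let U : G ≃ₗᵢ[ℂ] EuclideanSpace ℂ (Fin (N + 1)) :=
    ((stdOrthonormalBasis ℂ G).reindex (finCongr hN)).repr
  let α := (cornerHom i h.left_left).comp (ρ : R →⋆ₙₐ[ℂ] MatAlg p)
  let β := (cornerHom j h.right_right).comp (ρ' : R →⋆ₙₐ[ℂ] MatAlg q)
  have hα : ∀ a x, α a x = i (ρ a (adjoint i x)) := fun a x => rfl
  have hβ : ∀ a x, β a x = j (ρ' a (adjoint j x)) := fun a x => rfl
  have hαβ : ∀ a b, α a * β b = 0 := fun a b => ContinuousLinearMap.ext fun x => by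
    rw [mul_apply_eq_comp, hα, hβ, h.left_right]; simp
  have hβα : ∀ a b, β a * α b = 0 := fun a b => ContinuousLinearMap.ext fun x => by
    rw [mul_apply_eq_comp, hα, hβ, h.right_left]; simp
  have hone : α 1 + β 1 = 1 := ContinuousLinearMap.ext fun x => by
    rw [add_apply, hα, hβ, map_one, map_one]
    exact h.sum x
  let τ : R →⋆ₐ[ℂ] (G →L[ℂ] G) :=
    { toFun := fun a => α a + β a
      map_one' := hone
      map_zero' := by simp
      map_add' := fun a b => by simp only [map_add]; abel
      map_mul' := fun a b => by
        simp only [map_mul, add_mul, mul_add, hαβ, hβα, zero_add, add_zero]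
      commutes' := fun c => by
        simp only [Algebra.algebraMap_eq_smul_one, map_smul, ← smul_add, hone]
      map_star' := fun a => by simp only [map_star, star_add] }
  have hτ : ∀ a x, τ a x = i (ρ a (adjoint i x)) + j (ρ' a (adjoint j x)) := fun a x => rfl
  refine ⟨N, (conjHom U).comp τ, U.toLinearIsometry.comp u, U.toLinearIsometry.comp u',
    fun a x => ?_, fun a x => ?_, fun x y => ?_, fun x y => ?_⟩
  · simp [hτ, ← hui, h.left_left, h.right_left]
  · simp [hτ, ← huj, h.right_right, h.left_right]
  · change ⟪U (u x), U (u' y)⟫_ℂ = 0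
    rw [U.inner_map_map, ← hui, ← huj, ← adjoint_inner_right, h.left_right, inner_zero_right]
  · change ⟪U (u' x), U (u y)⟫_ℂ = 0
    rw [U.inner_map_map, ← hui, ← huj, ← adjoint_inner_right, h.right_left, inner_zero_right]

end DirectSum

/-! ### Approximation of matrix coefficients by Hahn–Banach. -/

section Separation

variable {R : Type u} [CStarAlgebra R]

/-- The tuples of matrix coefficients of finite-dimensional representations. -/
def finCoefficients (n : ℕ) {L : Type*} (m : L → R) : Set (L × Fin n × Fin n → ℂ) :=
  {v | ∃ (k : ℕ) (ρ : R →⋆ₐ[ℂ] MatAlg k) (x : Fin n → EuclideanSpace ℂ (Fin (k + 1))),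
    ∀ l i j, v (l, i, j) = ⟪x i, ρ (m l) (x j)⟫_ℂ}

/-- Vectors placed in orthogonal summands of a direct sum have coefficients that add. -/
theorem add_mem_finCoefficients {n : ℕ} {L : Type*} {m : L → R} {v w : L × Fin n × Fin n → ℂ}
    (hv : v ∈ finCoefficients n m) (hw : w ∈ finCoefficients n m) :
    v + w ∈ finCoefficients n m := by
  obtain ⟨k, ρ, x, hx⟩ := hv
  obtain ⟨k', ρ', x', hx'⟩ := hw
  obtain ⟨N, σ, J, J', h1, h2, h3, h4⟩ := exists_finite_directSum ρ ρ'
  refine ⟨N, σ, fun i => J (x i) + J' (x' i), fun l i j => ?_⟩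
  rw [Pi.add_apply, hx, hx', map_add, h1, h2, inner_add_left, inner_add_right, inner_add_right,
    h3, h4, J.inner_map_map, J'.inner_map_map, zero_add, add_zero]

theorem smul_mem_finCoefficients {n : ℕ} {L : Type*} {m : L → R} {v : L × Fin n × Fin n → ℂ}
    (hv : v ∈ finCoefficients n m) {c : ℝ} (hc : 0 ≤ c) : c • v ∈ finCoefficients n m := by
  obtain ⟨k, ρ, x, hx⟩ := hv
  refine ⟨k, ρ, fun i => ((√c : ℝ) : ℂ) • x i, fun l i j => ?_⟩
  rw [Pi.smul_apply, hx, map_smul, inner_smul_left, inner_smul_right, Complex.conj_ofReal,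
    ← mul_assoc, ← Complex.ofReal_mul, Real.mul_self_sqrt hc, Complex.real_smul]

variable {G : Type*} [NormedAddCommGroup G] [InnerProductSpace ℂ G] [CompleteSpace G]

theorem sum_inner_neg_combination {n : ℕ} {L : Type*} [Fintype L] (c : L × Fin n × Fin n → ℂ)
    (m : L → R) (ρ : R →⋆ₐ[ℂ] (G →L[ℂ] G)) (x : Fin n → G) :
    ∑ i, ⟪x i, ∑ j, ρ (-∑ l, c (l, i, j) • m l) (x j)⟫_ℂ =
      -∑ t : L × Fin n × Fin n, ⟪x t.2.1, ρ (m t.1) (x t.2.2)⟫_ℂ * c t := by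
  rw [Fintype.sum_prod_type_right, Fintype.sum_prod_type, ← Finset.sum_neg_distrib]
  refine Finset.sum_congr rfl fun i _ => ?_
  rw [inner_sum, ← Finset.sum_neg_distrib]
  refine Finset.sum_congr rfl fun j _ => ?_
  simp only [map_neg, map_sum, map_smul, neg_apply, sum_apply, smul_apply,
    inner_neg_right, inner_sum, inner_smul_right]
  simp only [mul_comm]

/-- Finite-dimensional coefficients form a convex cone, by direct sums and rescaling. A functional
separating a point from it yields a matrix over R that is accretive in every finite-dimensional
representation, hence under σ, contradicting the separation. -/
theorem coefficients_mem_closure [Nontrivial R] (hR : IsResiduallyFinite R)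
    (σ : R →⋆ₐ[ℂ] (G →L[ℂ] G)) {n : ℕ} (g : Fin n → G) {L : Type*} [Fintype L] (m : L → R) :
    (fun t : L × Fin n × Fin n => ⟪g t.2.1, σ (m t.1) (g t.2.2)⟫_ℂ) ∈
      closure (finCoefficients n m) := by
  classical
  by_contra hp
  set p : L × Fin n × Fin n → ℂ := fun t => ⟪g t.2.1, σ (m t.1) (g t.2.2)⟫_ℂ
  have hconv : Convex ℝ (finCoefficients n m) := fun v hv w hw a b ha hb _ =>
    add_mem_finCoefficients (smul_mem_finCoefficients hv ha) (smul_mem_finCoefficients hw hb)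
  obtain ⟨k₀, ⟨ρ₀⟩⟩ := hR.exists_starHom
  have hzero : (0 : L × Fin n × Fin n → ℂ) ∈ finCoefficients n m :=
    ⟨k₀, ρ₀, 0, fun l i j => by simp⟩
  obtain ⟨f, u, hf, hfp⟩ := RCLike.geometric_hahn_banach_closed_point (𝕜 := ℂ) hconv.closure
    isClosed_closure hp
  have hu : 0 < u := by simpa using hf 0 (subset_closure hzero)
  -- A positive value could be rescaled within the cone to reach the bound u.
  have hneg : ∀ v ∈ finCoefficients n m, (f v).re ≤ 0 := by
    intro v hv
    by_contra! hpos
    have h1 := hf _ (subset_closure (smul_mem_finCoefficients hv (div_pos hu hpos).le))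
    have h2 : f ((u / (f v).re) • v) = (u / (f v).re) • f v :=
      LinearMap.map_smul_of_tower f.toLinearMap _ v
    rw [h2] at h1
    change ((u / (f v).re) • f v).re < u at h1
    rw [Complex.smul_re, smul_eq_mul, div_mul_cancel₀ _ hpos.ne'] at h1
    exact lt_irrefl _ h1
  let c : L × Fin n × Fin n → ℂ := fun t => f (fun j => if t = j then 1 else 0)
  have hfc : ∀ v, f v = ∑ t, v t * c t := fun v => LinearMap.pi_apply_eq_sum_univ f.toLinearMap v
  let X : Matrix (Fin n) (Fin n) R := Matrix.of fun i j => -∑ l, c (l, i, j) • m l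
  have h0 := re_sum_inner_nonneg_of_contractive hR (AlgHom.id ℂ R) (σ : R →ₐ[ℂ] (G →L[ℂ] G))
    (fun n X => matNorm_map_le σ X) X (fun k ρ x => ?_) g
  · have h1 : (∑ i, ⟪g i, ∑ j, σ (X i j) (g j)⟫_ℂ).re = -(f p).re := by
      rw [hfc, ← Complex.neg_re]
      exact congrArg Complex.re (sum_inner_neg_combination c m σ g)
    have h2 : 0 ≤ -(f p).re := h1 ▸ h0
    change u < (f p).re at hfp
    linarith
  · have h1 : (∑ i, ⟪x i, ∑ j, ρ (X i j) (x j)⟫_ℂ).re =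
        -(f fun t => ⟪x t.2.1, ρ (m t.1) (x t.2.2)⟫_ℂ).re := by
      rw [hfc, ← Complex.neg_re]
      exact congrArg Complex.re (sum_inner_neg_combination c m ρ x)
    change 0 ≤ (∑ i, ⟪x i, ∑ j, ρ (X i j) (x j)⟫_ℂ).re
    rw [h1]
    exact neg_nonneg.2 (hneg _ ⟨k, ρ, x, fun _ _ _ => rfl⟩)

/-- Matrix coefficients of a representation of a residually finite-dimensional algebra are
approximated by those of finite-dimensional representations. -/
theorem exists_finite_coefficients_approx [Nontrivial R] (hR : IsResiduallyFinite R)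
    (σ : R →⋆ₐ[ℂ] (G →L[ℂ] G)) {n : ℕ} (g : Fin n → G) {L : Type*} [Fintype L] (m : L → R)
    {δ : ℝ} (hδ : 0 < δ) :
    ∃ (k : ℕ) (ρ : R →⋆ₐ[ℂ] MatAlg k) (x : Fin n → EuclideanSpace ℂ (Fin (k + 1))),
      ∀ l i j, ‖⟪x i, ρ (m l) (x j)⟫_ℂ - ⟪g i, σ (m l) (g j)⟫_ℂ‖ ≤ δ := by
  obtain ⟨v, ⟨k, ρ, x, hv⟩, hd⟩ := Metric.mem_closure_iff.1 (coefficients_mem_closure hR σ g m) δ hδ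
  refine ⟨k, ρ, x, fun l i j => ?_⟩
  rw [← hv, ← dist_eq_norm, dist_comm]
  exact (dist_le_pi_dist _ _ (l, i, j)).trans hd.le

end Separation

/-! ### Inverse square roots near the identity. -/

section InverseSqrt

/-- The left side equals |t - 1| / (√t (1 + √t)), whose denominator is at least 1 for t ≥ 1/2. -/
theorem abs_inv_sqrt_sub_one_le {t η : ℝ} (hη : η ≤ 1 / 2) (ht : |t - 1| ≤ η) :
    |(√t)⁻¹ - 1| ≤ η := by
  rw [abs_le] at ht
  have ht0 : 0 < t := by linarith
  have hs : 1 / 2 ≤ √t := Real.le_sqrt_of_sq_le (by linarith)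
  have hs0 : 0 < √t := Real.sqrt_pos.2 ht0
  have hsq : √t * √t = t := Real.mul_self_sqrt ht0.le
  have h1 : (√t)⁻¹ - 1 = (1 - √t) / √t := by field_simp
  rw [h1, abs_div, abs_of_pos hs0, div_le_iff₀ hs0]
  have h2 : |1 - √t| * (1 + √t) = |1 - t| := by
    have h0 : 0 < 1 + √t := by linarith
    calc |1 - √t| * (1 + √t) = |1 - √t| * |1 + √t| := by rw [abs_of_pos h0]
      _ = |(1 - √t) * (1 + √t)| := (abs_mul _ _).symm
      _ = |1 - t| := by congr 1; linarith
  have h3 : |1 - t| ≤ η := by rw [abs_le]; constructor <;> linarith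
  have h4 : 1 ≤ √t * (1 + √t) := by
    have : (7 : ℝ) / 10 ≤ √t := Real.le_sqrt_of_sq_le (by linarith)
    nlinarith
  have h5 : 0 ≤ η := (abs_nonneg _).trans h3
  refine le_of_mul_le_mul_right ?_ (show 0 < 1 + √t by linarith)
  rw [h2, mul_assoc]
  nlinarith

/-- A self-adjoint element close to `1` has an inverse square root close to `1`. -/
theorem exists_inv_sqrt {B : Type*} [CStarAlgebra B] (h : B) (hh : IsSelfAdjoint h) {η : ℝ}
    (hη : η ≤ 1 / 2) (hn : ‖h - 1‖ ≤ η) :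
    ∃ s : B, IsSelfAdjoint s ∧ s * h * s = 1 ∧ ‖s - 1‖ ≤ η := by
  have hη0 : 0 ≤ η := (norm_nonneg _).trans hn
  have hspec : ∀ t ∈ spectrum ℝ h, |t - 1| ≤ η := by
    intro t ht
    have h1 : t - 1 ∈ spectrum ℝ (h - 1) := by
      have := spectrum.sub_singleton_eq (R := ℝ) h 1
      rw [map_one] at this
      rw [← this]
      exact Set.sub_mem_sub ht rfl
    refine (spectrum.norm_le_norm_mul_of_mem h1).trans ?_
    nlinarith [norm_one_le_one (M := B), norm_nonneg (h - 1)]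
  have hpos : ∀ t ∈ spectrum ℝ h, 0 < t := fun t ht => by
    have := abs_le.1 (hspec t ht); linarith
  have hc : ContinuousOn (fun t : ℝ => (√t)⁻¹) (spectrum ℝ h) :=
    Real.continuous_sqrt.continuousOn.inv₀ fun t ht => (Real.sqrt_pos.2 (hpos t ht)).ne'
  refine ⟨cfc (fun t : ℝ => (√t)⁻¹) h, cfc_predicate _ h, ?_, ?_⟩
  · have h1 : cfc (fun t : ℝ => (√t)⁻¹ * t * (√t)⁻¹) h = 1 := by
      rw [← cfc_one ℝ h]
      refine cfc_congr fun t ht => ?_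
      have := hpos t ht
      have h2 : √t ≠ 0 := (Real.sqrt_pos.2 this).ne'
      change (√t)⁻¹ * t * (√t)⁻¹ = 1
      nth_rw 2 [← Real.mul_self_sqrt this.le]
      field_simp
    rwa [cfc_mul (fun t : ℝ => (√t)⁻¹ * t) _ h (hc.mul continuousOn_id) hc,
      cfc_mul (fun t : ℝ => (√t)⁻¹) (fun t => t) h hc continuousOn_id, cfc_id' ℝ h] at h1
  · have h1 : cfc (fun t : ℝ => (√t)⁻¹ - 1) h = cfc (fun t : ℝ => (√t)⁻¹) h - 1 := by
      rw [cfc_sub _ _ h hc continuousOn_const, cfc_const_one ℝ h]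
    rw [← h1]
    exact norm_cfc_le hη0 fun t ht => abs_inv_sqrt_sub_one_le hη (hspec t ht)

end InverseSqrt

/-! ### Approximation through isometric embeddings. -/

section IsometricApproximation

open ContinuousLinearMap

theorem norm_le_of_inner_le {E : Type*} [NormedAddCommGroup E] [InnerProductSpace ℂ E]
    (T : E →L[ℂ] E) {η : ℝ} (hη : 0 ≤ η) (h : ∀ x y, ‖⟪x, T y⟫_ℂ‖ ≤ η * ‖x‖ * ‖y‖) : ‖T‖ ≤ η := by
  refine T.opNorm_le_bound hη fun y => ?_
  have h1 := h (T y) y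
  rw [inner_self_eq_norm_sq_to_K, norm_pow, RCLike.norm_ofReal, abs_norm] at h1
  rcases (norm_nonneg (T y)).eq_or_lt with h0 | h0
  · rw [← h0]; positivity
  · nlinarith

theorem norm_sum_sum_le {n : ℕ} (c : Fin n → Fin n → ℂ) {δ r r' : ℝ} (hc : ∀ i j, ‖c i j‖ ≤ δ)
    (x y : Fin n → ℂ) (hx : ∀ i, ‖x i‖ ≤ r) (hy : ∀ i, ‖y i‖ ≤ r') :
    ‖∑ i, ∑ j, x i * y j * c i j‖ ≤ (n * n * δ) * r * r' := by
  have h1 : ∀ i j, ‖x i * y j * c i j‖ ≤ r * r' * δ := fun i j => by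
    rw [norm_mul, norm_mul]
    have h2 := norm_nonneg (x i)
    have h3 := norm_nonneg (y j)
    exact mul_le_mul (mul_le_mul (hx i) (hy j) h3 (h2.trans (hx i))) (hc i j) (norm_nonneg _)
      (mul_nonneg (h2.trans (hx i)) (h3.trans (hy j)))
  calc ‖∑ i, ∑ j, x i * y j * c i j‖ ≤ ∑ i : Fin n, ∑ j : Fin n, r * r' * δ :=
        (norm_sum_le _ _).trans (Finset.sum_le_sum fun i _ =>
          (norm_sum_le _ _).trans (Finset.sum_le_sum fun j _ => h1 i j))
    _ = (n * n * δ) * r * r' := by simp; ring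

variable {R : Type u} [CStarAlgebra R]
  {G : Type*} [NormedAddCommGroup G] [InnerProductSpace ℂ G] [CompleteSpace G]

/-- K sends an orthonormal basis of P to the approximating vectors. Expanding in the basis gives n²
coefficient errors, whence the accuracy η / (n² + 1) asked for them. -/
theorem exists_finite_compression_approx [Nontrivial R] (hR : IsResiduallyFinite R)
    (σ : R →⋆ₐ[ℂ] (G →L[ℂ] G)) (P : Submodule ℂ G) [FiniteDimensional ℂ P] (s : Finset R)
    {η : ℝ} (hη : 0 < η) :
    ∃ (k : ℕ) (ρ : R →⋆ₐ[ℂ] MatAlg k) (K : P →L[ℂ] EuclideanSpace ℂ (Fin (k + 1))),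
      ∀ a ∈ s, ∀ x y : P, ‖⟪K x, ρ a (K y)⟫_ℂ - ⟪(x : G), σ a y⟫_ℂ‖ ≤ η * ‖x‖ * ‖y‖ := by
  set n := Module.finrank ℂ P
  let b : OrthonormalBasis (Fin n) ℂ P := stdOrthonormalBasis ℂ P
  obtain ⟨k, ρ, v, hv⟩ := exists_finite_coefficients_approx hR σ (fun i => (b i : G))
    (fun a : s => (a : R)) (δ := η / (n * n + 1)) (by positivity)
  let K : P →ₗ[ℂ] EuclideanSpace ℂ (Fin (k + 1)) := b.toBasis.constr ℂ v
  have hK : ∀ x, K x = ∑ i, b.repr x i • v i := fun x => by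
    simp [K, Module.Basis.constr_apply_fintype]
  have hb : ∀ x : P, (x : G) = ∑ i, b.repr x i • (b i : G) := fun x => by
    conv_lhs => rw [← b.sum_repr x]
    simp
  refine ⟨k, ρ, LinearMap.toContinuousLinearMap K, fun a ha x y => ?_⟩
  have h1 : ⟪K x, ρ a (K y)⟫_ℂ - ⟪(x : G), σ a y⟫_ℂ =
      ∑ i, ∑ j, star (b.repr x i) * b.repr y j *
        (⟪v i, ρ a (v j)⟫_ℂ - ⟪(b i : G), σ a (b j)⟫_ℂ) := by
    rw [hK, hK, hb x, hb y]
    simp only [map_sum, map_smul, sum_inner, inner_sum, inner_smul_left, inner_smul_right]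
    rw [← Finset.sum_sub_distrib, Finset.sum_comm]
    refine Finset.sum_congr rfl fun j _ => ?_
    rw [Finset.mul_sum, Finset.mul_sum, ← Finset.sum_sub_distrib]
    refine Finset.sum_congr rfl fun i _ => ?_
    rw [starRingEnd_apply]
    ring
  change ‖⟪K x, ρ a (K y)⟫_ℂ - ⟪(x : G), σ a y⟫_ℂ‖ ≤ _
  rw [h1]
  have hr : ∀ (x : P) i, ‖b.repr x i‖ ≤ ‖x‖ := fun x i => by
    rw [← b.repr.norm_map x]
    exact PiLp.norm_apply_le _ i
  refine (norm_sum_sum_le _ (fun i j => hv ⟨a, ha⟩ i j) _ _ (r := ‖x‖) (fun i => ?_)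
    fun j => hr y j).trans ?_
  · rw [norm_star]; exact hr x i
  · have : (n * n * (η / (n * n + 1)) : ℝ) ≤ η := by
      rw [mul_div_assoc', div_le_iff₀ (by positivity)]
      nlinarith
    gcongr

/-- The compression to a finite-dimensional subspace of a representation of a residually
finite-dimensional algebra is approximated by compressions of finite-dimensional
representations. -/
theorem exists_finite_isometric_approx [Nontrivial R] (hR : IsResiduallyFinite R)
    (σ : R →⋆ₐ[ℂ] (G →L[ℂ] G)) (P : Submodule ℂ G) [FiniteDimensional ℂ P] (s : Finset R)
    {ε : ℝ} (hε : 0 < ε) :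
    ∃ (k : ℕ) (ρ : R →⋆ₐ[ℂ] MatAlg k) (J : P →ₗᵢ[ℂ] EuclideanSpace ℂ (Fin (k + 1))),
      ∀ a ∈ s, ∀ x y : P, ‖⟪J x, ρ a (J y)⟫_ℂ - ⟪(x : G), σ a y⟫_ℂ‖ ≤ ε * ‖x‖ * ‖y‖ := by
  classical
  obtain ⟨c, hc0, hc⟩ : ∃ c : ℝ, 0 ≤ c ∧ ∀ a ∈ s, ‖a‖ ≤ c :=
    ⟨∑ a ∈ s, ‖a‖, by positivity, fun a ha =>
      Finset.single_le_sum (f := fun a => ‖a‖) (fun _ _ => norm_nonneg _) ha⟩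
  -- The bound 1/2 allows the inverse square root and gives ‖t x‖ ≤ 2‖x‖. The three errors below are
  -- then at most 4η, 2cη and cη.
  let η : ℝ := min (1 / 2) (ε / (4 + 3 * c))
  have hη : 0 < η := by positivity
  have hη2 : η ≤ 1 / 2 := min_le_left _ _
  -- Including 1 makes K*K close to the identity, so that K (K*K)^(-1/2) is an isometry close to K.
  obtain ⟨k, ρ, K, hK⟩ := exists_finite_compression_approx hR σ P (insert 1 s) hη
  have : CompleteSpace P := FiniteDimensional.complete ℂ P
  have hsa : IsSelfAdjoint (adjoint K ∘L K) := by
    rw [IsSelfAdjoint, ContinuousLinearMap.star_eq_adjoint, adjoint_comp, adjoint_adjoint]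
  obtain ⟨t, ht, ht1, htn⟩ := exists_inv_sqrt (adjoint K ∘L K) hsa hη2 <| by
    refine norm_le_of_inner_le _ hη.le fun x y => ?_
    have := hK 1 (Finset.mem_insert_self _ _) x y
    rw [map_one, map_one] at this
    rw [sub_apply, inner_sub_right, comp_apply, adjoint_inner_right]
    exact this
  have htx : ∀ x, ‖t x - x‖ ≤ η * ‖x‖ := fun x => (t - 1).le_of_opNorm_le htn x
  have htx2 : ∀ x, ‖t x‖ ≤ 2 * ‖x‖ := fun x => by
    have h1 : ‖t x‖ ≤ ‖t x - x‖ + ‖x‖ := by simpa using norm_add_le (t x - x) x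
    nlinarith [htx x, norm_nonneg x]
  have hin : ∀ x y, ⟪K (t x), K (t y)⟫_ℂ = ⟪x, y⟫_ℂ := fun x y => by
    have h1 : t (adjoint K (K (t y))) = y := DFunLike.congr_fun ht1 y
    conv_rhs => rw [← h1, ← adjoint_inner_left, ← ContinuousLinearMap.star_eq_adjoint, ht.star_eq]
    rw [adjoint_inner_right]
  refine ⟨k, ρ, (K.toLinearMap ∘ₗ t.toLinearMap).isometryOfInner hin, fun a ha x y => ?_⟩
  change ‖⟪K (t x), ρ a (K (t y))⟫_ℂ - ⟪(x : G), σ a y⟫_ℂ‖ ≤ _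
  have h1 : ⟪K (t x), ρ a (K (t y))⟫_ℂ - ⟪(x : G), σ a y⟫_ℂ =
      (⟪K (t x), ρ a (K (t y))⟫_ℂ - ⟪(t x : G), σ a (t y)⟫_ℂ) +
      ⟪((t x - x : P) : G), σ a (t y)⟫_ℂ + ⟪(x : G), σ a ((t y - y : P) : G)⟫_ℂ := by
    rw [Submodule.coe_sub, Submodule.coe_sub, map_sub, inner_sub_left, inner_sub_right]
    abel
  have hσ : ∀ g : G, ‖σ a g‖ ≤ c * ‖g‖ := fun g =>
    ContinuousLinearMap.le_of_opNorm_le _ ((norm_starHom_le σ a).trans (hc a ha)) g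
  have hx := norm_nonneg x
  have hy := norm_nonneg y
  have e1 : ‖⟪K (t x), ρ a (K (t y))⟫_ℂ - ⟪(t x : G), σ a (t y)⟫_ℂ‖ ≤ η * (2 * ‖x‖) * (2 * ‖y‖) :=
    (hK a (Finset.mem_insert_of_mem ha) _ _).trans (by gcongr <;> exact htx2 _)
  have e2 : ‖⟪((t x - x : P) : G), σ a (t y)⟫_ℂ‖ ≤ (η * ‖x‖) * (c * (2 * ‖y‖)) := by
    refine (norm_inner_le_norm _ _).trans ?_
    have := hσ (t y)
    gcongr
    · exact htx x
    · exact this.trans (by gcongr; exact htx2 y)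
  have e3 : ‖⟪(x : G), σ a ((t y - y : P) : G)⟫_ℂ‖ ≤ ‖x‖ * (c * (η * ‖y‖)) := by
    refine (norm_inner_le_norm _ _).trans ?_
    have := hσ ((t y - y : P) : G)
    gcongr
    · rfl
    · exact this.trans (by gcongr; exact htx y)
  have hηε : η * (4 + 3 * c) ≤ ε := by
    rw [← le_div_iff₀ (by positivity)]
    exact min_le_right _ _
  rw [h1]
  calc _ ≤ η * (2 * ‖x‖) * (2 * ‖y‖) + (η * ‖x‖) * (c * (2 * ‖y‖)) + ‖x‖ * (c * (η * ‖y‖)) :=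
        (norm_add₃_le).trans (by gcongr)
    _ = (η * (4 + 3 * c)) * ‖x‖ * ‖y‖ := by ring
    _ ≤ ε * ‖x‖ * ‖y‖ := by gcongr

end IsometricApproximation

/-! ### Strong approximation of pairs by finite-dimensional pairs. -/

section PairApproximation

open ContinuousLinearMap Filter Topology

variable {R S : Type u} [CStarAlgebra R] [CStarAlgebra S]
  {G : Type u} [NormedAddCommGroup G] [InnerProductSpace ℂ G] [CompleteSpace G]

/-- The two algebras are approximated independently, on different spaces; amplifying and aligning
the two embeddings of P makes the space and the isometry common. -/
theorem exists_finite_pair_approx [Nontrivial R] [Nontrivial S] (hR : IsResiduallyFinite R)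
    (hS : IsResiduallyFinite S) (σ : R →⋆ₐ[ℂ] (G →L[ℂ] G)) (τ : S →⋆ₐ[ℂ] (G →L[ℂ] G))
    (P : Submodule ℂ G) [FiniteDimensional ℂ P] (s : Finset R) (s' : Finset S)
    {ε : ℝ} (hε : 0 < ε) :
    ∃ (k : ℕ) (ρ : R →⋆ₐ[ℂ] MatAlg k) (ρ' : S →⋆ₐ[ℂ] MatAlg k)
      (J : P →ₗᵢ[ℂ] EuclideanSpace ℂ (Fin (k + 1))),
      (∀ a ∈ s, ∀ x y : P, ‖⟪J x, ρ a (J y)⟫_ℂ - ⟪(x : G), σ a y⟫_ℂ‖ ≤ ε * ‖x‖ * ‖y‖) ∧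
      ∀ a ∈ s', ∀ x y : P, ‖⟪J x, ρ' a (J y)⟫_ℂ - ⟪(x : G), τ a y⟫_ℂ‖ ≤ ε * ‖x‖ * ‖y‖ := by
  obtain ⟨p, ρ, J, hJ⟩ := exists_finite_isometric_approx hR σ P s hε
  obtain ⟨q, ρ', J', hJ'⟩ := exists_finite_isometric_approx hS τ P s' hε
  obtain ⟨N, π, π', T, T', h1, h2, h3⟩ := exists_common_amplification ρ ρ' J J'
  refine ⟨N, π, π', T.comp J, fun a ha x y => ?_, fun a ha x y => ?_⟩
  · change ‖⟪T (J x), π a (T (J y))⟫_ℂ - _‖ ≤ _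
    rw [h1, T.inner_map_map]
    exact hJ a ha x y
  · change ‖⟪T (J x), π' a (T (J y))⟫_ℂ - _‖ ≤ _
    rw [h3, h3, h2, T'.inner_map_map]
    exact hJ' a ha x y

/-- Expanding the square leaves only the coefficient of a*a at x and that of a between z and x. Weak
control of these two gives strong control, with errors ε‖x‖² and 2ε‖z‖‖x‖. -/
theorem norm_sq_sub_le_of_compression (σ : R →⋆ₐ[ℂ] (G →L[ℂ] G)) {P : Submodule ℂ G} {k : ℕ}
    (ρ : R →⋆ₐ[ℂ] MatAlg k) (J : P →ₗᵢ[ℂ] EuclideanSpace ℂ (Fin (k + 1))) {ε : ℝ} (a : R)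
    (h1 : ∀ x y : P, ‖⟪J x, ρ a (J y)⟫_ℂ - ⟪(x : G), σ a y⟫_ℂ‖ ≤ ε * ‖x‖ * ‖y‖)
    (h2 : ∀ x y : P, ‖⟪J x, ρ (star a * a) (J y)⟫_ℂ - ⟪(x : G), σ (star a * a) y⟫_ℂ‖ ≤
      ε * ‖x‖ * ‖y‖) (x z : P) (hz : (z : G) = σ a x) :
    ‖ρ a (J x) - J z‖ ^ 2 ≤ ε * (‖x‖ * ‖x‖ + 2 * (‖z‖ * ‖x‖)) := by
  have hsq : ∀ {K : Type _} [NormedAddCommGroup K] [InnerProductSpace ℂ K] [CompleteSpace K]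
      (ρ : R →⋆ₐ[ℂ] (K →L[ℂ] K)) (y : K), (⟪y, ρ (star a * a) y⟫_ℂ).re = ‖ρ a y‖ ^ 2 := by
    intro K _ _ _ ρ y
    rw [map_mul, map_star, ContinuousLinearMap.star_eq_adjoint, mul_apply_eq_comp,
      adjoint_inner_right]
    exact inner_self_eq_norm_sq (𝕜 := ℂ) _
  have e1 := (Complex.abs_re_le_norm _).trans (h2 x x)
  have e2 := (Complex.abs_re_le_norm _).trans (h1 z x)
  have hsq2 : (⟪(x : G), σ (star a * a) x⟫_ℂ).re = ‖z‖ ^ 2 := by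
    rw [map_mul, map_star, ContinuousLinearMap.star_eq_adjoint, mul_apply_eq_comp,
      adjoint_inner_right, ← hz]
    exact inner_self_eq_norm_sq (𝕜 := ℂ) _
  have hsq3 : (⟪(z : G), σ a x⟫_ℂ).re = ‖z‖ ^ 2 := by
    rw [← hz]
    exact inner_self_eq_norm_sq (𝕜 := ℂ) _
  rw [Complex.sub_re, hsq2, hsq] at e1
  rw [Complex.sub_re, hsq3] at e2
  have e3 : ‖ρ a (J x) - J z‖ ^ 2 =
      ‖ρ a (J x)‖ ^ 2 - 2 * (⟪J z, ρ a (J x)⟫_ℂ).re + ‖z‖ ^ 2 := by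
    rw [norm_sub_rev, @norm_sub_sq ℂ, J.norm_map]
    change _ - 2 * (⟪J z, ρ a (J x)⟫_ℂ).re + _ = _
    ring
  rw [e3]
  linarith [(abs_le.1 e1).2, (abs_le.1 e2).1]

/-- P is enlarged to contain the images of the test vectors, and a*a is adjoined to the test
elements. Composing with the projection onto P makes J a contraction defined on all of G. -/
theorem exists_finite_pair_strong_approx [Nontrivial R] [Nontrivial S] (hR : IsResiduallyFinite R)
    (hS : IsResiduallyFinite S) (σ : R →⋆ₐ[ℂ] (G →L[ℂ] G)) (τ : S →⋆ₐ[ℂ] (G →L[ℂ] G))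
    (s : Finset R) (s' : Finset S) (g : Finset G) {ε : ℝ} (hε : 0 < ε) :
    ∃ (k : ℕ) (ρ : R →⋆ₐ[ℂ] MatAlg k) (ρ' : S →⋆ₐ[ℂ] MatAlg k)
      (J : G →L[ℂ] EuclideanSpace ℂ (Fin (k + 1))),
      (∀ x, ‖J x‖ ≤ ‖x‖) ∧ (∀ x ∈ g, ‖J x‖ = ‖x‖) ∧
      (∀ a ∈ s, ∀ x ∈ g, ‖ρ a (J x) - J (σ a x)‖ ^ 2 ≤
        ε * (‖x‖ * ‖x‖ + 2 * (‖σ a x‖ * ‖x‖))) ∧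
      ∀ a ∈ s', ∀ x ∈ g, ‖ρ' a (J x) - J (τ a x)‖ ^ 2 ≤
        ε * (‖x‖ * ‖x‖ + 2 * (‖τ a x‖ * ‖x‖)) := by
  classical
  let W : Finset G := g ∪ (s ×ˢ g).image (fun p => σ p.1 p.2) ∪
    (s' ×ˢ g).image (fun p => τ p.1 p.2)
  let P : Submodule ℂ G := Submodule.span ℂ W
  have hfin : FiniteDimensional ℂ P := FiniteDimensional.span_finset ℂ W
  have hg : ∀ x ∈ g, x ∈ P := fun x hx => Submodule.subset_span (by simp [W, hx])
  have hσ : ∀ a ∈ s, ∀ x ∈ g, σ a x ∈ P := fun a ha x hx => Submodule.subset_span <| by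
    refine Finset.mem_coe.2 (Finset.mem_union_left _ (Finset.mem_union_right _ ?_))
    exact Finset.mem_image.2 ⟨(a, x), Finset.mem_product.2 ⟨ha, hx⟩, rfl⟩
  have hτ : ∀ a ∈ s', ∀ x ∈ g, τ a x ∈ P := fun a ha x hx => Submodule.subset_span <| by
    refine Finset.mem_coe.2 (Finset.mem_union_right _ ?_)
    exact Finset.mem_image.2 ⟨(a, x), Finset.mem_product.2 ⟨ha, hx⟩, rfl⟩
  obtain ⟨k, ρ, ρ', J, h1, h2⟩ := exists_finite_pair_approx hR hS σ τ P
    (s ∪ s.image fun a => star a * a) (s' ∪ s'.image fun a => star a * a) hε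
  let Q : G →L[ℂ] P := P.orthogonalProjectionOnto
  have hQ : ∀ x (hx : x ∈ P), Q x = ⟨x, hx⟩ := fun x hx =>
    P.orthogonalProjectionOnto_mem_subspace_eq_self ⟨x, hx⟩
  refine ⟨k, ρ, ρ', J.toContinuousLinearMap ∘L Q, fun x => ?_, fun x hx => ?_,
    fun a ha x hx => ?_, fun a ha x hx => ?_⟩
  · change ‖J (Q x)‖ ≤ ‖x‖
    rw [J.norm_map]
    exact P.norm_orthogonalProjectionOnto_apply_le x
  · change ‖J (Q x)‖ = ‖x‖
    rw [J.norm_map, hQ x (hg x hx)]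
    rfl
  · change ‖ρ a (J (Q x)) - J (Q (σ a x))‖ ^ 2 ≤ _
    rw [hQ x (hg x hx), hQ _ (hσ a ha x hx)]
    exact norm_sq_sub_le_of_compression σ ρ J a (h1 a (Finset.mem_union_left _ ha))
      (h1 _ (Finset.mem_union_right _ (Finset.mem_image_of_mem _ ha))) _ _ rfl
  · change ‖ρ' a (J (Q x)) - J (Q (τ a x))‖ ^ 2 ≤ _
    rw [hQ x (hg x hx), hQ _ (hτ a ha x hx)]
    exact norm_sq_sub_le_of_compression τ ρ' J a (h2 a (Finset.mem_union_left _ ha))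
      (h2 _ (Finset.mem_union_right _ (Finset.mem_image_of_mem _ ha))) _ _ rfl

/-- Pairs of representations of residually finite-dimensional algebras on a common space are
strong limits of pairs of finite-dimensional ones. -/
theorem exists_finite_pair_net [Nontrivial R] [Nontrivial S] (hR : IsResiduallyFinite R)
    (hS : IsResiduallyFinite S) (σ : R →⋆ₐ[ℂ] (G →L[ℂ] G)) (τ : S →⋆ₐ[ℂ] (G →L[ℂ] G)) :
    ∃ (D : Type u) (l : Filter D) (k : D → ℕ) (ρ : ∀ d, R →⋆ₐ[ℂ] MatAlg (k d))
      (ρ' : ∀ d, S →⋆ₐ[ℂ] MatAlg (k d)) (J : ∀ d, G →L[ℂ] EuclideanSpace ℂ (Fin (k d + 1))),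
      l.NeBot ∧ (∀ d x, ‖J d x‖ ≤ ‖x‖) ∧ (∀ x, Tendsto (fun d => ‖J d x‖) l (𝓝 ‖x‖)) ∧
      (∀ a x, Tendsto (fun d => ‖ρ d a (J d x) - J d (σ a x)‖) l (𝓝 0)) ∧
      ∀ a x, Tendsto (fun d => ‖ρ' d a (J d x) - J d (τ a x)‖) l (𝓝 0) := by
  classical
  -- The net is indexed by finite sets of test elements and vectors, together with n for accuracy 1
  -- / (n + 1).
  have key := fun d : Finset R × Finset S × Finset G × ℕ =>
    exists_finite_pair_strong_approx hR hS σ τ d.1 d.2.1 d.2.2.1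
      (Nat.one_div_pos_of_nat (α := ℝ) (n := d.2.2.2))
  choose k ρ ρ' J h1 h2 h3 h4 using key
  have hn : Tendsto (fun d : Finset R × Finset S × Finset G × ℕ => (1 : ℝ) / (d.2.2.2 + 1)) atTop
      (𝓝 0) := by
    refine tendsto_one_div_add_atTop_nhds_zero_nat.comp ?_
    rw [← prod_atTop_atTop_eq, ← prod_atTop_atTop_eq, ← prod_atTop_atTop_eq]
    exact tendsto_snd.comp (tendsto_snd.comp tendsto_snd)
  have lim : ∀ (f : Finset R × Finset S × Finset G × ℕ → ℝ) (c : ℝ), (∀ d, 0 ≤ f d) →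
      (∀ᶠ d in atTop, f d ^ 2 ≤ 1 / ((d.2.2.2 : ℝ) + 1) * c) → Tendsto f atTop (𝓝 0) := by
    intro f c hf h
    have h5 : Tendsto (fun d : Finset R × Finset S × Finset G × ℕ =>
        √(1 / ((d.2.2.2 : ℝ) + 1) * c)) atTop (𝓝 0) := by
      have := (Real.continuous_sqrt.tendsto _).comp (hn.mul_const c)
      rwa [zero_mul, Real.sqrt_zero] at this
    refine squeeze_zero' (Eventually.of_forall hf) ?_ h5
    filter_upwards [h] with d hd
    exact Real.le_sqrt_of_sq_le hd
  refine ⟨Finset R × Finset S × Finset G × ℕ, atTop, k, ρ, ρ', J, inferInstance, h1,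
    fun x => ?_, fun a x => ?_, fun a x => ?_⟩
  · refine tendsto_const_nhds.congr' ?_
    filter_upwards [eventually_ge_atTop (∅, ∅, {x}, 0)] with d hd
    exact (h2 d x (hd.2.2.1 (Finset.mem_singleton_self x))).symm
  · refine lim _ (‖x‖ * ‖x‖ + 2 * (‖σ a x‖ * ‖x‖)) (fun _ => norm_nonneg _) ?_
    filter_upwards [eventually_ge_atTop ({a}, ∅, {x}, 0)] with d hd
    exact h3 d a (hd.1 (Finset.mem_singleton_self a)) x (hd.2.2.1 (Finset.mem_singleton_self x))
  · refine lim _ (‖x‖ * ‖x‖ + 2 * (‖τ a x‖ * ‖x‖)) (fun _ => norm_nonneg _) ?_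
    filter_upwards [eventually_ge_atTop (∅, {a}, {x}, 0)] with d hd
    exact h4 d a (hd.2.1 (Finset.mem_singleton_self a)) x (hd.2.2.1 (Finset.mem_singleton_self x))

/-- Joint polynomials in two representations of residually finite-dimensional algebras are
controlled by pairs of finite-dimensional representations. -/
theorem matNorm_pairEval_le_of_finite [Nontrivial R] [Nontrivial S] (hR : IsResiduallyFinite R)
    (hS : IsResiduallyFinite S) (σ : R →⋆ₐ[ℂ] (G →L[ℂ] G)) (τ : S →⋆ₐ[ℂ] (G →L[ℂ] G))
    {I I' : Type*} (f : I → R) (f' : I' → S) {n : ℕ}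
    (X : Matrix (Fin n) (Fin n) (FreeAlgebra ℂ (I ⊕ I'))) {C : ℝ} (hC : 0 ≤ C)
    (h : ∀ (k : ℕ) (ρ : R →⋆ₐ[ℂ] MatAlg k) (ρ' : S →⋆ₐ[ℂ] MatAlg k),
      matNorm (X.map (pairEval (fun i => ρ (f i)) fun i => ρ' (f' i))) ≤ C) :
    matNorm (X.map (pairEval (fun i => σ (f i)) fun i => τ (f' i))) ≤ C := by
  obtain ⟨D, l, k, ρ, ρ', J, hl, hJ1, hJ, hρ, hρ'⟩ := exists_finite_pair_net hR hS σ τ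
  set e := pairEval (fun i => σ (f i)) fun i => τ (f' i)
  let e' (d : D) := pairEval (fun i => ρ d (f i)) fun i => ρ' d (f' i)
  -- Bounds uniform in d are what let the asymptotic intertwining in `hlim` pass to products.
  have hbound : ∀ x, ∃ c : ℝ, ∀ d, ‖e' d x‖ ≤ c := by
    intro x
    induction x using FreeAlgebra.induction with
    | grade0 c => exact ⟨‖c‖, fun d => by
        rw [AlgHom.commutes, Algebra.algebraMap_eq_smul_one, norm_smul, norm_one, mul_one]⟩
    | grade1 s =>
      rcases s with i | i
      · exact ⟨‖f i‖, fun d => by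
          simp only [e', pairEval_inl]; exact norm_starHom_le (ρ d) _⟩
      · exact ⟨‖f' i‖, fun d => by
          simp only [e', pairEval_inr]; exact norm_starHom_le (ρ' d) _⟩
    | mul x y hx hy =>
      obtain ⟨c, hc⟩ := hx
      obtain ⟨c', hc'⟩ := hy
      refine ⟨c * c', fun d => ?_⟩
      rw [map_mul]
      exact (norm_mul_le _ _).trans (mul_le_mul (hc d) (hc' d) (norm_nonneg _)
        ((norm_nonneg _).trans (hc d)))
    | add x y hx hy =>
      obtain ⟨c, hc⟩ := hx
      obtain ⟨c', hc'⟩ := hy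
      refine ⟨c + c', fun d => ?_⟩
      rw [map_add]
      exact norm_add_le_of_le (hc d) (hc' d)
  have hlim : ∀ x v, Tendsto (fun d => ‖e' d x (J d v) - J d (e x v)‖) l (𝓝 0) := by
    intro x
    induction x using FreeAlgebra.induction with
    | grade0 c =>
      intro v
      simp [e', e, Algebra.algebraMap_eq_smul_one]
    | grade1 s =>
      intro v
      rcases s with i | i
      · simpa [e', e] using hρ (f i) v
      · simpa [e', e] using hρ' (f' i) v
    | mul x y hx hy =>
      intro v
      obtain ⟨c, hc⟩ := hbound x
      have h1 := ((hy v).const_mul c).add (hx (e y v))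
      rw [mul_zero, zero_add] at h1
      refine squeeze_zero (fun _ => norm_nonneg _) (fun d => ?_) h1
      have h2 : e' d (x * y) (J d v) - J d (e (x * y) v) =
          e' d x (e' d y (J d v) - J d (e y v)) +
            (e' d x (J d (e y v)) - J d (e x (e y v))) := by
        rw [map_mul, map_mul, mul_apply_eq_comp, mul_apply_eq_comp, map_sub]
        abel
      rw [h2]
      exact norm_add_le_of_le (ContinuousLinearMap.le_of_opNorm_le _ (hc d) _) le_rfl
    | add x y hx hy =>
      intro v
      have h1 := (hx v).add (hy v)
      rw [zero_add] at h1
      refine squeeze_zero (fun _ => norm_nonneg _) (fun d => ?_) h1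
      have h2 : e' d (x + y) (J d v) - J d (e (x + y) v) =
          (e' d x (J d v) - J d (e x v)) + (e' d y (J d v) - J d (e y v)) := by
        rw [map_add (e' d), map_add e, add_apply, add_apply, map_add (J d)]
        abel
      rw [h2]
      exact norm_add_le _ _
  rw [matNorm_le_iff _ hC]
  intro v
  have hlim2 : ∀ i, Tendsto (fun d => ‖∑ j, e' d (X i j) (J d (v j))‖) l
      (𝓝 ‖∑ j, e (X i j) (v j)‖) := by
    intro i
    have h1 : Tendsto (fun d => ∑ j, ‖e' d (X i j) (J d (v j)) - J d (e (X i j) (v j))‖) l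
        (𝓝 (∑ _j : Fin n, 0)) := tendsto_finsetSum _ fun j _ => hlim (X i j) (v j)
    rw [Finset.sum_const_zero] at h1
    have h2 : Tendsto (fun d => ‖∑ j, e' d (X i j) (J d (v j))‖ -
        ‖J d (∑ j, e (X i j) (v j))‖) l (𝓝 0) := by
      refine squeeze_zero_norm (fun d => ?_) h1
      refine (abs_norm_sub_norm_le _ _).trans ?_
      rw [map_sum, ← Finset.sum_sub_distrib]
      exact norm_sum_le _ _
    simpa using h2.add (hJ (∑ j, e (X i j) (v j)))
  refine le_of_tendsto (tendsto_finsetSum _ fun i _ => (hlim2 i).pow 2)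
    (Eventually.of_forall fun d => ?_)
  have h3 := (matNorm_le_iff _ hC).1 (h (k d) (ρ d) (ρ' d)) fun j => J d (v j)
  refine h3.trans ?_
  gcongr with j
  exact hJ1 d (v j)

end PairApproximation

/-! ### The joint norm estimate for RFD operator algebras. -/

section JointBounds

variable {M M' : Type u} [CStarAlgebra M] [CStarAlgebra M'] {A : Subalgebra ℂ M}
  {B : Subalgebra ℂ M'}

/-- Joint polynomials in two completely contractive representations of RFD operator algebras are
controlled by pairs of finite-dimensional representations. -/
theorem matNorm_pairEval_le_of_finRep [Nontrivial M] [Nontrivial M'] (hA : IsRFD A) (hB : IsRFD B)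
    {E : Type u} [NormedAddCommGroup E] [InnerProductSpace ℂ E] [CompleteSpace E]
    (π : A →ₐ[ℂ] (E →L[ℂ] E)) (θ : B →ₐ[ℂ] (E →L[ℂ] E))
    (hπ : CompletelyContractive A π) (hθ : CompletelyContractive B θ) {n : ℕ}
    (X : Matrix (Fin n) (Fin n) (FreeAlgebra ℂ (A ⊕ B))) {C : ℝ} (hC : 0 ≤ C)
    (h : ∀ (k : ℕ) (ρ : A →ₐ[ℂ] MatAlg k) (ρ' : B →ₐ[ℂ] MatAlg k), CompletelyContractive A ρ →
      CompletelyContractive B ρ' → matNorm (X.map (pairEval ρ ρ')) ≤ C) :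
    matNorm (X.map (pairEval π θ)) ≤ C := by
  have hA' := hA.completelyIsometric_finCoverMap
  have hB' := hB.completelyIsometric_finCoverMap
  have := hA'.nontrivial
  have := hB'.nontrivial
  obtain ⟨G, _, _, _, σ, τ, hle⟩ := exists_common_dilation isResiduallyFinite_finCover
    isResiduallyFinite_finCover (finCoverMap A) (finCoverMap B) hA' hB' π θ hπ hθ
  refine (hle n X).trans (matNorm_pairEval_le_of_finite isResiduallyFinite_finCover
    isResiduallyFinite_finCover σ τ _ _ X hC fun k ρ ρ' => ?_)
  exact h k ((ρ : FinCover A →ₐ[ℂ] MatAlg k).comp (finCoverMap A))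
    ((ρ' : FinCover B →ₐ[ℂ] MatAlg k).comp (finCoverMap B))
    (hA'.completelyContractive.comp_starHom ρ) (hB'.completelyContractive.comp_starHom ρ')

/-- An inequality between matrix norms passes from a dense subalgebra to the whole algebra. -/
theorem matNorm_map_le_of_denseRange {A₀ F D D' : Type*} [TopologicalSpace F]
    [CStarAlgebra D] [CStarAlgebra D'] {f : A₀ → F} (hf : DenseRange f) {φ : F → D} {ψ : F → D'}
    (hφ : Continuous φ) (hψ : Continuous ψ)
    (h : ∀ (n : ℕ) (X : Matrix (Fin n) (Fin n) A₀),
      matNorm (X.map fun x => φ (f x)) ≤ matNorm (X.map fun x => ψ (f x)))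
    (n : ℕ) (X : Matrix (Fin n) (Fin n) F) : matNorm (X.map φ) ≤ matNorm (X.map ψ) := by
  have hd : DenseRange fun X : Matrix (Fin n) (Fin n) A₀ => X.map f :=
    DenseRange.piMap (fun _ => DenseRange.piMap fun _ => hf)
  have hcl : IsClosed {X : Matrix (Fin n) (Fin n) F | matNorm (X.map φ) ≤ matNorm (X.map ψ)} :=
    isClosed_le (continuous_matNorm.comp (Continuous.matrix_map continuous_id hφ))
      (continuous_matNorm.comp (Continuous.matrix_map continuous_id hψ))
  refine hcl.closure_subset_iff.2 ?_ (hd X)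
  rintro _ ⟨X, rfl⟩
  exact h n X

/-- Embeddings of the zero space let `exists_common_amplification` be used when a common space is
wanted but nothing has to be aligned. -/
theorem exists_linearIsometry_of_subsingleton (k : ℕ) : Nonempty
    (EuclideanSpace ℂ (Fin 0) →ₗᵢ[ℂ] EuclideanSpace ℂ (Fin (k + 1))) :=
  ⟨⟨0, fun x => by simp [Subsingleton.elim x 0]⟩⟩

/-- A finite-dimensional representation of `A` is a compression of one which occurs in a pair. -/
theorem exists_finite_pair_left [Nontrivial M'] (hB : IsRFD B) (σ : FinRep A) :
    ∃ (k : ℕ) (ρ : A →ₐ[ℂ] MatAlg k) (ρ' : B →ₐ[ℂ] MatAlg k),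
      CompletelyContractive A ρ ∧ CompletelyContractive B ρ' ∧
      ∀ (n : ℕ) (X : Matrix (Fin n) (Fin n) A), matNorm (X.map σ.hom) ≤ matNorm (X.map ρ) := by
  have hB' := hB.completelyIsometric_finCoverMap
  have := hB'.nontrivial
  obtain ⟨q, ⟨τ⟩⟩ := (isResiduallyFinite_finCover (A := B)).exists_starHom
  obtain ⟨J⟩ := exists_linearIsometry_of_subsingleton σ.deg
  obtain ⟨J'⟩ := exists_linearIsometry_of_subsingleton q
  obtain ⟨N, π, π', T, -, hT, -, -⟩ := exists_common_amplification (finCoverEval A σ) τ J J'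
  refine ⟨N, (π : FinCover A →ₐ[ℂ] MatAlg N).comp (finCoverMap A),
    (π' : FinCover B →ₐ[ℂ] MatAlg N).comp (finCoverMap B),
    completelyContractive_finCoverMap.comp_starHom π, hB'.completelyContractive.comp_starHom π',
    fun n X => ?_⟩
  have h1 : X.map σ.hom = (X.map fun a => π (finCoverMap A a)).map fun Y =>
      ContinuousLinearMap.adjoint T.toContinuousLinearMap ∘L Y ∘L T.toContinuousLinearMap := by
    refine Matrix.ext fun i j => ContinuousLinearMap.ext fun x => ?_
    change _ = ContinuousLinearMap.adjoint T.toContinuousLinearMap (π (finCoverMap A (X i j)) (T x))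
    rw [hT, T.adjoint_apply_apply]
    rfl
  rw [h1]
  exact matNorm_compress_le _ _ _
    (by rw [LinearIsometryEquiv.norm_map]; exact T.norm_toContinuousLinearMap_le)
    T.norm_toContinuousLinearMap_le

end JointBounds

/-! ### Free products of residually finite-dimensional C*-algebras. -/

section CStarPairs

variable {R S : Type u} [CStarAlgebra R] [CStarAlgebra S]

/-- A GNS representation attaining the norm of the given polynomial reduces an abstract target to
operators on a Hilbert space. -/
theorem norm_pairEval_le_of_finite [Nontrivial R] [Nontrivial S] (hR : IsResiduallyFinite R)
    (hS : IsResiduallyFinite S) {D : Type u} [CStarAlgebra D] (σ : R →⋆ₐ[ℂ] D) (τ : S →⋆ₐ[ℂ] D)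
    (x : FreeAlgebra ℂ (R ⊕ S)) {C : ℝ} (hC : 0 ≤ C)
    (h : ∀ (k : ℕ) (ρ : R →⋆ₐ[ℂ] MatAlg k) (ρ' : S →⋆ₐ[ℂ] MatAlg k), ‖pairEval ρ ρ' x‖ ≤ C) :
    ‖pairEval σ τ x‖ ≤ C := by
  obtain ⟨E, _, _, _, φ, hφ⟩ := exists_starHom_norm_eq (pairEval σ τ x)
  have h1 : φ (pairEval σ τ x) = pairEval (fun a => φ (σ a)) (fun b => φ (τ b)) x :=
    algHom_pairEval (φ : D →ₐ[ℂ] (E →L[ℂ] E)) σ τ x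
  rw [← hφ, h1, ← matNorm_diag]
  refine matNorm_pairEval_le_of_finite hR hS (φ.comp σ) (φ.comp τ) id id
    (Matrix.of fun _ _ : Fin 1 => x) hC fun k ρ ρ' => ?_
  change matNorm (Matrix.of fun _ _ : Fin 1 => pairEval ρ ρ' x) ≤ C
  rw [matNorm_diag]
  exact h k ρ ρ'

/-- A finite-dimensional `*`-representation of `R` is contained in one which occurs in a pair. -/
theorem exists_finite_star_pair_left [Nontrivial S] (hS : IsResiduallyFinite S) {p : ℕ}
    (ρ : R →⋆ₐ[ℂ] MatAlg p) :
    ∃ (k : ℕ) (σ : R →⋆ₐ[ℂ] MatAlg k) (_ : S →⋆ₐ[ℂ] MatAlg k), ∀ x, σ x = 0 → ρ x = 0 := by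
  obtain ⟨q, ⟨τ⟩⟩ := hS.exists_starHom
  obtain ⟨J⟩ := exists_linearIsometry_of_subsingleton p
  obtain ⟨J'⟩ := exists_linearIsometry_of_subsingleton q
  obtain ⟨N, π, π', T, -, hT, -, -⟩ := exists_common_amplification ρ τ J J'
  refine ⟨N, π, π', fun x hx => ContinuousLinearMap.ext fun v => T.injective ?_⟩
  rw [← hT, hx]
  simp

variable (R S) in
/-- The pairs of finite-dimensional `*`-representations on a common space. -/
abbrev StarPair : Type u := Σ k, (R →⋆ₐ[ℂ] MatAlg k) × (S →⋆ₐ[ℂ] MatAlg k)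

/-- The `*`-homomorphism into an `ℓ^∞`-product with given coordinates. -/
noncomputable def MatProd.starLift {Λ : Type*} {k : Λ → ℕ} (f : ∀ l, R →⋆ₐ[ℂ] MatAlg (k l)) :
    R →⋆ₐ[ℂ] MatProd k :=
  { MatProd.lift (fun l => (f l : R →ₐ[ℂ] MatAlg (k l)))
      fun a => ⟨‖a‖, fun l => norm_starHom_le (f l) a⟩ with
    map_star' := fun a => MatProd.ext_eval fun l => by
      rw [map_star]
      exact map_star (f l) a }

/-- A C*-algebra generated by `R` and `S` on which all pairs of finite-dimensional
`*`-representations are defined is the free product. -/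
theorem isCStarFreeProduct_of_finite [Nontrivial R] [Nontrivial S] (hR : IsResiduallyFinite R)
    (hS : IsResiduallyFinite S) {F : Type u} [CStarAlgebra F] (r : R →⋆ₐ[ℂ] F) (s : S →⋆ₐ[ℂ] F)
    (hgen : (StarAlgebra.adjoin ℂ (Set.range r ∪ Set.range s)).topologicalClosure = ⊤)
    (hpair : ∀ (k : ℕ) (ρ : R →⋆ₐ[ℂ] MatAlg k) (ρ' : S →⋆ₐ[ℂ] MatAlg k),
      ∃ e : F →⋆ₐ[ℂ] MatAlg k, (∀ x, e (r x) = ρ x) ∧ ∀ y, e (s y) = ρ' y) :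
    IsCStarFreeProduct r s where
  -- After amplification every finite-dimensional representation of R is part of a pair, and
  -- therefore is seen by F.
  injective_left := (injective_iff_map_eq_zero r).2 fun x hx => hR x fun p ρ => by
    obtain ⟨k, σ, τ, hσ⟩ := exists_finite_star_pair_left hS ρ
    obtain ⟨e, he, -⟩ := hpair k σ τ
    exact hσ x (by rw [← he, hx, map_zero])
  injective_right := (injective_iff_map_eq_zero s).2 fun x hx => hS x fun p ρ => by
    obtain ⟨k, τ, σ, hτ⟩ := exists_finite_star_pair_left hR ρ
    obtain ⟨e, -, he⟩ := hpair k σ τ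
    exact hτ x (by rw [← he, hx, map_zero])
  generates := hgen
  universal D _ π θ := by
    obtain ⟨h, hn, hh⟩ := exists_algHom_of_norm_le (pairEval r s) (pairEval π θ)
      (denseRange_pairEval_of_starHom r s hgen) fun x => by
        refine norm_pairEval_le_of_finite hR hS π θ x (norm_nonneg _) fun k ρ ρ' => ?_
        obtain ⟨e, her, hes⟩ := hpair k ρ ρ'
        have h1 : e (pairEval r s x) = pairEval (fun x => e (r x)) (fun y => e (s y)) x :=
          algHom_pairEval (e : F →ₐ[ℂ] MatAlg k) r s x
        rw [funext her, funext hes] at h1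
        rw [← h1]
        exact norm_starHom_le _ _
    have hl : ∀ x, starHomOfNormLE h hn (r x) = π x := fun x => by
      have := hh (FreeAlgebra.ι ℂ (Sum.inl x))
      rwa [pairEval_inl, pairEval_inl] at this
    have hr : ∀ x, starHomOfNormLE h hn (s x) = θ x := fun x => by
      have := hh (FreeAlgebra.ι ℂ (Sum.inr x))
      rwa [pairEval_inr, pairEval_inr] at this
    refine ⟨starHomOfNormLE h hn, ⟨hl, hr⟩, fun g hg => ?_⟩
    refine starHom_ext_of_topologicalClosure_adjoin hgen _ _ ?_
    rintro _ (⟨x, rfl⟩ | ⟨x, rfl⟩)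
    · rw [hg.1, hl]
    · rw [hg.2, hr]

/-- The free product of residually finite-dimensional C*-algebras exists and is residually
finite-dimensional. -/
theorem exists_isCStarFreeProduct [Nontrivial R] [Nontrivial S] (hR : IsResiduallyFinite R)
    (hS : IsResiduallyFinite S) :
    ∃ (F : Type u) (_ : CStarAlgebra F) (r : R →⋆ₐ[ℂ] F) (s : S →⋆ₐ[ℂ] F),
      IsCStarFreeProduct r s ∧ IsResiduallyFinite F := by
  let r₀ : R →⋆ₐ[ℂ] MatProd fun l : StarPair R S => l.1 := MatProd.starLift fun l => l.2.1
  let s₀ : S →⋆ₐ[ℂ] MatProd fun l : StarPair R S => l.1 := MatProd.starLift fun l => l.2.2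
  let F : StarSubalgebra ℂ (MatProd fun l : StarPair R S => l.1) :=
    (StarAlgebra.adjoin ℂ (Set.range r₀ ∪ Set.range s₀)).topologicalClosure
  let r : R →⋆ₐ[ℂ] F := r₀.codRestrict F fun a =>
    StarSubalgebra.le_topologicalClosure _ (StarAlgebra.subset_adjoin ℂ _ (Or.inl ⟨a, rfl⟩))
  let s : S →⋆ₐ[ℂ] F := s₀.codRestrict F fun a =>
    StarSubalgebra.le_topologicalClosure _ (StarAlgebra.subset_adjoin ℂ _ (Or.inr ⟨a, rfl⟩))
  have hgen : (StarAlgebra.adjoin ℂ (Set.range r ∪ Set.range s)).topologicalClosure = ⊤ := by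
    refine topologicalClosure_adjoin_eq_top_of_image _ _ ?_
    rw [Set.image_union, ← Set.range_comp, ← Set.range_comp]
    rfl
  exact ⟨F, inferInstance, r, s, isCStarFreeProduct_of_finite hR hS r s hgen fun k ρ ρ' =>
    ⟨(MatProd.eval (k := fun l : StarPair R S => l.1) ⟨k, ρ, ρ'⟩).comp F.subtype,
      fun x => rfl, fun x => rfl⟩,
    isResiduallyFinite_of_injective F.subtype Subtype.val_injective MatProd.isResiduallyFinite⟩

theorem IsCStarFreeProduct.hom_ext {F : Type u} [CStarAlgebra F] {r : R →⋆ₐ[ℂ] F}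
    {s : S →⋆ₐ[ℂ] F} (h : IsCStarFreeProduct r s) {D : Type u} [CStarAlgebra D]
    {φ ψ : F →⋆ₐ[ℂ] D} (hl : ∀ x, φ (r x) = ψ (r x)) (hr : ∀ x, φ (s x) = ψ (s x)) : φ = ψ := by
  refine starHom_ext_of_topologicalClosure_adjoin h.generates _ _ ?_
  rintro _ (⟨x, rfl⟩ | ⟨x, rfl⟩)
  · exact hl x
  · exact hr x

/-- Universality gives a map to the constructed residually finite-dimensional model with a left
inverse, so it is injective. -/
theorem IsCStarFreeProduct.isResiduallyFinite [Nontrivial R] [Nontrivial S]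
    (hR : IsResiduallyFinite R) (hS : IsResiduallyFinite S) {F : Type u} [CStarAlgebra F]
    {r : R →⋆ₐ[ℂ] F} {s : S →⋆ₐ[ℂ] F} (h : IsCStarFreeProduct r s) : IsResiduallyFinite F := by
  obtain ⟨F', _, r', s', h', hF'⟩ := exists_isCStarFreeProduct hR hS
  obtain ⟨φ, ⟨hφr, hφs⟩, -⟩ := h.universal F' r' s'
  obtain ⟨ψ, ⟨hψr, hψs⟩, -⟩ := h'.universal F r s
  have : ψ.comp φ = StarAlgHom.id ℂ F := h.hom_ext
    (fun x => by simp [hφr, hψr]) (fun x => by simp [hφs, hψs])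
  refine isResiduallyFinite_of_injective φ (fun x y hxy => ?_) hF'
  have e : ∀ z, ψ (φ z) = z := DFunLike.congr_fun this
  rw [← e x, hxy, e]

end CStarPairs

/-! ### Construction of the operator algebra free product. -/

section FreeProduct

variable {M₁ M₂ : Type u} [CStarAlgebra M₁] [CStarAlgebra M₂] {A : Subalgebra ℂ M₁}
  {B : Subalgebra ℂ M₂}

theorem CompletelyContractive.continuous {M : Type u} [CStarAlgebra M] {A : Subalgebra ℂ M}
    {N : Type*} [CStarAlgebra N] {f : A →ₐ[ℂ] N} (hf : CompletelyContractive A f) :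
    Continuous f :=
  AddMonoidHomClass.continuous_of_bound f 1 (by simpa using hf.norm_le)

theorem continuous_of_norm_le {F D : Type*} [NormedRing F] [NormedAlgebra ℂ F] [NormedRing D]
    [NormedAlgebra ℂ D] (h : F →ₐ[ℂ] D) (hn : ∀ y, ‖h y‖ ≤ ‖y‖) : Continuous h :=
  AddMonoidHomClass.continuous_of_bound h 1 (by simpa using hn)

variable (A B) in
/-- The pairs of finite-dimensional completely contractive representations on a common space. -/
abbrev RepPair : Type u :=
  Σ k, {ρ : A →ₐ[ℂ] MatAlg k // CompletelyContractive A ρ} ×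
    {ρ : B →ₐ[ℂ] MatAlg k // CompletelyContractive B ρ}

/-- A family of completely contractive homomorphisms into matrix algebras, as operators on the
`ℓ²`-sum. -/
theorem exists_blockDiagonal_algHom {Λ : Type u} {k : Λ → ℕ} (f : ∀ l, A →ₐ[ℂ] MatAlg (k l))
    (hf : ∀ l, CompletelyContractive A (f l))
    (hA : ∀ (n : ℕ) (X : Matrix (Fin n) (Fin n) A) (C : ℝ), 0 ≤ C →
      (∀ l, matNorm (X.map (f l)) ≤ C) → matNorm (X.map Subtype.val) ≤ C) :
    CompletelyIsometric A fun a => MatProd.blockDiagonal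
      (MatProd.lift f (fun a => ⟨‖a‖, fun l => (hf l).norm_le a⟩) a) := by
  intro n X
  have h1 := matNorm_map_of_injective MatProd.blockDiagonal MatProd.blockDiagonal_injective
    (X.map (MatProd.lift f (fun a => ⟨‖a‖, fun l => (hf l).norm_le a⟩)))
  refine h1.trans (le_antisymm ?_ ?_)
  · exact MatProd.matNorm_le _ (matNorm_nonneg _) fun l => hf l n X
  · exact hA n X _ (matNorm_nonneg _) fun l => matNorm_map_le (MatProd.eval l)
      (X.map (MatProd.lift f (fun a => ⟨‖a‖, fun l => (hf l).norm_le a⟩)))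

/-- An operator algebra generated by `A` and `B` on which all pairs of finite-dimensional
representations are defined and completely contractive is the free product. -/
theorem isFreeProduct_of_finRep [Nontrivial M₁] [Nontrivial M₂] (hA : IsRFD A) (hB : IsRFD B)
    {M₃ : Type u} [CStarAlgebra M₃] {P : Subalgebra ℂ M₃} (ι : A →ₐ[ℂ] P) (j : B →ₐ[ℂ] P)
    (hι : CompletelyIsometric A fun a => (ι a : M₃))
    (hj : CompletelyIsometric B fun b => (j b : M₃))
    (hgen : Dense (Algebra.adjoin ℂ (Set.range ι ∪ Set.range j) : Set P))
    (hpair : ∀ (k : ℕ) (ρ : A →ₐ[ℂ] MatAlg k) (ρ' : B →ₐ[ℂ] MatAlg k), CompletelyContractive A ρ →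
      CompletelyContractive B ρ' → ∃ e : P →ₐ[ℂ] MatAlg k, CompletelyContractive P e ∧
        (∀ x, e (ι x) = ρ x) ∧ ∀ y, e (j y) = ρ' y) :
    IsFreeProduct A B P ι j where
  isometric_left := hι
  isometric_right := hj
  generates := hgen
  universal E _ _ _ π θ hπ hθ := by
    have hd : DenseRange (pairEval ι j) := by rwa [DenseRange, range_pairEval]
    have key : ∀ (n : ℕ) (X : Matrix (Fin n) (Fin n) (FreeAlgebra ℂ (A ⊕ B))),
        matNorm (X.map (pairEval π θ)) ≤ matNorm (X.map fun x => (pairEval ι j x : M₃)) := by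
      intro n X
      refine matNorm_pairEval_le_of_finRep hA hB π θ hπ hθ X (matNorm_nonneg _)
        fun k ρ ρ' hρ hρ' => ?_
      obtain ⟨e, he, her, hes⟩ := hpair k ρ ρ' hρ hρ'
      have h1 : ∀ x, e (pairEval ι j x) = pairEval ρ ρ' x := fun x => by
        rw [algHom_pairEval e ι j x, funext her, funext hes]
      have h2 : X.map (pairEval ρ ρ') = (X.map (pairEval ι j)).map e := by
        ext1 r s; exact (h1 _).symm
      rw [h2]
      exact he n (X.map (pairEval ι j))
    obtain ⟨h, hn, hh⟩ := exists_algHom_of_norm_le (pairEval ι j) (pairEval π θ) hd fun x => by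
      have := key 1 (Matrix.of fun _ _ => x)
      change matNorm (Matrix.of fun _ _ : Fin 1 => pairEval π θ x) ≤
        matNorm (Matrix.of fun _ _ : Fin 1 => (pairEval ι j x : M₃)) at this
      rwa [matNorm_diag, matNorm_diag] at this
    refine ⟨h, ⟨fun n X => ?_, fun a => ?_, fun b => ?_⟩, fun g ⟨hg, hgι, hgj⟩ => ?_⟩
    · refine matNorm_map_le_of_denseRange hd (continuous_of_norm_le h hn) continuous_subtype_val
        (fun n X => ?_) n X
      simp_rw [hh]
      exact key n X
    · have := hh (FreeAlgebra.ι ℂ (Sum.inl a))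
      rwa [pairEval_inl, pairEval_inl] at this
    · have := hh (FreeAlgebra.ι ℂ (Sum.inr b))
      rwa [pairEval_inr, pairEval_inr] at this
    · refine DFunLike.coe_injective (hd.equalizer hg.continuous (continuous_of_norm_le h hn) ?_)
      funext x
      change g (pairEval ι j x) = h (pairEval ι j x)
      rw [hh, algHom_pairEval g ι j x, funext hgι, funext hgj]

theorem hasFreeProduct_of_isRFD [Nontrivial M₁] [Nontrivial M₂] (hA : IsRFD A) (hB : IsRFD B) :
    HasFreeProduct A B := by
  let k : RepPair A B → ℕ := fun l => l.1
  have hfA : ∀ a : A, ∃ c : ℝ, ∀ l : RepPair A B, ‖l.2.1.1 a‖ ≤ c :=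
    fun a => ⟨‖a‖, fun l => l.2.1.2.norm_le a⟩
  have hfB : ∀ b : B, ∃ c : ℝ, ∀ l : RepPair A B, ‖l.2.2.1 b‖ ≤ c :=
    fun b => ⟨‖b‖, fun l => l.2.2.2.norm_le b⟩
  let Ψ : MatProd k →ₐ[ℂ] (lp (fun l => EuclideanSpace ℂ (Fin (k l + 1))) 2 →L[ℂ]
      lp (fun l => EuclideanSpace ℂ (Fin (k l + 1))) 2) :=
    (MatProd.blockDiagonal (k := k)).toAlgHom
  let f : A →ₐ[ℂ] MatProd k := MatProd.lift (fun l => l.2.1.1) hfA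
  let g : B →ₐ[ℂ] MatProd k := MatProd.lift (fun l => l.2.2.1) hfB
  let Q : Subalgebra ℂ (MatProd k) := Algebra.adjoin ℂ (Set.range f ∪ Set.range g)
  -- The algebra generated in the product over all pairs is moved by the block diagonal action onto
  -- a Hilbert space. No closure is taken, so polynomials fill P exactly.
  let P := Q.map Ψ
  let q : Q ≃ₐ[ℂ] P := Q.equivMapOfInjective Ψ MatProd.blockDiagonal_injective
  let f' : A →ₐ[ℂ] Q := f.codRestrict Q fun a => Algebra.subset_adjoin (Or.inl ⟨a, rfl⟩)
  let g' : B →ₐ[ℂ] Q := g.codRestrict Q fun b => Algebra.subset_adjoin (Or.inr ⟨b, rfl⟩)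
  let ι : A →ₐ[ℂ] P := q.toAlgHom.comp f'
  let j : B →ₐ[ℂ] P := q.toAlgHom.comp g'
  refine ⟨_, inferInstance, inferInstance, inferInstance, P, ι, j,
    isFreeProduct_of_finRep hA hB ι j ?_ ?_ ?_ fun m ρ ρ' hρ hρ' => ?_⟩
  · refine exists_blockDiagonal_algHom (fun l : RepPair A B => l.2.1.1) (fun l => l.2.1.2)
      fun n X C hC h => hA.matNorm_le X hC fun σ => ?_
    -- Coordinates must norm A by itself, so each representation of A is replaced by one that occurs
    -- in a pair and dominates it.
    obtain ⟨m, ρ, ρ', hρ, hρ', hle⟩ := exists_finite_pair_left hB σ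
    exact (hle n X).trans (h ⟨m, ⟨ρ, hρ⟩, ⟨ρ', hρ'⟩⟩)
  · refine exists_blockDiagonal_algHom (fun l : RepPair A B => l.2.2.1) (fun l => l.2.2.2)
      fun n X C hC h => hB.matNorm_le X hC fun σ => ?_
    obtain ⟨m, ρ', ρ, hρ', hρ, hle⟩ := exists_finite_pair_left hA σ
    exact (hle n X).trans (h ⟨m, ⟨ρ, hρ⟩, ⟨ρ', hρ'⟩⟩)
  · have hsurj : ∀ p : P, p ∈ Set.range (pairEval ι j) := by
      intro p
      obtain ⟨y, rfl⟩ := q.surjective p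
      have hy : (y : MatProd k) ∈ Set.range (pairEval f g) := by
        rw [range_pairEval]; exact y.2
      obtain ⟨x, hx⟩ := hy
      refine ⟨x, ?_⟩
      have h1 : pairEval ι j x = q (pairEval f' g' x) :=
        (algHom_pairEval q.toAlgHom f' g' x).symm
      rw [h1]
      congr 1
      apply Subtype.ext
      rw [← hx]
      exact algHom_pairEval Q.val f' g' x
    rw [← range_pairEval, Set.eq_univ_of_forall hsurj]
    exact dense_univ
  · let l : RepPair A B := ⟨m, ⟨ρ, hρ⟩, ⟨ρ', hρ'⟩⟩
    refine ⟨((MatProd.eval (k := k) l : MatProd k →ₐ[ℂ] MatAlg m).comp Q.val).comp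
      q.symm.toAlgHom, fun n X => ?_, fun x => ?_, fun y => ?_⟩
    · obtain ⟨Y, rfl⟩ : ∃ Y : Matrix (Fin n) (Fin n) Q, Y.map q = X :=
        ⟨X.map q.symm, by ext1 r s; simp⟩
      have h1 := matNorm_map_of_injective (MatProd.blockDiagonal (k := k))
        MatProd.blockDiagonal_injective (Y.map Subtype.val)
      have h2 := matNorm_map_le (MatProd.eval (k := k) l) (Y.map Subtype.val)
      rw [← h1] at h2
      refine le_trans (le_of_eq ?_) (h2.trans (le_of_eq rfl))
      congr 1
      ext1 r s
      change MatProd.eval l ((q.symm (q (Y r s)) : Q) : MatProd k) = _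
      rw [AlgEquiv.symm_apply_apply]
      rfl
    · change MatProd.eval l ((q.symm (q (f' x)) : Q) : MatProd k) = _
      rw [AlgEquiv.symm_apply_apply]
      rfl
    · change MatProd.eval l ((q.symm (q (g' y)) : Q) : MatProd k) = _
      rw [AlgEquiv.symm_apply_apply]
      rfl

end FreeProduct

/-! ### The free product is RFD, and the isomorphism. -/

section FreeProduct

variable {M₁ M₂ M₃ : Type u} [CStarAlgebra M₁] [CStarAlgebra M₂] [CStarAlgebra M₃]
  {A : Subalgebra ℂ M₁} {B : Subalgebra ℂ M₂} {P : Subalgebra ℂ M₃}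
  {ι : A →ₐ[ℂ] P} {j : B →ₐ[ℂ] P}

namespace IsFreeProduct

theorem denseRange (h : IsFreeProduct A B P ι j) : DenseRange (pairEval ι j) := by
  rw [DenseRange, range_pairEval]
  exact h.generates

/-- The universal property of the free product for finite-dimensional representations. -/
theorem exists_extension (h : IsFreeProduct A B P ι j) {k : ℕ} (ρ : A →ₐ[ℂ] MatAlg k)
    (ρ' : B →ₐ[ℂ] MatAlg k) (hρ : CompletelyContractive A ρ) (hρ' : CompletelyContractive B ρ') :
    ∃ σ : P →ₐ[ℂ] MatAlg k, CompletelyContractive P σ ∧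
      ∀ x, σ (pairEval ι j x) = pairEval ρ ρ' x := by
  -- The universal property concerns Hilbert spaces in universe u, so the matrix algebra is
  -- transported to a unitarily equivalent lifted copy and back.
  obtain ⟨E, _, _, _, ⟨U⟩⟩ : ∃ (E : Type u) (_ : NormedAddCommGroup E)
      (_ : InnerProductSpace ℂ E) (_ : CompleteSpace E),
      Nonempty (EuclideanSpace ℂ (Fin (k + 1)) ≃ₗᵢ[ℂ] E) :=
    ⟨EuclideanSpace ℂ (ULift.{u} (Fin (k + 1))), inferInstance, inferInstance, inferInstance,
      ⟨LinearIsometryEquiv.piLpCongrLeft 2 ℂ ℂ Equiv.ulift.symm⟩⟩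
  let α : MatAlg k →ₐ[ℂ] (E →L[ℂ] E) := (conjHom U).toAlgHom
  let β : (E →L[ℂ] E) →ₐ[ℂ] MatAlg k := (conjHom U.symm).toAlgHom
  have hβα : ∀ T, β (α T) = T := fun T => ContinuousLinearMap.ext fun x => by
    change U.symm (U (T (U.symm (U x)))) = T x
    rw [U.symm_apply_apply, U.symm_apply_apply]
  obtain ⟨σ, ⟨hσ, hσι, hσj⟩, -⟩ := h.universal E (α.comp ρ) (α.comp ρ')
    (hρ.comp_starHom (conjHom U)) (hρ'.comp_starHom (conjHom U))
  refine ⟨β.comp σ, hσ.comp_starHom (conjHom U.symm), fun x => ?_⟩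
  have h1 : (fun a => β.comp σ (ι a)) = ρ := funext fun a => by
    rw [AlgHom.comp_apply, hσι, AlgHom.comp_apply, hβα]
  have h2 : (fun b => β.comp σ (j b)) = ρ' := funext fun b => by
    rw [AlgHom.comp_apply, hσj, AlgHom.comp_apply, hβα]
  rw [algHom_pairEval, h1, h2]

/-- Each finite-dimensional pair extends to a finite-dimensional representation of P, so the
estimate over pairs becomes one over representations of P. -/
theorem matNorm_map_pairEval_le [Nontrivial M₁] [Nontrivial M₂] {L : Type u}
    [NormedAddCommGroup L] [InnerProductSpace ℂ L] [CompleteSpace L]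
    {P : Subalgebra ℂ (L →L[ℂ] L)} {ι : A →ₐ[ℂ] P} {j : B →ₐ[ℂ] P} (h : IsFreeProduct A B P ι j)
    (hA : IsRFD A) (hB : IsRFD B) {n : ℕ} (X : Matrix (Fin n) (Fin n) (FreeAlgebra ℂ (A ⊕ B)))
    {C : ℝ} (hC : 0 ≤ C)
    (hX : ∀ σ : FinRep P, matNorm (X.map fun x => σ.hom (pairEval ι j x)) ≤ C) :
    matNorm (X.map fun x => (pairEval ι j x : L →L[ℂ] L)) ≤ C := by
  have h1 : (X.map fun x => (pairEval ι j x : L →L[ℂ] L)) =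
      X.map (pairEval (P.val.comp ι) (P.val.comp j)) := by
    refine Matrix.ext fun r s => ?_
    exact algHom_pairEval P.val ι j (X r s)
  rw [h1]
  have hι : CompletelyContractive A (P.val.comp ι) := h.isometric_left.completelyContractive
  have hj : CompletelyContractive B (P.val.comp j) := h.isometric_right.completelyContractive
  refine matNorm_pairEval_le_of_finRep hA hB _ _ hι hj X hC fun k ρ ρ' hρ hρ' => ?_
  obtain ⟨σ, hσ, hσ'⟩ := h.exists_extension ρ ρ' hρ hρ'
  have := hX ⟨k, σ, hσ⟩
  simp_rw [hσ'] at this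
  exact this

/-- The free product of RFD operator algebras is RFD. -/
theorem isRFD [Nontrivial M₁] [Nontrivial M₂] {L : Type u} [NormedAddCommGroup L]
    [InnerProductSpace ℂ L] [CompleteSpace L] {P : Subalgebra ℂ (L →L[ℂ] L)} {ι : A →ₐ[ℂ] P}
    {j : B →ₐ[ℂ] P} (h : IsFreeProduct A B P ι j) (hA : IsRFD A) (hB : IsRFD B) : IsRFD P := by
  have := h.isometric_left.nontrivial
  -- Polynomials in A and B are controlled directly; the remaining elements of P follow by density
  -- and continuity.
  have hle : ∀ (n : ℕ) (X : Matrix (Fin n) (Fin n) P),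
      matNorm (X.map Subtype.val) ≤ matNorm (X.map (finCoverMap P)) :=
    matNorm_map_le_of_denseRange h.denseRange continuous_subtype_val
      completelyContractive_finCoverMap.continuous fun n X =>
        h.matNorm_map_pairEval_le hA hB X (matNorm_nonneg _) fun σ =>
          matNorm_map_le (finCoverEval P σ) (X.map fun x => finCoverMap P (pairEval ι j x))
  exact isRFD_of_completelyIsometric
    (fun n X => le_antisymm (completelyContractive_finCoverMap n X) (hle n X))
    isResiduallyFinite_finCover

/-- The universal property of the free product for residually finite-dimensional targets. -/
theorem exists_algHom (h : IsFreeProduct A B P ι j) {F : Type u} [CStarAlgebra F]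
    (hF : IsResiduallyFinite F) (φ : A →ₐ[ℂ] F) (ψ : B →ₐ[ℂ] F) (hφ : CompletelyContractive A φ)
    (hψ : CompletelyContractive B ψ) :
    ∃ κ : P →ₐ[ℂ] F, CompletelyContractive P κ ∧ (∀ a, κ (ι a) = φ a) ∧ ∀ b, κ (j b) = ψ b := by
  have key : ∀ (n : ℕ) (X : Matrix (Fin n) (Fin n) (FreeAlgebra ℂ (A ⊕ B))),
      matNorm (X.map (pairEval φ ψ)) ≤ matNorm (X.map fun x => (pairEval ι j x : M₃)) := by
    intro n X
    refine hF.matNorm_le _ (matNorm_nonneg _) fun k ρ => ?_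
    obtain ⟨σ, hσ, hσ'⟩ := h.exists_extension ((ρ : F →ₐ[ℂ] MatAlg k).comp φ)
      ((ρ : F →ₐ[ℂ] MatAlg k).comp ψ) (hφ.comp_starHom ρ) (hψ.comp_starHom ρ)
    refine le_trans (le_of_eq ?_) (hσ n (X.map (pairEval ι j)))
    congr 1
    ext1 r s
    exact (algHom_pairEval (ρ : F →ₐ[ℂ] MatAlg k) φ ψ (X r s)).trans (hσ' _).symm
  obtain ⟨κ, hn, hκ⟩ := exists_algHom_of_norm_le (pairEval ι j) (pairEval φ ψ) h.denseRange
    fun x => by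
      have := key 1 (Matrix.of fun _ _ => x)
      change matNorm (Matrix.of fun _ _ : Fin 1 => pairEval φ ψ x) ≤
        matNorm (Matrix.of fun _ _ : Fin 1 => (pairEval ι j x : M₃)) at this
      rwa [matNorm_diag, matNorm_diag] at this
  refine ⟨κ, fun n X => ?_, fun a => ?_, fun b => ?_⟩
  · refine matNorm_map_le_of_denseRange h.denseRange (continuous_of_norm_le κ hn)
      continuous_subtype_val (fun n X => ?_) n X
    simp_rw [hκ]
    exact key n X
  · have := hκ (FreeAlgebra.ι ℂ (Sum.inl a))
    rwa [pairEval_inl, pairEval_inl] at this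
  · have := hκ (FreeAlgebra.ι ℂ (Sum.inr b))
    rwa [pairEval_inr, pairEval_inr] at this

theorem algHom_ext (h : IsFreeProduct A B P ι j) {D : Type*} [NormedRing D] [NormedAlgebra ℂ D]
    {φ ψ : P →ₐ[ℂ] D} (hφ : Continuous φ) (hψ : Continuous ψ) (hι : ∀ a, φ (ι a) = ψ (ι a))
    (hj : ∀ b, φ (j b) = ψ (j b)) : φ = ψ := by
  refine DFunLike.coe_injective (h.denseRange.equalizer hφ hψ ?_)
  funext x
  change φ (pairEval ι j x) = ψ (pairEval ι j x)
  rw [algHom_pairEval φ ι j x, algHom_pairEval ψ ι j x, funext hι, funext hj]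

/-- The RFD-maximal C*-cover of a free product is the free product of the RFD-maximal
C*-covers. -/
theorem nonempty_starAlgEquiv [Nontrivial M₁] [Nontrivial M₂] (h : IsFreeProduct A B P ι j)
    {RA RB RP F : Type u} [CStarAlgebra RA] [CStarAlgebra RB] [CStarAlgebra RP] [CStarAlgebra F]
    {υA : A →ₐ[ℂ] RA} {υB : B →ₐ[ℂ] RB} {υP : P →ₐ[ℂ] RP} {r : RA →⋆ₐ[ℂ] F} {s : RB →⋆ₐ[ℂ] F}
    (hA : IsRFDMaximalCover A υA) (hB : IsRFDMaximalCover B υB) (hP : IsRFDMaximalCover P υP)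
    (hF : IsCStarFreeProduct r s) : Nonempty (RP ≃⋆ₐ[ℂ] F) := by
  have := h.isometric_left.nontrivial
  have := hA.cover.isometric.nontrivial
  have := hB.cover.isometric.nontrivial
  -- This is what allows the RFD-maximal cover of P to map to F.
  have hF' : IsResiduallyFinite F :=
    hF.isResiduallyFinite hA.isResiduallyFinite hB.isResiduallyFinite
  obtain ⟨κ, hκ, hκι, hκj⟩ := h.exists_algHom hF' ((r : RA →ₐ[ℂ] F).comp υA)
    ((s : RB →ₐ[ℂ] F).comp υB) (hA.cover.isometric.completelyContractive.comp_starHom r)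
    (hB.cover.isometric.completelyContractive.comp_starHom s)
  obtain ⟨f, hf⟩ := hP.exists_starHom hF' κ hκ
  have hυP := hP.cover.isometric.completelyContractive
  have hι' : CompletelyContractive A (υP.comp ι) := fun n X =>
    (hυP n (X.map ι)).trans (h.isometric_left n X).le
  have hj' : CompletelyContractive B (υP.comp j) := fun n X =>
    (hυP n (X.map j)).trans (h.isometric_right n X).le
  obtain ⟨gA, hgA⟩ := hA.exists_starHom hP.isResiduallyFinite (υP.comp ι) hι'
  obtain ⟨gB, hgB⟩ := hB.exists_starHom hP.isResiduallyFinite (υP.comp j) hj'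
  -- Conversely, A and B map through P into the RFD algebra RP; these maps extend to RA and RB by
  -- maximality and combine on F.
  obtain ⟨g, ⟨hgr, hgs⟩, -⟩ := hF.universal RP gA gB
  have hfg : f.comp g = StarAlgHom.id ℂ F := by
    have hr : (f.comp g).comp r = r := by
      refine starHom_ext_of_topologicalClosure_adjoin hA.cover.generates _ _ ?_
      rintro _ ⟨a, rfl⟩
      change f (g (r (υA a))) = r (υA a)
      rw [hgr, hgA]
      exact (hf _).trans (hκι a)
    have hs : (f.comp g).comp s = s := by
      refine starHom_ext_of_topologicalClosure_adjoin hB.cover.generates _ _ ?_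
      rintro _ ⟨b, rfl⟩
      change f (g (s (υB b))) = s (υB b)
      rw [hgs, hgB]
      exact (hf _).trans (hκj b)
    exact hF.hom_ext (fun x => DFunLike.congr_fun hr x) fun y => DFunLike.congr_fun hs y
  have hgκ : (g : F →ₐ[ℂ] RP).comp κ = υP := by
    refine h.algHom_ext ((continuous_starHom g).comp hκ.continuous) hυP.continuous
      (fun a => ?_) fun b => ?_
    · change g (κ (ι a)) = υP (ι a)
      rw [hκι]
      exact (hgr _).trans (hgA a)
    · change g (κ (j b)) = υP (j b)
      rw [hκj]
      exact (hgs _).trans (hgB b)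
  have hgf : g.comp f = StarAlgHom.id ℂ RP := by
    refine starHom_ext_of_topologicalClosure_adjoin hP.cover.generates _ _ ?_
    rintro _ ⟨p, rfl⟩
    change g (f (υP p)) = υP p
    rw [hf]
    exact DFunLike.congr_fun hgκ p
  exact ⟨StarAlgEquiv.ofStarAlgHom f g hgf hfg⟩

end IsFreeProduct

end FreeProduct

theorem theorem4p11
    {H K : Type u}
    [NormedAddCommGroup H] [InnerProductSpace ℂ H] [CompleteSpace H] [Nontrivial H]
    [NormedAddCommGroup K] [InnerProductSpace ℂ K] [CompleteSpace K] [Nontrivial K]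
    (A : Subalgebra ℂ (H →L[ℂ] H)) (B : Subalgebra ℂ (K →L[ℂ] K))
    (hA : IsRFD A) (hB : IsRFD B) :
    -- the objects attached to `A` and `B` exist
    HasFreeProduct A B ∧ HasRFDMaximalCover A ∧ HasRFDMaximalCover B ∧
    -- the free product is RFD, so that its RFD-maximal C*-cover exists
    (∀ (L : Type u) [NormedAddCommGroup L] [InnerProductSpace ℂ L] [CompleteSpace L]
      (P : Subalgebra ℂ (L →L[ℂ] L)) (ι : A →ₐ[ℂ] P) (j : B →ₐ[ℂ] P),
      IsFreeProduct A B P ι j → IsRFD P ∧ HasRFDMaximalCover P) ∧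
    -- the C*-algebraic free product of the RFD-maximal C*-covers exists
    (∀ (RA RB : Type u) [CStarAlgebra RA] [CStarAlgebra RB]
      (υA : A →ₐ[ℂ] RA) (υB : B →ₐ[ℂ] RB),
      IsRFDMaximalCover A υA → IsRFDMaximalCover B υB → HasCStarFreeProduct RA RB) ∧
    -- `R(A * B) ≅ R(A) * R(B)`
    (∀ (L : Type u) [NormedAddCommGroup L] [InnerProductSpace ℂ L] [CompleteSpace L]
      (P : Subalgebra ℂ (L →L[ℂ] L)) (ι : A →ₐ[ℂ] P) (j : B →ₐ[ℂ] P)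
      (RA RB RP F : Type u) [CStarAlgebra RA] [CStarAlgebra RB] [CStarAlgebra RP]
      [CStarAlgebra F] (υA : A →ₐ[ℂ] RA) (υB : B →ₐ[ℂ] RB) (υP : P →ₐ[ℂ] RP)
      (r : RA →⋆ₐ[ℂ] F) (s : RB →⋆ₐ[ℂ] F),
      IsFreeProduct A B P ι j → IsRFDMaximalCover A υA → IsRFDMaximalCover B υB →
        IsRFDMaximalCover P υP → IsCStarFreeProduct r s → Nonempty (RP ≃⋆ₐ[ℂ] F)) := by
  refine ⟨hasFreeProduct_of_isRFD hA hB, hA.hasRFDMaximalCover, hB.hasRFDMaximalCover, ?_, ?_, ?_⟩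
  · intro L _ _ _ P ι j h
    have := h.isometric_left.nontrivial
    have hP := h.isRFD hA hB
    exact ⟨hP, hP.hasRFDMaximalCover⟩
  · intro RA RB _ _ υA υB hRA hRB
    have := hRA.cover.isometric.nontrivial
    have := hRB.cover.isometric.nontrivial
    obtain ⟨F, _, r, s, h, -⟩ :=
      exists_isCStarFreeProduct hRA.isResiduallyFinite hRB.isResiduallyFinite
    exact ⟨F, _, r, s, h⟩
  · intro L _ _ _ P ι j RA RB RP F _ _ _ _ υA υB υP r s h hRA hRB hRP hF
    exact h.nonempty_starAlgEquiv hRA hRB hRP hF
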